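/- Fix an integer $n\ge 2$. For $1\le k\le n-1$ let $\mathbb X_k=\mathrm{Gr}(k,n)\times\mathbb C^\times$, where $\mathrm{Gr}(k,n)$ is the set of $k$-dimensional subspaces of $\mathbb C^n$; write $N|t$ for the point $(N,t)$. For a $k$-subset $J\subset\{1,\dots,n\}$ let $P_J(N)$ be the Plücker coordinate of $N$, i.e. the minor with row set $J$ of an $n\times k$ matrix whose columns form a basis of $N$ (these are defined up to a common nonzero scalar). For any finite set $J$ of integers, let $P_J(N)=P_{J'}(N)$, where $J'\subset\{1,\dots,n\}$ is the set of residues of $J$ modulo $n$, and $P_{J'}(N)=0$ if $|J'|\ne k$. Let $[a,b]$ denote the set of integers $m$ with $a\le m\le b$. When all $P_{[j-k,j-1]}(N)$, $1\le j\le n$, are nonzero, let $g(N|t)$ be the $n\times n$ matrix over $\mathbb C[\lambda]$ ($\lambda$ an indeterminate) with entries $$g(N|t)_{ij}=c_{ij}\,\frac{P_{[j-k+1,j-1]\cup\{i\}}(N)}{P_{[j-k,j-1]}(N)},\qquad c_{ij}=\begin{cases}1&\text{if } j\le k,\\ t&\text{if } j>k\text{ and } i\ge j,\\ \lambda&\text{if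 } j>k\text{ and } i<j.\end{cases}$$ Call $N|t$ *positive* if $t$ is a positive real number and, for a suitable choice of the common scalar, $P_J(N)>0$ for all $k$-subsets $J\subset\{1,\dots,n\}$; $g$ is defined at every positive point. (1) Let $k_1,\dots,k_d\in\{1,\dots,n-1\}$, let $t_1,\dots,t_d\in\mathbb C^\times$ be distinct, and let $M_i,N_i\in\mathrm{Gr}(k_i,n)$ be such that all $M_i|t_i$ and $N_i|t_i$ are positive. If $$g(M_1|t_1)\cdots g(M_d|t_d)=g(N_1|t_1)\cdots g(N_d|t_d),$$ then $M_i=N_i$ for all $i$. (2) Let $k_1,k_2\in\{1,\dots,n-1\}$, and let $M|s\in\mathbb X_{k_1}$ and $N|t\in\mathbb X_{k_2}$ be positive with $s\ne t$. Then there is exactly one pair $(N',M')\in\mathrm{Gr}(k_2,n)\times\mathrm{Gr}(k_1,n)$ such that $N'|t$ and $M'|s$ are positive and $$g(M|s)\,g(N|t)=g(N'|t)\,g(M'|s).$$ -/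

import Mathlib

open scoped ComplexOrder Polynomial

namespace GeometricR

/-- Maximal minor of an `n × k` matrix `A` on the rows in `I`, taken in the order in which they
appear in `A`; it is `0` if `I` does not have exactly `k` elements. -/
noncomputable def maxMinor {n k : ℕ} (A : Matrix (Fin n) (Fin k) ℂ) (I : Finset (Fin n)) : ℂ :=
  if h : I.card = k then (A.submatrix (I.orderEmbOfFin h) id).det else 0

/-- The Grassmannian `Gr(k, n)` of `k`-dimensional subspaces of `ℂ^n`. -/
abbrev Gr (n k : ℕ) : Type :=
  {N : Submodule ℂ (Fin n → ℂ) // Module.finrank ℂ N = k}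

/-- An `n × k` matrix whose columns form a basis of the subspace `N`. -/
noncomputable def Gr.rep {n k : ℕ} (N : Gr n k) : Matrix (Fin n) (Fin k) ℂ :=
  Matrix.of fun i j => (Module.finBasisOfFinrankEq ℂ N.1 N.2 j : Fin n → ℂ) i

/-- Plücker coordinates of `N`, computed from the matrix representative `N.rep`. They are
projective: `Gr.plucker_of_span` shows that any other representative gives the same
coordinates up to one common nonzero scalar. -/
noncomputable def Gr.plucker {n k : ℕ} (N : Gr n k) (I : Finset (Fin n)) : ℂ :=
  maxMinor N.rep I

theorem maxMinor_mul {n k : ℕ} (A : Matrix (Fin n) (Fin k) ℂ) (B : Matrix (Fin k) (Fin k) ℂ)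
    (I : Finset (Fin n)) : maxMinor (A * B) I = B.det * maxMinor A I := by
  unfold maxMinor
  split_ifs with h
  · rw [← Matrix.submatrix_mul_equiv A B _ (Equiv.refl _) _, Matrix.det_mul, mul_comm]
    simp
  · simp

theorem Gr.plucker_of_span {n k : ℕ} (N : Gr n k) (A : Matrix (Fin n) (Fin k) ℂ)
    (hA : Submodule.span ℂ (Set.range A.transpose) = N.1) :
    ∃ c : ℂ, c ≠ 0 ∧ ∀ I : Finset (Fin n), maxMinor A I = c * N.plucker I := by
  let b := Module.finBasisOfFinrankEq ℂ N.1 N.2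
  have hmem : ∀ j, A.transpose j ∈ N.1 := fun j => hA ▸ Submodule.subset_span ⟨j, rfl⟩
  have hli : LinearIndependent ℂ A.transpose := by
    refine linearIndependent_iff_card_eq_finrank_span.mpr ?_
    rw [Fintype.card_fin]
    exact (N.2.symm.trans (by rw [← hA]; rfl))
  let v : Fin k → N.1 := fun j => ⟨A.transpose j, hmem j⟩
  have hv : LinearIndependent ℂ v :=
    LinearIndependent.of_comp N.1.subtype hli
  have hAB : A = N.rep * b.toMatrix v := by
    ext i j
    have := congrArg (fun x : N.1 => (x : Fin n → ℂ) i) (b.sum_toMatrix_smul_self v j)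
    simp only [Submodule.coe_sum, Submodule.coe_smul, Finset.sum_apply, Pi.smul_apply,
      smul_eq_mul] at this
    rw [Matrix.mul_apply]
    simp only [Gr.rep, Matrix.of_apply]
    rw [show A i j = ((v j : N.1) : Fin n → ℂ) i from rfl, ← this]
    exact Finset.sum_congr rfl fun x _ => mul_comm _ _
  refine ⟨(b.toMatrix v).det, ?_, fun I => ?_⟩
  · let b' := basisOfLinearIndependentOfCardEqFinrank' v hv (by simp [N.2])
    have h := b.toMatrix_mul_toMatrix_flip b'
    have hb' : (b' : Fin k → N.1) = v := by simp [b']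
    rw [hb'] at h
    intro h0
    have := congrArg Matrix.det h
    rw [Matrix.det_mul, h0] at this
    simp at this
  · conv_lhs => rw [hAB]
    rw [maxMinor_mul]
    rfl

/-- The set of residues modulo `n` of a finite set of integers, as a subset of the row set
`Fin n`. Rows and columns are numbered from `0` here, so that the `i`-th row (or column) in the
usual numbering `1, …, n` is `i - 1 : Fin n`; all the index sets below are shifted by the same
amount. -/
def residues (n : ℕ) (S : Finset ℤ) : Finset (Fin n) :=
  Finset.univ.filter fun i => ∃ m ∈ S, m ≡ ((i : ℕ) : ℤ) [ZMOD (n : ℤ)]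

/-- The variety `X_k = Gr(k, n) × ℂ^×`; the pair `(N, t)` is the point `N|t`. -/
abbrev X (n k : ℕ) : Type := Gr n k × ℂˣ

/-- The matrix `g(N|t)`, with entries in `ℂ[lam]`; the loop parameter `lam` is the polynomial
variable. -/
noncomputable def g {n k : ℕ} (x : X n k) : Matrix (Fin n) (Fin n) ℂ[X] :=
  Matrix.of fun i j =>
    (if (j : ℕ) < k then 1
      else if j ≤ i then Polynomial.C (x.2 : ℂ)
      else Polynomial.X) *
    Polynomial.C
      (x.1.plucker (residues n
          (Finset.Icc ((j : ℤ) - k + 1) ((j : ℤ) - 1) ∪ {(i : ℤ)})) /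
        x.1.plucker (residues n (Finset.Icc ((j : ℤ) - k) ((j : ℤ) - 1))))

/-- `N|t` is positive: `t > 0`, and the (projective) Plücker coordinates of `N` are all
positive, that is, they are so after multiplication by a common nonzero scalar. In the order on
`ℂ` that is used here, `0 < z` says that `z` is real and positive. -/
def IsPositive {n k : ℕ} (x : X n k) : Prop :=
  0 < (x.2 : ℂ) ∧
    ∃ c : ℂ, c ≠ 0 ∧ ∀ J : Finset (Fin n), J.card = k → 0 < c * x.1.plucker J

/-- The set of `(N₁|t₁, …, N_d|t_d)` in `X_{k₁} × ⋯ × X_{k_d}` for which every `N_i|t_i` is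
positive and the `t_i` are distinct. -/
def positiveLocus (n : ℕ) {d : ℕ} (k : Fin d → ℕ) : Set ((i : Fin d) → X n (k i)) :=
  {x | (∀ i, IsPositive (x i)) ∧ Function.Injective fun i => (x i).2}

/-- `g(x₁, …, x_d) = g(x₁) ⋯ g(x_d)`, the product taken in this order. -/
noncomputable def gProd {n d : ℕ} {k : Fin d → ℕ} (x : (i : Fin d) → X n (k i)) :
    Matrix (Fin n) (Fin n) ℂ[X] :=
  (List.ofFn fun i => g (x i)).prod

end GeometricR

/-! Write k = m + 1. The rows of a matrix representing `N` are continued to a sequence `u` of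
vectors indexed by ℤ with (-1)^m t · u(i + n) = u(i). The sign compensates the cyclic permutation of
the rows of a minor, so moving a row by one period changes minors by powers of t only, and
positivity is cyclically symmetric. The matrix g(N|t) unfolds to an n-periodic band matrix B_u
(`bandEntry`), as g has entries B(i, j) + λ B(i + n, j). Column j of B_u is supported on [j, j + n -
m - 1], with nonzero top entry and bottom entry 1. Evaluating λ at a number lam means letting B_u
act on sequences with lam · x(i + n) = x(i).

Algebra. Let lam₀ = (-1)^m t. At lam₀ the range of g is exactly N (`Nondegenerate.bandOp_inSpan`,
`Nondegenerate.exists_preimage`); at every other nonzero value g is invertible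
(`eq_zero_of_bandOp_eq_zero`); and a finitely supported sequence whose fold at lam₀ lies in N can be
divided by B_u, which shortens it by n - m - 1 (`exists_bandOp_eq`). The first two facts give all
uniqueness statements: for distinct positive parameters the values lam₀ are distinct, so the range
of a product at the value of its leftmost factor is the subspace of that factor, which can then be
cancelled.

Existence. The new factors are forced: v' = B_u v, and u' is the solution of B_{v'} u' = u. Each
column of B_u B_v - B_{v'} B_{u'} has its folds at both special values in the right spans, hence is
divisible by B_{v'}, with a quotient too short to be nonzero (`bandEntry_exchange`). The same
division argument shows that consecutive minors of u' do not vanish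
(`det_window_ne_zero_of_exchange`).

Positivity is obtained by continuity. A nonnegative point with positive cyclically consecutive
minors is positive, by the three-term Plücker relations (`pos_of_arcs`). So along a path on which
consecutive minors do not vanish positivity is both open and closed (`totallyPositive_path`). If m₂
≤ m₁, consecutive minors of v' are positive by Cauchy–Binet, because minors of B_u on consecutive
rows are, up to positive factors, minors of the twist of u, which is again positive
(`TotallyPositive.twist`). Deforming B_u to its diagonal then gives positivity of v'. For u' the
operator B_{v'} is deformed to a shift if t < s and to a diagonal operator if s < t, so that the
moving parameter never meets s. The case m₁ < m₂ follows by anti-transposition, which reverses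
products (`TotallyPositive.bandEntry_dual`). -/

namespace GeometricR

set_option linter.unusedSectionVars false

/-! ### Quasi-periodic sequences, band operators and folding. -/

section Operators

variable {K : Type*} [Field K] {E : Type*} [AddCommGroup E] [Module K E] {m n : ℕ}

/-- A two-sided sequence with `lam • x (i + n) = x i`. -/
def QuasiPeriodic (n : ℕ) (lam : K) (x : ℤ → E) : Prop := ∀ i, lam • x (i + n) = x i

/-- The square matrix whose rows are `m + 1` consecutive terms of `u`, starting at `a`. -/
def window (u : ℤ → Fin (m + 1) → K) (a : ℤ) : Matrix (Fin (m + 1)) (Fin (m + 1)) K :=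
  Matrix.of fun r => u (a + (r : ℕ))

/-- The linear form `x ↦ det (u (j - m), …, u (j - 1), x)`. -/
noncomputable def bracket (u : ℤ → Fin (m + 1) → K) (j : ℤ) : (Fin (m + 1) → K) →ₗ[K] K :=
  (Matrix.detRowAlternating (n := Fin (m + 1)) (R := K)).toMultilinearMap.toLinearMap
    (window u (j - m)) (Fin.last m)

/-- The entries of the band matrix that unfolds `g`. -/
noncomputable def bandEntry (n : ℕ) (t : K) (u : ℤ → Fin (m + 1) → K) (i j : ℤ) : K :=
  if j ≤ i ∧ i + (m + 1) ≤ j + n then t * bracket u j (u i) / (window u (j - m - 1)).det else 0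

/-- The action of an infinite matrix supported on `j ≤ i ≤ j + n`. -/
noncomputable def bandOp (n : ℕ) (a : ℤ → ℤ → K) (x : ℤ → E) (i : ℤ) : E :=
  ∑ j ∈ Finset.Icc (i - n) i, a i j • x j

/-- `x` vanishes outside the interval `[a, b]`. -/
def SupportedIn (x : ℤ → E) (a b : ℤ) : Prop := ∀ i, i < a ∨ b < i → x i = 0

/-- The quasi-periodic sequence obtained from a finitely supported one. -/
noncomputable def fold (n : ℕ) (lam : K) (x : ℤ → E) (i : ℤ) : E :=
  ∑ᶠ q : ℤ, lam ^ q • x (i + q * n)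

theorem window_apply (u : ℤ → Fin (m + 1) → K) (a : ℤ) (r : Fin (m + 1)) :
    window u a r = u (a + (r : ℕ)) := rfl

theorem bracket_apply (u : ℤ → Fin (m + 1) → K) (j : ℤ) (x : Fin (m + 1) → K) :
    bracket u j x = ((window u (j - m)).updateRow (Fin.last m) x).det := rfl

theorem bracket_self (u : ℤ → Fin (m + 1) → K) (j : ℤ) :
    bracket u j (u j) = (window u (j - m)).det := by
  rw [bracket_apply]
  congr 1
  conv_rhs => rw [← Matrix.updateRow_eq_self (window u (j - m)) (Fin.last m)]
  rw [window_apply, Fin.val_last, sub_add_cancel]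

theorem bracket_eq_zero (u : ℤ → Fin (m + 1) → K) {i j : ℤ} (h1 : j - m ≤ i) (h2 : i < j) :
    bracket u j (u i) = 0 := by
  rw [bracket_apply]
  obtain ⟨r, hr⟩ := Int.eq_ofNat_of_zero_le (sub_nonneg.mpr h1)
  have hrm : r < m := by omega
  have hne : (⟨r, by omega⟩ : Fin (m + 1)) ≠ Fin.last m := by
    intro h; simp [Fin.ext_iff] at h; omega
  refine Matrix.det_zero_of_row_eq hne ?_
  rw [Matrix.updateRow_self, Matrix.updateRow_ne hne]
  rw [window_apply]
  congr 1
  simp only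
  omega

/-- The rows are those of the window at `j - m - 1` with the first one moved to the end, a cycle of
length `m + 1`. Its sign is the reason for the sign in the multiplier `(-1) ^ m * t`. -/
theorem bracket_rotate (u : ℤ → Fin (m + 1) → K) (j : ℤ) :
    bracket u j (u (j - m - 1)) = (-1) ^ m * (window u (j - m - 1)).det := by
  rw [bracket_apply]
  have h : (window u (j - m)).updateRow (Fin.last m) (u (j - m - 1)) =
      (window u (j - m - 1)).submatrix (finRotate (m + 1)) id := by
    ext r c
    refine Fin.lastCases ?_ (fun r => ?_) r
    · rw [Matrix.updateRow_self, Matrix.submatrix_apply, finRotate_last, window_apply]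
      simp
    · rw [Matrix.updateRow_ne (Fin.castSucc_lt_last r).ne, Matrix.submatrix_apply, window_apply,
        window_apply, finRotate_apply, Fin.coeSucc_eq_succ, Fin.val_succ, Fin.val_castSucc]
      congr 1
      push_cast
      ring_nf
  rw [h, Matrix.det_permute, sign_finRotate]
  simp

theorem QuasiPeriodic.map {F : Type*} [AddCommGroup F] [Module K F] {lam : K} {x : ℤ → E}
    (hx : QuasiPeriodic n lam x) (f : E →ₗ[K] F) : QuasiPeriodic n lam fun i => f (x i) := by
  intro i
  rw [← map_smul, hx i]

theorem QuasiPeriodic.zpow_smul {lam : K} (hl : lam ≠ 0) {x : ℤ → E}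
    (hx : QuasiPeriodic n lam x) (i q : ℤ) : lam ^ q • x (i + q * n) = x i := by
  induction q with
  | zero => simp
  | succ q ih =>
    rw [← ih, zpow_add_one₀ hl, mul_smul, add_mul, one_mul, ← add_assoc, hx]
  | pred q ih =>
    rw [← ih, ← hx (i + (-(q : ℤ) - 1) * n), smul_smul, ← zpow_add_one₀ hl]
    congr 2 <;> ring

theorem QuasiPeriodic.eq_zero_of_window {lam : K} (hl : lam ≠ 0) (hn : 0 < n) {x : ℤ → E}
    (hx : QuasiPeriodic n lam x) (a : ℤ) (h : ∀ i, a ≤ i → i < a + n → x i = 0) (i : ℤ) :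
    x i = 0 := by
  have hn' : (0 : ℤ) < n := by exact_mod_cast hn
  have h1 := Int.emod_nonneg (i - a) hn'.ne'
  have h2 := Int.emod_lt_of_pos (i - a) hn'
  have h3 : (i - a) % n + (i - a) / n * n = i - a := Int.emod_add_ediv_mul (i - a) n
  have h4 := hx.zpow_smul hl (a + (i - a) % n) ((i - a) / n)
  have h5 : a + (i - a) % n + (i - a) / n * n = i := by linarith
  rw [h5, h (a + (i - a) % n) (by linarith) (by linarith)] at h4
  exact (smul_eq_zero.mp h4).resolve_left (zpow_ne_zero _ hl)

theorem QuasiPeriodic.sub {lam : K} {x y : ℤ → E} (hx : QuasiPeriodic n lam x)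
    (hy : QuasiPeriodic n lam y) : QuasiPeriodic n lam fun i => x i - y i := by
  intro i
  rw [smul_sub, hx, hy]

theorem QuasiPeriodic.eq_of_window {lam : K} (hl : lam ≠ 0) (hn : 0 < n) {x y : ℤ → E}
    (hx : QuasiPeriodic n lam x) (hy : QuasiPeriodic n lam y) (a : ℤ)
    (h : ∀ i, a ≤ i → i < a + n → x i = y i) : x = y := by
  funext i
  exact sub_eq_zero.mp ((hx.sub hy).eq_zero_of_window hl hn a
    (fun i h1 h2 => sub_eq_zero.mpr (h i h1 h2)) i)

/-! ### Folding -/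

theorem SupportedIn.finite {x : ℤ → E} {a b : ℤ} (hx : SupportedIn x a b) (hn : 0 < n) (lam : K)
    (i : ℤ) : (Function.support fun q : ℤ => lam ^ q • x (i + q * n)).Finite := by
  refine (Set.finite_Icc (min (a - i) 0) (max (b - i) 0)).subset fun q hq => ?_
  have hx' : x (i + q * n) ≠ 0 := fun h => hq (by simp [h])
  have h1 : a ≤ i + q * n := by
    by_contra h; exact hx' (hx _ (Or.inl (by omega)))
  have h2 : i + q * n ≤ b := by
    by_contra h; exact hx' (hx _ (Or.inr (by omega)))
  have hn' : (1 : ℤ) ≤ n := by exact_mod_cast hn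
  rcases le_total 0 q with h | h
  · refine ⟨(min_le_right _ _).trans h, le_max_of_le_left ?_⟩
    nlinarith
  · refine ⟨min_le_of_left_le ?_, h.trans (le_max_right _ _)⟩
    nlinarith

theorem fold_quasiPeriodic (lam : K) (hl : lam ≠ 0) (x : ℤ → E) :
    QuasiPeriodic n lam (fold n lam x) := by
  intro i
  unfold fold
  rw [smul_finsum]
  rw [← finsum_comp_equiv (Equiv.addRight (1 : ℤ)) (f := fun q : ℤ => lam ^ q • x (i + q * n))]
  refine finsum_congr fun q => ?_
  simp only [Equiv.coe_addRight]
  rw [smul_smul, zpow_add_one₀ hl, mul_comm lam]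
  congr 2; ring

theorem fold_apply {lam : K} (hn : 0 < n) {x : ℤ → E} {a : ℤ}
    (hx : SupportedIn x a (a + 2 * n - 1)) {i : ℤ} (h1 : a ≤ i) (h2 : i < a + n) :
    fold n lam x i = x i + lam • x (i + n) := by
  unfold fold
  have hn' : (1 : ℤ) ≤ n := by exact_mod_cast hn
  rw [finsum_eq_sum_of_support_subset (s := {0, 1})]
  · rw [Finset.sum_pair zero_ne_one]; simp
  · intro q hq
    have hx' : x (i + q * n) ≠ 0 := fun h => hq (by simp [h])
    have h3 : a ≤ i + q * n := by
      by_contra h; exact hx' (hx _ (Or.inl (by omega)))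
    have h4 : i + q * n ≤ a + 2 * n - 1 := by
      by_contra h; exact hx' (hx _ (Or.inr (by omega)))
    have h5 : -1 < q := by nlinarith
    have h6 : q < 2 := by nlinarith
    have : q = 0 ∨ q = 1 := by omega
    simpa using this

theorem fold_apply_of_lt {lam : K} (hn : 0 < n) {x : ℤ → E} {a : ℤ}
    (hx : SupportedIn x a (a + n - 1)) {i : ℤ} (h1 : a ≤ i) (h2 : i < a + n) :
    fold n lam x i = x i := by
  rw [fold_apply hn (a := a) (fun i hi => hx i (by omega)) h1 h2, hx (i + n) (by omega), smul_zero,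
    add_zero]

/-- Finitely supported sequences stand for vectors of Laurent polynomials and folding for evaluation
at `lam`. A periodic matrix is linear over Laurent polynomials, hence compatible with evaluation. -/
theorem fold_bandOp {lam : K} (hn : 0 < n) {A : ℤ → ℤ → K}
    (hA : ∀ i j, A (i + n) (j + n) = A i j) {x : ℤ → E} {a b : ℤ} (hx : SupportedIn x a b) :
    fold n lam (bandOp n A x) = bandOp n A (fold n lam x) := by
  have hA' : ∀ q i j : ℤ, A (i + q * n) (j + q * n) = A i j := by
    intro q i j
    induction q with
    | zero => simp
    | succ q ih => rw [← ih, ← hA (i + q * n)]; congr 1 <;> ring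
    | pred q ih => rw [← ih, ← hA (i + (-(q:ℤ)-1) * n)]; congr 1 <;> ring
  funext i
  unfold fold bandOp
  have : ∀ q : ℤ, lam ^ q • ∑ j ∈ Finset.Icc (i + q * n - n) (i + q * n), A (i + q * n) j • x j =
      ∑ j ∈ Finset.Icc (i - n) i, A i j • (lam ^ q • x (j + q * n)) := by
    intro q
    rw [Finset.smul_sum]
    refine Finset.sum_bij' (fun j _ => j - q * n) (fun j _ => j + q * n) ?_ ?_ ?_ ?_ ?_
    · intro j hj; simp only [Finset.mem_Icc] at hj ⊢; constructor <;> linarith [hj.1, hj.2]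
    · intro j hj; simp only [Finset.mem_Icc] at hj ⊢; constructor <;> linarith [hj.1, hj.2]
    · intro j _; ring
    · intro j _; ring
    · intro j _
      rw [← hA' q i (j - q * n), sub_add_cancel, smul_comm]
  simp only [this]
  rw [finsum_sum_comm]
  · refine Finset.sum_congr rfl fun j _ => ?_
    rw [smul_finsum]
  · intro j _
    refine ((hx.finite hn lam j)).subset fun q hq => ?_
    intro h
    apply hq
    simp only at h ⊢
    rw [h, smul_zero]

theorem fold_truncate {lam : K} (hl : lam ≠ 0) (hn : 0 < n) {x : ℤ → E}
    (hx : QuasiPeriodic n lam x) (a : ℤ) :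
    fold n lam (fun i => if a ≤ i ∧ i < a + n then x i else 0) = x := by
  refine QuasiPeriodic.eq_of_window hl hn (fold_quasiPeriodic lam hl _) hx a fun i h1 h2 => ?_
  rw [fold_apply_of_lt hn (a := a) _ h1 h2, if_pos ⟨h1, h2⟩]
  intro j hj
  exact if_neg (by omega)

theorem bandOp_quasiPeriodic {lam : K} {A : ℤ → ℤ → K}
    (hA : ∀ i j, A (i + n) (j + n) = A i j) {x : ℤ → E} (hx : QuasiPeriodic n lam x) :
    QuasiPeriodic n lam (bandOp n A x) := by
  intro i
  unfold bandOp
  rw [Finset.smul_sum]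
  symm
  refine Finset.sum_bij' (fun j _ => j + n) (fun j _ => j - n) ?_ ?_ ?_ ?_ ?_
  · intro j hj; simp only [Finset.mem_Icc] at hj ⊢; omega
  · intro j hj; simp only [Finset.mem_Icc] at hj ⊢; omega
  · intro j _; ring
  · intro j _; ring
  · intro j _
    rw [hA, smul_comm, hx]

theorem bandOp_add (A : ℤ → ℤ → K) (x y : ℤ → E) :
    bandOp n A (fun i => x i + y i) = fun i => bandOp n A x i + bandOp n A y i := by
  funext i; simp [bandOp, Finset.sum_add_distrib]

theorem bandOp_sub (A : ℤ → ℤ → K) (x y : ℤ → E) :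
    bandOp n A (fun i => x i - y i) = fun i => bandOp n A x i - bandOp n A y i := by
  funext i; simp [bandOp, smul_sub, Finset.sum_sub_distrib]

theorem bandOp_smul (A : ℤ → ℤ → K) (c : K) (x : ℤ → E) :
    bandOp n A (fun i => c • x i) = fun i => c • bandOp n A x i := by
  funext i; simp [bandOp, Finset.smul_sum, smul_comm c]

theorem bandOp_map {F : Type*} [AddCommGroup F] [Module K F] (A : ℤ → ℤ → K) (f : E →ₗ[K] F)
    (x : ℤ → E) : bandOp n A (fun i => f (x i)) = fun i => f (bandOp n A x i) := by
  funext i; simp [bandOp]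

end Operators

theorem sum_Icc_eq {M : Type*} [AddCommMonoid M] (m : ℕ) (a : ℤ) (f : ℤ → M) :
    ∑ j ∈ Finset.Icc a (a + m), f j = ∑ r : Fin (m + 1), f (a + (r : ℕ)) := by
  symm
  refine Finset.sum_bij (fun r _ => a + (r : ℕ)) ?_ ?_ ?_ ?_
  · intro r _; simp only [Finset.mem_Icc]; omega
  · intro r _ s _ h; ext; omega
  · intro j hj
    simp only [Finset.mem_Icc] at hj
    exact ⟨⟨(j - a).toNat, by omega⟩, Finset.mem_univ _, by simp only; omega⟩
  · intro r _; rfl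

/-! ### The band matrix of a nondegenerate point: range, kernel and division. -/

section Band

variable {K : Type*} [Field K] {E : Type*} [AddCommGroup E] [Module K E] {m n : ℕ}

/-- `u` lists the rows of a matrix whose columns span a subspace of dimension `m + 1`, continued
quasi-periodically, and no `m + 1` consecutive rows are dependent. -/
structure Nondegenerate (n : ℕ) (t : K) (u : ℤ → Fin (m + 1) → K) : Prop where
  lt : m + 1 < n
  ne_zero : t ≠ 0
  periodic : QuasiPeriodic n ((-1) ^ m * t) u
  det_ne : ∀ a, (window u a).det ≠ 0

/-- The sequences in the span of the columns of `u`. -/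
def InSpan (u : ℤ → Fin (m + 1) → K) (x : ℤ → K) : Prop :=
  ∃ h : (Fin (m + 1) → K) →ₗ[K] K, ∀ i, x i = h (u i)

theorem InSpan.sub {u : ℤ → Fin (m + 1) → K} {x y : ℤ → K} (hx : InSpan u x) (hy : InSpan u y) :
    InSpan u fun i => x i - y i := by
  obtain ⟨h, hh⟩ := hx
  obtain ⟨h', hh'⟩ := hy
  exact ⟨h - h', fun i => by simp [hh, hh']⟩

theorem twist_ne {t : K} (ht : t ≠ 0) : (-1) ^ m * t ≠ 0 :=
  mul_ne_zero (pow_ne_zero _ (neg_ne_zero.mpr one_ne_zero)) ht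

theorem bandEntry_of_not {t : K} {u : ℤ → Fin (m + 1) → K} {i j : ℤ}
    (h : ¬ (j ≤ i ∧ i + (m + 1) ≤ j + n)) : bandEntry n t u i j = 0 := if_neg h

theorem window_add {lam : K} {u : ℤ → Fin (m + 1) → K} (hu : QuasiPeriodic n lam u) (a : ℤ) :
    lam • window u (a + n) = window u a := by
  ext r c
  have := congrFun (hu (a + (r : ℕ))) c
  rw [Matrix.smul_apply, window_apply, window_apply, ← this]
  rw [add_right_comm]
  rfl

theorem det_window_add {lam : K} {u : ℤ → Fin (m + 1) → K} (hu : QuasiPeriodic n lam u) (a : ℤ) :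
    lam ^ (m + 1) * (window u (a + n)).det = (window u a).det := by
  rw [← window_add hu a, Matrix.det_smul, Fintype.card_fin]

theorem bracket_add {lam : K} (hl : lam ≠ 0) {u : ℤ → Fin (m + 1) → K}
    (hu : QuasiPeriodic n lam u) (j : ℤ) (x : Fin (m + 1) → K) :
    lam ^ m * bracket u (j + n) x = bracket u j x := by
  have h : ((window u (j - m)).updateRow (Fin.last m) (lam • x)) =
      lam • ((window u (j + n - m)).updateRow (Fin.last m) x) := by
    rw [show j + n - m = j - m + n by ring, ← window_add hu]
    ext r c
    by_cases hr : r = Fin.last m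
    · subst hr; simp
    · simp [hr]
  have h2 : lam * bracket u j x = lam * (lam ^ m * bracket u (j + n) x) := by
    rw [← smul_eq_mul, ← map_smul, bracket_apply, h, Matrix.det_smul, Fintype.card_fin,
      ← bracket_apply, pow_succ]
    ring
  exact (mul_left_cancel₀ hl h2).symm

theorem bandEntry_add {t : K} (ht : t ≠ 0) {u : ℤ → Fin (m + 1) → K}
    (hu : QuasiPeriodic n ((-1) ^ m * t) u) (i j : ℤ) :
    bandEntry n t u (i + n) (j + n) = bandEntry n t u i j := by
  have hl : (-1) ^ m * t ≠ 0 := twist_ne ht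
  unfold bandEntry
  by_cases h : j ≤ i ∧ i + (m + 1) ≤ j + n
  · rw [if_pos h, if_pos (by omega), ← hu i, ← bracket_add hl hu j, map_smul, smul_eq_mul,
      ← det_window_add hu (j - m - 1), show j + n - m - 1 = j - m - 1 + n by ring]
    generalize (-1) ^ m * t = lam at hl
    rw [show t * (lam ^ m * (lam * bracket u (j + n) (u (i + n)))) =
      lam ^ (m + 1) * (t * bracket u (j + n) (u (i + n))) by ring,
      mul_div_mul_left _ _ (pow_ne_zero _ hl)]
  · rw [if_neg h, if_neg (by omega)]

theorem Nondegenerate.twist_ne {t : K} {u : ℤ → Fin (m + 1) → K} (hu : Nondegenerate n t u) :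
    (-1) ^ m * t ≠ 0 := GeometricR.twist_ne hu.ne_zero

theorem Nondegenerate.pos {t : K} {u : ℤ → Fin (m + 1) → K} (hu : Nondegenerate n t u) :
    0 < n := by have := hu.lt; omega

theorem Nondegenerate.bandEntry_add {t : K} {u : ℤ → Fin (m + 1) → K}
    (hu : Nondegenerate n t u) (i j : ℤ) :
    bandEntry n t u (i + n) (j + n) = bandEntry n t u i j :=
  GeometricR.bandEntry_add hu.ne_zero hu.periodic i j

/-- In this row `u` is a multiple of `u (j - m - 1)`; the sign from `bracket_rotate` cancels that of
the multiplier, and `t` cancels too. -/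
theorem Nondegenerate.bandEntry_bottom {t : K} {u : ℤ → Fin (m + 1) → K}
    (hu : Nondegenerate n t u) (j : ℤ) : bandEntry n t u (j + n - m - 1) j = 1 := by
  have hlt := hu.lt
  have hl := hu.twist_ne
  unfold bandEntry
  rw [if_pos (by omega)]
  have h := congrArg (bracket u j) (hu.periodic (j - m - 1))
  rw [map_smul, bracket_rotate, smul_eq_mul, show j - m - 1 + n = j + n - m - 1 by ring] at h
  have hd := hu.det_ne (j - m - 1)
  rw [div_eq_one_iff_eq hd]
  have hs : ((-1 : K) ^ m) ≠ 0 := pow_ne_zero _ (neg_ne_zero.mpr one_ne_zero)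
  rw [mul_assoc] at h
  exact mul_left_cancel₀ hs h

theorem Nondegenerate.bandEntry_self {t : K} {u : ℤ → Fin (m + 1) → K}
    (hu : Nondegenerate n t u) (j : ℤ) :
    bandEntry n t u j j = t * (window u (j - m)).det / (window u (j - m - 1)).det := by
  have hlt := hu.lt
  unfold bandEntry
  rw [if_pos (by omega), bracket_self]

theorem Nondegenerate.bandEntry_self_ne {t : K} {u : ℤ → Fin (m + 1) → K}
    (hu : Nondegenerate n t u) (j : ℤ) : bandEntry n t u j j ≠ 0 := by
  rw [hu.bandEntry_self]
  exact div_ne_zero (mul_ne_zero hu.ne_zero (hu.det_ne _)) (hu.det_ne _)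

/-- The bracket vanishes on its own for `j - m ≤ i < j`, where a row is repeated, and by
quasi-periodicity for `j + n - m ≤ i < j + n`. So the cut-off in `bandEntry` is harmless on this
larger range. -/
theorem Nondegenerate.entry_eq {t : K} {u : ℤ → Fin (m + 1) → K}
    (hu : Nondegenerate n t u) {i j : ℤ} (h1 : j - m ≤ i) (h2 : i < j + n) :
    bandEntry n t u i j = t * bracket u j (u i) / (window u (j - m - 1)).det := by
  unfold bandEntry
  split_ifs with h
  · rfl
  rcases lt_or_ge i j with h3 | h3
  · rw [bracket_eq_zero u h1 h3, mul_zero, zero_div]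
  · have h4 := congrArg (bracket u j) (hu.periodic (i - n))
    rw [sub_add_cancel, map_smul, bracket_eq_zero u (i := i - n) (by omega) (by omega), smul_eq_mul] at h4
    rw [(mul_eq_zero.mp h4).resolve_left hu.twist_ne, mul_zero, zero_div]

/-- The linear form that represents the action of the band matrix of `u` on `x` near position
`a`. -/
noncomputable def localForm (n : ℕ) (t : K) (u : ℤ → Fin (m + 1) → K) (x : ℤ → K) (a : ℤ) :
    (Fin (m + 1) → K) →ₗ[K] K :=
  ∑ j ∈ Finset.Ioc (a - n) a, (t * x j / (window u (j - m - 1)).det) • bracket u j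

/-- The `m + 1` rows ending at `a` can all be computed from the same `n` columns, because the closed
formula of `entry_eq` is valid for each of them. -/
theorem Nondegenerate.bandOp_eq_localForm {t : K} {u : ℤ → Fin (m + 1) → K}
    (hu : Nondegenerate n t u) (x : ℤ → K) {a i : ℤ} (h1 : a - m ≤ i) (h2 : i ≤ a) :
    bandOp n (bandEntry n t u) x i = localForm n t u x a (u i) := by
  unfold bandOp localForm
  have hlt := hu.lt
  rw [LinearMap.sum_apply]
  have e1 : ∑ j ∈ Finset.Icc (i - n) i, bandEntry n t u i j • x j =
      ∑ j ∈ Finset.Icc (i - n) a, bandEntry n t u i j • x j := by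
    refine Finset.sum_subset (Finset.Icc_subset_Icc_right h2) fun j hj hj' => ?_
    simp only [Finset.mem_Icc] at hj hj'
    rw [bandEntry_of_not (by omega), zero_smul]
  have e2 : ∑ j ∈ Finset.Ioc (a - n) a, bandEntry n t u i j • x j =
      ∑ j ∈ Finset.Icc (i - n) a, bandEntry n t u i j • x j := by
    refine Finset.sum_subset (fun j hj => ?_) fun j hj hj' => ?_
    · simp only [Finset.mem_Icc, Finset.mem_Ioc] at hj ⊢; omega
    · simp only [Finset.mem_Icc, Finset.mem_Ioc] at hj hj'
      rw [bandEntry_of_not (by omega), zero_smul]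
  rw [e1, ← e2]
  refine Finset.sum_congr rfl fun j hj => ?_
  simp only [Finset.mem_Ioc] at hj
  rw [hu.entry_eq (by omega) (by omega), LinearMap.smul_apply, smul_eq_mul, smul_eq_mul]
  ring

/-- Column `a + 1 - n` is traded for column `a + 1`. With lam the multiplier, `x` and the bracket
together contribute lam^(m + 1), which cancels against the factor of the denominator. -/
theorem Nondegenerate.localForm_succ {t : K} {u : ℤ → Fin (m + 1) → K}
    (hu : Nondegenerate n t u) {x : ℤ → K} (hx : QuasiPeriodic n ((-1) ^ m * t) x) (a : ℤ) :
    localForm n t u x (a + 1) = localForm n t u x a := by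
  have hn := hu.pos
  have hl := hu.twist_ne
  unfold localForm
  have e1 : Finset.Ioc (a + 1 - n) (a + 1) = insert (a + 1) (Finset.Ioc (a + 1 - n) a) := by
    ext j; simp only [Finset.mem_Ioc, Finset.mem_insert]; omega
  have e2 : Finset.Ioc (a - n) a = insert (a + 1 - n) (Finset.Ioc (a + 1 - n) a) := by
    ext j; simp only [Finset.mem_Ioc, Finset.mem_insert]; omega
  rw [e1, e2, Finset.sum_insert (by simp), Finset.sum_insert (by simp)]
  congr 1
  refine LinearMap.ext fun l => ?_
  rw [LinearMap.smul_apply, LinearMap.smul_apply,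
    smul_eq_mul, smul_eq_mul]
  obtain ⟨b, hb⟩ : ∃ b, a + 1 = b + n := ⟨a + 1 - n, by ring⟩
  rw [hb, add_sub_cancel_right, ← hx b, ← bracket_add hl hu.periodic b,
    ← det_window_add hu.periodic (b - m - 1), show b + n - m - 1 = b - m - 1 + n by ring]
  have hd := hu.det_ne (b - m - 1 + n)
  generalize (-1) ^ m * t = lam at hl
  rw [smul_eq_mul]
  field_simp
  ring

/-- The local forms at different positions coincide, so a single linear form computes the whole
image. This is the half "range contained in `N`" of the description of g at its special value. -/
theorem Nondegenerate.bandOp_inSpan {t : K} {u : ℤ → Fin (m + 1) → K}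
    (hu : Nondegenerate n t u) {x : ℤ → K} (hx : QuasiPeriodic n ((-1) ^ m * t) x) :
    InSpan u (bandOp n (bandEntry n t u) x) := by
  refine ⟨localForm n t u x 0, fun i => ?_⟩
  rw [hu.bandOp_eq_localForm x (a := i) (by omega) le_rfl]
  congr 1
  induction i with
  | zero => rfl
  | succ i ih => rw [hu.localForm_succ hx, ih]
  | pred i ih => rw [← ih, ← hu.localForm_succ hx, sub_add_cancel]

theorem linear_eq_zero_of_det_ne_zero {k : ℕ} {M : Matrix (Fin k) (Fin k) K} (hd : M.det ≠ 0)
    (h : (Fin k → K) →ₗ[K] K) (h0 : ∀ r, h (M r) = 0) : h = 0 := by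
  set c : Fin k → K := fun l => h (Pi.single l 1)
  have hc : ∀ y, h y = y ⬝ᵥ c := by
    intro y
    rw [LinearMap.pi_apply_eq_sum_univ h y]
    simp only [dotProduct, smul_eq_mul, c]
    refine Finset.sum_congr rfl fun l _ => ?_
    congr 2
    funext i
    simp [Pi.single_apply, eq_comm]
  have hz : M.mulVec c = 0 := by
    funext r
    rw [Matrix.mulVec, ← hc]
    exact h0 r
  have := Matrix.eq_zero_of_mulVec_eq_zero hd hz
  ext1 l
  rw [LinearMap.ext_ring_iff]
  exact congrFun this l

theorem linear_eq_zero {u : ℤ → Fin (m + 1) → K} {a : ℤ} (hd : (window u a).det ≠ 0)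
    (h : (Fin (m + 1) → K) →ₗ[K] K) (h0 : ∀ i, a ≤ i → i ≤ a + m → h (u i) = 0) : h = 0 :=
  linear_eq_zero_of_det_ne_zero hd h fun r => h0 _ (by omega) (by omega)

theorem InSpan.eq_zero {u : ℤ → Fin (m + 1) → K} {x : ℤ → K} (hx : InSpan u x) {a : ℤ}
    (hd : (window u a).det ≠ 0) (h0 : ∀ i, a ≤ i → i ≤ a + m → x i = 0) (i : ℤ) : x i = 0 := by
  obtain ⟨h, hh⟩ := hx
  rw [hh, linear_eq_zero hd h fun i h1 h2 => by rw [← hh, h0 i h1 h2]]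
  rfl

theorem SupportedIn.bandOp {t : K} {u : ℤ → Fin (m + 1) → K} {x : ℤ → E} {a b : ℤ}
    (hx : SupportedIn x a b) : SupportedIn (bandOp n (bandEntry n t u) x) a (b + n - m - 1) := by
  intro i hi
  refine Finset.sum_eq_zero fun j _ => ?_
  by_cases h : j ≤ i ∧ i + (m + 1) ≤ j + n
  · rw [hx j (by omega), smul_zero]
  · rw [bandEntry_of_not h, zero_smul]

theorem bandOp_bottom {t : K} {u : ℤ → Fin (m + 1) → K} (hu : Nondegenerate n t u) {x : ℤ → K}
    {a b : ℤ} (hx : SupportedIn x a b) :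
    bandOp n (bandEntry n t u) x (b + n - m - 1) = x b := by
  have := hu.lt
  unfold GeometricR.bandOp
  rw [Finset.sum_eq_single b]
  · rw [hu.bandEntry_bottom, one_smul]
  · intro j _ hj
    rcases lt_or_gt_of_ne hj with h | h
    · rw [bandEntry_of_not (by omega), zero_smul]
    · rw [hx j (Or.inr h), smul_zero]
  · intro h
    simp only [Finset.mem_Icc] at h
    omega

theorem bandOp_top {t : K} {u : ℤ → Fin (m + 1) → K} {x : ℤ → K} {a : ℤ}
    (hx : ∀ i < a, x i = 0) :
    bandOp n (bandEntry n t u) x a = bandEntry n t u a a * x a := by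
  unfold GeometricR.bandOp
  rw [Finset.sum_eq_single a]
  · rfl
  · intro j hj hj'
    simp only [Finset.mem_Icc] at hj
    rw [hx j (by omega), smul_zero]
  · intro h
    simp only [Finset.mem_Icc] at h
    omega

theorem bandOp_injective {t : K} {u : ℤ → Fin (m + 1) → K} (hu : Nondegenerate n t u)
    {x : ℤ → K} {a : ℤ} (hx : ∀ i < a, x i = 0)
    (h : ∀ i, bandOp n (bandEntry n t u) x i = 0) (i : ℤ) : x i = 0 := by
  have key : ∀ N : ℕ, ∀ i < a + N, x i = 0 := by
    intro N
    induction N with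
    | zero => intro i hi; exact hx i (by simpa using hi)
    | succ N ih =>
      intro i hi
      rcases lt_or_ge i (a + N) with h1 | h1
      · exact ih i h1
      · have hi' : i = a + N := by push_cast at hi; omega
        subst hi'
        have := h (a + N)
        rw [bandOp_top ih] at this
        exact (mul_eq_zero.mp this).resolve_left (hu.bandEntry_self_ne _)
  exact key (i - a + 1).toNat i (by omega)

theorem fold_sub {lam : K} (hn : 0 < n) {x y : ℤ → K} {a b c d : ℤ} (hx : SupportedIn x a b)
    (hy : SupportedIn y c d) :
    fold n lam (fun i => x i - y i) = fun i => fold n lam x i - fold n lam y i := by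
  funext i
  unfold fold
  rw [← finsum_sub_distrib (hx.finite hn lam i) (hy.finite hn lam i)]
  exact finsum_congr fun q => smul_sub _ _ _

/-- Folding causes no overlap and leaves `m + 1` consecutive zeros in a period; a member of the span
with that many zeros is zero. -/
theorem eq_zero_of_fold_inSpan {t : K} {u : ℤ → Fin (m + 1) → K} (hu : Nondegenerate n t u)
    {x : ℤ → K} {a b : ℤ} (hx : SupportedIn x a b) (hb : b + m + 2 ≤ a + n)
    (hs : InSpan u (fold n ((-1) ^ m * t) x)) (i : ℤ) : x i = 0 := by
  have hsup : SupportedIn x a (a + n - 1) := fun i hi => hx i (by omega)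
  by_cases hi : a ≤ i ∧ i ≤ b
  · rw [← fold_apply_of_lt (lam := (-1) ^ m * t) hu.pos hsup hi.1 (by omega)]
    refine hs.eq_zero (a := a + n - 1 - m) (hu.det_ne _) (fun i h1 h2 => ?_) i
    rw [fold_apply_of_lt hu.pos hsup (by have := hu.lt; omega) (by omega)]
    exact hx i (by omega)
  · exact hx i (by omega)

/-- Long division: a multiple of column `a` clears the top entry without leaving the span, and one
continues from `a + 1`. The process stops at length `n - m - 1`, where the remainder is zero by
`eq_zero_of_fold_inSpan`. -/
theorem exists_bandOp_eq {t : K} {u : ℤ → Fin (m + 1) → K} (hu : Nondegenerate n t u) (d : ℕ) :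
    ∀ (a : ℤ) (x : ℤ → K), SupportedIn x a (a + d - 1) → InSpan u (fold n ((-1) ^ m * t) x) →
      ∃ y, SupportedIn y a (a + d + m - n) ∧ bandOp n (bandEntry n t u) y = x := by
  have hlt := hu.lt
  have hzero : ∀ (d : ℕ), d + m + 1 ≤ n → ∀ (a : ℤ) (x : ℤ → K), SupportedIn x a (a + d - 1) →
      InSpan u (fold n ((-1) ^ m * t) x) →
      ∃ y, SupportedIn y a (a + d + m - n) ∧ bandOp n (bandEntry n t u) y = x := by
    intro d hd a x hx hs
    refine ⟨fun _ => 0, fun _ _ => rfl, ?_⟩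
    funext i
    rw [eq_zero_of_fold_inSpan hu hx (by omega) hs i]
    simp [bandOp]
  induction d with
  | zero => exact hzero 0 (by omega)
  | succ d ih =>
    intro a x hx hs
    by_cases hd : d + 1 + m + 1 ≤ n
    · exact hzero (d + 1) hd a x hx hs
    set y₀ : ℤ → K := fun i => if i = a then x a / bandEntry n t u a a else 0 with hy₀
    have hs₀ : SupportedIn y₀ a a := fun i hi => if_neg (by omega)
    have hb := hs₀.bandOp (n := n) (t := t) (u := u)
    have hb' : SupportedIn (bandOp n (bandEntry n t u) y₀) a (a + d) :=
      fun i hi => hb i (by omega)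
    obtain ⟨y, hy, hyx⟩ := ih (a + 1) (fun i => x i - bandOp n (bandEntry n t u) y₀ i) (by
      intro i hi
      simp only
      by_cases hia : i = a
      · subst hia
        rw [bandOp_top fun j hj => hs₀ j (Or.inl hj)]
        simp only [hy₀, if_pos]
        rw [mul_div_cancel₀ _ (hu.bandEntry_self_ne i), sub_self]
      · rw [hx i (by push_cast; omega), hb' i (by omega), sub_self]) (by
      rw [fold_sub hu.pos hx hb]
      refine hs.sub ?_
      rw [fold_bandOp hu.pos hu.bandEntry_add hs₀]
      exact hu.bandOp_inSpan (fold_quasiPeriodic _ hu.twist_ne _))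
    refine ⟨fun i => y i + y₀ i, fun i hi => ?_, ?_⟩
    · simp only
      rw [hy i (by push_cast at hi ⊢; omega), hs₀ i (by push_cast at hi; omega), add_zero]
    · rw [bandOp_add, hyx]
      funext i
      simp

/-- Invertibility of g away from 0 and its special value, without computing the determinant. Let `z`
be the image of one period of `x`. Its fold at `lam` vanishes, so its fold at the special value is a
nonzero multiple of `z (i + n)`. This fold lies in the span and vanishes in the last `m + 1` places,
beyond the end of the support of `z`; hence `z = 0`, and the triangular operator is injective. -/
theorem eq_zero_of_bandOp_eq_zero {t lam : K} {u : ℤ → Fin (m + 1) → K}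
    (hu : Nondegenerate n t u) (hl : lam ≠ 0) (hne : lam ≠ (-1) ^ m * t) {x : ℤ → K}
    (hx : QuasiPeriodic n lam x) (h : ∀ i, bandOp n (bandEntry n t u) x i = 0) (i : ℤ) :
    x i = 0 := by
  have hn := hu.pos
  have hlt := hu.lt
  set y : ℤ → K := fun i => if 0 ≤ i ∧ i < 0 + n then x i else 0 with hy
  have hys : SupportedIn y 0 (n - 1) := fun i hi => if_neg (by omega)
  have hfy : fold n lam y = x := fold_truncate hl hn hx 0
  set z := bandOp n (bandEntry n t u) y with hz
  have hzs' : SupportedIn z 0 (n - 1 + n - m - 1) := hys.bandOp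
  have hzs : SupportedIn z 0 (0 + 2 * n - 1) := fun i hi => hzs' i (by omega)
  have h1 : ∀ i, fold n lam z i = 0 := by
    intro i
    rw [hz, fold_bandOp hn hu.bandEntry_add hys, hfy, h]
  have h2 : InSpan u (fold n ((-1) ^ m * t) z) := by
    rw [hz, fold_bandOp hn hu.bandEntry_add hys]
    exact hu.bandOp_inSpan (fold_quasiPeriodic _ hu.twist_ne _)
  have h3 : ∀ i : ℤ, 0 ≤ i → i < 0 + n →
      fold n ((-1) ^ m * t) z i = ((-1) ^ m * t - lam) * z (i + n) := by
    intro i hi hi'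
    have := h1 i
    rw [fold_apply hn hzs hi hi'] at this ⊢
    simp only [smul_eq_mul] at this ⊢
    linear_combination this
  have h4 : ∀ i, fold n ((-1) ^ m * t) z i = 0 := by
    refine h2.eq_zero (a := n - 1 - m) (hu.det_ne _) fun i hi hi' => ?_
    rw [h3 i (by omega) (by omega), hzs' (i + n) (by omega), mul_zero]
  have h5 : ∀ i : ℤ, 0 ≤ i → i < 0 + n → z (i + n) = 0 := by
    intro i hi hi'
    have := h3 i hi hi'
    rw [h4] at this
    exact (mul_eq_zero.mp this.symm).resolve_left (sub_ne_zero.mpr hne.symm)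
  have h6 : ∀ i, z i = 0 := by
    intro i
    by_cases hi : 0 ≤ i ∧ i < 0 + n
    · have := h1 i
      rw [fold_apply hn hzs hi.1 hi.2, h5 i hi.1 hi.2] at this
      simpa using this
    by_cases hi' : (n : ℤ) ≤ i ∧ i < n + n
    · have := h5 (i - n) (by omega) (by omega)
      rwa [sub_add_cancel] at this
    · exact hzs i (by omega)
  have h7 := bandOp_injective hu (fun i hi => hys i (Or.inl hi)) h6
  rw [← hfy]
  unfold fold
  rw [finsum_eq_zero_of_forall_eq_zero]
  intro q
  rw [h7, smul_zero]

/-- Two members of the span agree once they agree on `m + 1` consecutive places, so it suffices to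
solve an equation with the triangular block of rows and columns `0, …, m`. -/
theorem Nondegenerate.exists_preimage {t : K} {u : ℤ → Fin (m + 1) → K}
    (hu : Nondegenerate n t u) {x : ℤ → K} (hx : InSpan u x) :
    ∃ y, QuasiPeriodic n ((-1) ^ m * t) y ∧ bandOp n (bandEntry n t u) y = x := by
  have hn := hu.pos
  have hlt := hu.lt
  set T : Matrix (Fin (m + 1)) (Fin (m + 1)) K :=
    Matrix.of fun i j => bandEntry n t u (i : ℕ) (j : ℕ) with hT
  have hdet : T.det ≠ 0 := by
    rw [Matrix.det_of_isLowerTriangular T]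
    · exact Finset.prod_ne_zero_iff.mpr fun i _ => hu.bandEntry_self_ne _
    · intro i j hij
      refine bandEntry_of_not fun h => ?_
      have : (i : ℕ) < j := hij
      omega
  obtain ⟨c, hc⟩ := (Matrix.mulVec_surjective_iff_isUnit.mpr
    ((Matrix.isUnit_iff_isUnit_det T).mpr hdet.isUnit)) fun i => x (i : ℕ)
  set y : ℤ → K := fun i => if h : 0 ≤ i ∧ i < m + 1 then c ⟨i.toNat, by omega⟩ else 0 with hy
  have hys : SupportedIn y 0 m := fun i hi => dif_neg (by omega)
  refine ⟨fold n ((-1) ^ m * t) y, fold_quasiPeriodic _ hu.twist_ne _, ?_⟩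
  have h1 : InSpan u fun i =>
      bandOp n (bandEntry n t u) (fold n ((-1) ^ m * t) y) i - x i :=
    (hu.bandOp_inSpan (fold_quasiPeriodic _ hu.twist_ne _)).sub hx
  funext i
  refine sub_eq_zero.mp (h1.eq_zero (a := 0) (hu.det_ne _) (fun i hi hi' => ?_) i)
  rw [sub_eq_zero, ← fold_bandOp hn hu.bandEntry_add hys, fold_apply_of_lt hn (a := 0)
    (fun i hi => hys.bandOp i (by omega)) hi (by omega)]
  obtain ⟨r, rfl⟩ := Int.eq_ofNat_of_zero_le hi
  have h2 : T.mulVec c ⟨r, by omega⟩ = x r := congrFun hc ⟨r, by omega⟩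
  rw [← h2]
  have e1 : ∑ j ∈ Finset.Icc ((r : ℤ) - n) r, bandEntry n t u r j • y j =
      ∑ j ∈ Finset.Icc ((r : ℤ) - n) m, bandEntry n t u r j • y j := by
    refine Finset.sum_subset (Finset.Icc_subset_Icc_right (by omega)) fun j hj hj' => ?_
    simp only [Finset.mem_Icc] at hj hj'
    rw [bandEntry_of_not (by omega), zero_smul]
  have e2 : ∑ j ∈ Finset.Icc (0 : ℤ) (0 + m), bandEntry n t u r j • y j =
      ∑ j ∈ Finset.Icc ((r : ℤ) - n) m, bandEntry n t u r j • y j := by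
    refine Finset.sum_subset (fun j hj => ?_) fun j hj hj' => ?_
    · simp only [Finset.mem_Icc] at hj ⊢; omega
    · simp only [Finset.mem_Icc] at hj hj'
      rw [hys j (by omega), smul_zero]
  rw [bandOp, e1, ← e2, sum_Icc_eq]
  refine Finset.sum_congr rfl fun j _ => ?_
  rw [smul_eq_mul, zero_add, hy]
  simp only
  rw [dif_pos (by omega)]
  rfl

end Band

/-! ### The algebraic exchange of two factors. -/

section Exchange

variable {K : Type*} [Field K] {m₁ m₂ n : ℕ} {s t : K} {u u' : ℤ → Fin (m₁ + 1) → K}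
  {v v' : ℤ → Fin (m₂ + 1) → K}

/-- The operator of `u` is injective at the special value of `v` and takes `v` to `v'`; so the
preimage of a combination of the columns of `v'` is the same combination for `v`. -/
theorem fold_bandOp_inSpan_of_eq (hu : Nondegenerate n s u) (hv : Nondegenerate n t v)
    (hv' : v' = bandOp n (bandEntry n s u) v) (hne : (-1) ^ m₁ * s ≠ (-1) ^ m₂ * t)
    {y : ℤ → K} {a b : ℤ} (hy : SupportedIn y a b)
    (h : InSpan v' (fold n ((-1) ^ m₂ * t) (bandOp n (bandEntry n s u) y))) :
    InSpan v (fold n ((-1) ^ m₂ * t) y) := by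
  obtain ⟨l, hl⟩ := h
  refine ⟨l, fun i => ?_⟩
  have h1 : QuasiPeriodic n ((-1) ^ m₂ * t) fun i => fold n ((-1) ^ m₂ * t) y i - l (v i) :=
    (fold_quasiPeriodic _ hv.twist_ne _).sub (hv.periodic.map l)
  refine sub_eq_zero.mp (eq_zero_of_bandOp_eq_zero hu hv.twist_ne hne.symm h1 (fun i => ?_) i)
  simp only [bandOp_sub, ← fold_bandOp hu.pos hu.bandEntry_add hy, bandOp_map, ← hv', hl, sub_self]

/-- A dependent window gives a linear form `l` whose values on `u'` vanish on `m₁ + 1` consecutive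
places. The remaining piece of one period, pushed forward by the operator of `v'`, is divisible by
that of `u`, and the quotient is too short for the span of `v`. So `l` vanishes on `u'`, hence on
`u`, hence identically. -/
theorem det_window_ne_zero_of_exchange (hu : Nondegenerate n s u) (hv : Nondegenerate n t v)
    (hv'n : Nondegenerate n t v') (hv' : v' = bandOp n (bandEntry n s u) v)
    (hu'p : QuasiPeriodic n ((-1) ^ m₁ * s) u') (hu' : u = bandOp n (bandEntry n t v') u')
    (hne : (-1) ^ m₁ * s ≠ (-1) ^ m₂ * t) (a : ℤ) : (window u' a).det ≠ 0 := by
  intro hdet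
  have hn := hu.pos
  have hlt₁ := hu.lt
  have hlt₂ := hv.lt
  obtain ⟨c, hc, hWc⟩ := Matrix.exists_mulVec_eq_zero_iff.mpr hdet
  let l : (Fin (m₁ + 1) → K) →ₗ[K] K :=
    { toFun := fun y => y ⬝ᵥ c
      map_add' := fun y z => add_dotProduct y z c
      map_smul' := fun r y => smul_dotProduct r y c }
  have hlc : ∀ y, l y = y ⬝ᵥ c := fun y => rfl
  have hx0 : ∀ i, a ≤ i → i ≤ a + m₁ → l (u' i) = 0 := by
    intro i h1 h2
    have := congrFun hWc ⟨(i - a).toNat, by omega⟩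
    rw [Matrix.mulVec, window_apply, ← hlc] at this
    simp only [Int.toNat_of_nonneg (sub_nonneg.mpr h1), add_sub_cancel] at this
    exact this
  set x : ℤ → K := fun i => if a ≤ i ∧ i < a + n then l (u' i) else 0 with hx
  have hxs : SupportedIn x (a + m₁ + 1) (a + n - 1) := by
    intro i hi
    by_cases h : a ≤ i ∧ i < a + n
    · rw [hx]; simp only [if_pos h]; exact hx0 i h.1 (by omega)
    · exact if_neg h
  have hfx : fold n ((-1) ^ m₁ * s) x = fun i => l (u' i) :=
    fold_truncate hu.twist_ne hn (hu'p.map l) a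
  have h1 : InSpan u (fold n ((-1) ^ m₁ * s) (bandOp n (bandEntry n t v') x)) := by
    refine ⟨l, fun i => ?_⟩
    rw [fold_bandOp hn hv'n.bandEntry_add hxs, hfx, bandOp_map, ← hu']
  have hws := hxs.bandOp (n := n) (t := t) (u := v')
  -- The dividend has length `2 * n - m₁ - m₂ - 2`; division removes `n - m₁ - 1` and leaves `n - m₂
  -- - 1`, the largest length excluded by `eq_zero_of_fold_inSpan`.
  obtain ⟨y, hys, hy⟩ := exists_bandOp_eq hu (2 * n - m₁ - m₂ - 3 + 1) (a + m₁ + 1) _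
    (fun i hi => hws i (by omega)) h1
  have h2 : InSpan v' (fold n ((-1) ^ m₂ * t) (bandOp n (bandEntry n s u) y)) := by
    rw [hy, fold_bandOp hn hv'n.bandEntry_add hxs]
    exact hv'n.bandOp_inSpan (fold_quasiPeriodic _ hv.twist_ne _)
  have h3 := fold_bandOp_inSpan_of_eq hu hv hv' hne hys h2
  have hy0 := eq_zero_of_fold_inSpan hv hys (by omega) h3
  have hw0 : ∀ i, bandOp n (bandEntry n t v') x i = 0 := by
    intro i
    rw [← hy]
    simp [bandOp, hy0]
  have hx00 := bandOp_injective hv'n (fun i hi => hxs i (Or.inl hi)) hw0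
  have h5 : ∀ i, l (u' i) = 0 := by
    intro i
    rw [← congrFun hfx i]
    unfold fold
    rw [finsum_eq_zero_of_forall_eq_zero]
    intro q
    rw [hx00, smul_zero]
  have h6 : ∀ i, l (u i) = 0 := by
    intro i
    rw [hu', ← congrFun (bandOp_map (bandEntry n t v') l u') i]
    simp [bandOp, h5]
  have h7 := linear_eq_zero (hu.det_ne 0) l fun i _ _ => h6 i
  apply hc
  funext r
  have h8 := hlc (Pi.single r 1)
  rw [h7] at h8
  simpa using h8.symm

theorem bandOp_column (n : ℕ) (w : ℤ → Fin (m₁ + 1) → K) (t : K) (j : ℤ) :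
    bandOp n (bandEntry n t w) (Pi.single j 1) = fun i => bandEntry n t w i j := by
  funext i
  unfold bandOp
  by_cases h : j ∈ Finset.Icc (i - n) i
  · rw [Finset.sum_eq_single j]
    · simp
    · intro l _ hl; simp [hl]
    · intro h'; exact absurd h h'
  · rw [bandEntry_of_not (by simp only [Finset.mem_Icc] at h; omega)]
    refine Finset.sum_eq_zero fun l hl => ?_
    rw [Pi.single_eq_of_ne (by rintro rfl; exact h hl), smul_zero]

/-- The difference of the two columns folds into the span of `u` at the first special value and into
that of `v'` at the second. The latter permits division by the operator of `v'`; the former puts the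
fold of the quotient in the span of `u'`, for which it is too short. -/
theorem bandEntry_exchange (hu : Nondegenerate n s u) (hv : Nondegenerate n t v)
    (hv'n : Nondegenerate n t v') (hv' : v' = bandOp n (bandEntry n s u) v)
    (hu'n : Nondegenerate n s u') (hu' : u = bandOp n (bandEntry n t v') u')
    (hne : (-1) ^ m₁ * s ≠ (-1) ^ m₂ * t) (j : ℤ) :
    bandOp n (bandEntry n s u) (fun i => bandEntry n t v i j) =
      bandOp n (bandEntry n t v') (fun i => bandEntry n s u' i j) := by
  have hn := hu.pos
  have hlt₁ := hu.lt
  have hlt₂ := hv.lt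
  have hes : SupportedIn (Pi.single j 1 : ℤ → K) j j :=
    fun i hi => Pi.single_eq_of_ne (by omega) _
  rw [← bandOp_column, ← bandOp_column]
  set e : ℤ → K := Pi.single j 1
  have hBv := hes.bandOp (n := n) (t := t) (u := v)
  have hBu' := hes.bandOp (n := n) (t := s) (u := u')
  have hA := hBv.bandOp (n := n) (t := s) (u := u)
  have hA' := hBu'.bandOp (n := n) (t := t) (u := v')
  have e1 := bandOp_bottom hu hBv
  have e2 := bandOp_bottom hv'n hBu'
  rw [bandOp_bottom hv hes] at e1
  rw [bandOp_bottom hu'n hes] at e2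
  -- Both products have bottom entry 1 in the same row, so the difference loses one place; this
  -- makes the later quotient short enough.
  have hws : SupportedIn (fun i => bandOp n (bandEntry n s u) (bandOp n (bandEntry n t v) e) i -
      bandOp n (bandEntry n t v') (bandOp n (bandEntry n s u') e) i) j
      (j + 2 * n - m₁ - m₂ - 3) := by
    intro i hi
    simp only
    by_cases h : i = j + n - m₂ - 1 + n - m₁ - 1
    · conv_lhs => rw [h, e1]
      rw [show j + n - m₂ - 1 + n - m₁ - 1 = j + n - m₁ - 1 + n - m₂ - 1 by ring, e2, sub_self]
    · rw [hA i (by omega), hA' i (by omega), sub_self]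
  have hf1 : InSpan u (fold n ((-1) ^ m₁ * s) fun i =>
      bandOp n (bandEntry n s u) (bandOp n (bandEntry n t v) e) i -
      bandOp n (bandEntry n t v') (bandOp n (bandEntry n s u') e) i) := by
    rw [fold_sub hn hA hA']
    refine InSpan.sub ?_ ?_
    · rw [fold_bandOp hn hu.bandEntry_add hBv]
      exact hu.bandOp_inSpan (fold_quasiPeriodic _ hu.twist_ne _)
    · rw [fold_bandOp hn hv'n.bandEntry_add hBu', fold_bandOp hn hu'n.bandEntry_add hes]
      obtain ⟨l, hl⟩ := hu'n.bandOp_inSpan (fold_quasiPeriodic (n := n) _ hu.twist_ne e)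
      refine ⟨l, fun i => ?_⟩
      rw [funext hl, bandOp_map, ← hu']
  have hf2 : InSpan v' (fold n ((-1) ^ m₂ * t) fun i =>
      bandOp n (bandEntry n s u) (bandOp n (bandEntry n t v) e) i -
      bandOp n (bandEntry n t v') (bandOp n (bandEntry n s u') e) i) := by
    rw [fold_sub hn hA hA']
    refine InSpan.sub ?_ ?_
    · rw [fold_bandOp hn hu.bandEntry_add hBv, fold_bandOp hn hv.bandEntry_add hes]
      obtain ⟨l, hl⟩ := hv.bandOp_inSpan (fold_quasiPeriodic (n := n) _ hv.twist_ne e)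
      refine ⟨l, fun i => ?_⟩
      rw [funext hl, bandOp_map, ← hv']
    · rw [fold_bandOp hn hv'n.bandEntry_add hBu']
      exact hv'n.bandOp_inSpan (fold_quasiPeriodic _ hv.twist_ne _)
  obtain ⟨y, hys, hy⟩ := exists_bandOp_eq hv'n (2 * n - m₁ - m₂ - 3 + 1) j _
    (fun i hi => hws i (by omega)) hf2
  have h3 : InSpan u' (fold n ((-1) ^ m₁ * s) y) := by
    rw [← hy] at hf1
    exact fold_bandOp_inSpan_of_eq hv'n hu'n hu' hne.symm hys hf1
  have hy0 := eq_zero_of_fold_inSpan hu'n hys (by omega) h3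
  funext i
  have h4 := congrFun hy i
  rw [← sub_eq_zero, ← h4]
  simp [bandOp, hy0]

end Exchange

/-! ### Positivity from cyclic intervals and nonnegativity. -/

section Arcs

variable {n : ℕ} [NeZero n]

/-- The cyclic interval of length `l` that starts at `z`. -/
def arc (z : ZMod n) (l : ℕ) : Finset (ZMod n) :=
  (Finset.range l).image fun i : ℕ => z + (i : ZMod n)

/-- The three-term Plücker relations, for quadruples in cyclic order. -/
def CyclicPlucker (k : ℕ) (P : Finset (ZMod n) → ℝ) : Prop :=
  ∀ (z : ZMod n) (a b c d : ℕ), a < b → b < c → c < d → d < n → ∀ S : Finset (ZMod n),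
    S.card + 2 = k → z + (a : ZMod n) ∉ S → z + (b : ZMod n) ∉ S → z + (c : ZMod n) ∉ S →
    z + (d : ZMod n) ∉ S →
    P (insert (z + (a : ZMod n)) (insert (z + (c : ZMod n)) S)) *
        P (insert (z + (b : ZMod n)) (insert (z + (d : ZMod n)) S)) =
      P (insert (z + (a : ZMod n)) (insert (z + (b : ZMod n)) S)) *
        P (insert (z + (c : ZMod n)) (insert (z + (d : ZMod n)) S)) +
      P (insert (z + (a : ZMod n)) (insert (z + (d : ZMod n)) S)) *
        P (insert (z + (b : ZMod n)) (insert (z + (c : ZMod n)) S))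

theorem add_natCast_inj (z : ZMod n) {i j : ℕ} (hi : i < n) (hj : j < n) :
    z + (i : ZMod n) = z + (j : ZMod n) ↔ i = j := by
  rw [add_right_inj]
  constructor
  · intro h
    have := congrArg ZMod.val h
    rwa [ZMod.val_cast_of_lt hi, ZMod.val_cast_of_lt hj] at this
  · rintro rfl; rfl

theorem exists_offset (z y : ZMod n) : ∃ i : ℕ, i < n ∧ y = z + (i : ZMod n) :=
  ⟨(y - z).val, ZMod.val_lt _, by simp⟩

theorem finset_ext_offset (z : ZMod n) {A B : Finset (ZMod n)}
    (h : ∀ i : ℕ, i < n → (z + (i : ZMod n) ∈ A ↔ z + (i : ZMod n) ∈ B)) : A = B := by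
  ext y
  obtain ⟨i, hi, rfl⟩ := exists_offset z y
  exact h i hi

theorem mem_arc_offset (z : ZMod n) {i e l : ℕ} (hi : i < n) (he : e ≤ n) (hl : l ≤ n) :
    z + (i : ZMod n) ∈ arc (z + (e : ZMod n)) l ↔ (e ≤ i ∧ i < e + l) ∨ i + n < e + l := by
  unfold arc
  simp only [Finset.mem_image, Finset.mem_range]
  constructor
  · rintro ⟨c, hc, h⟩
    rw [add_assoc, ← Nat.cast_add] at h
    rcases lt_or_ge (e + c) n with h1 | h1
    · rw [add_natCast_inj z h1 hi] at h
      omega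
    · have h2 : ((e + c : ℕ) : ZMod n) = ((e + c - n : ℕ) : ZMod n) := by
        conv_lhs => rw [← Nat.sub_add_cancel h1]
        simp
      rw [h2, add_natCast_inj z (by omega) hi] at h
      omega
  · rintro (⟨h1, h2⟩ | h)
    · refine ⟨i - e, by omega, ?_⟩
      rw [add_assoc, ← Nat.cast_add]
      congr 2
      omega
    · refine ⟨i + n - e, by omega, ?_⟩
      rw [add_assoc, ← Nat.cast_add, show e + (i + n - e) = i + n by omega]
      simp

theorem mem_arc_self (z : ZMod n) {i l : ℕ} (hi : i < n) (hl : l ≤ n) :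
    z + (i : ZMod n) ∈ arc z l ↔ i < l := by
  have := mem_arc_offset z hi (Nat.zero_le n) hl
  rw [Nat.cast_zero, add_zero] at this
  rw [this]
  omega

theorem offset_offset (z : ZMod n) {a b c : ℕ} (h : a + b = c) :
    z + (a : ZMod n) + (b : ZMod n) = z + (c : ZMod n) := by
  rw [add_assoc, ← Nat.cast_add, h]

theorem exists_first (f : ℕ → Prop) (a b : ℕ) (h : ¬ ∀ i, a ≤ i → i < b → f i) :
    ∃ r, a ≤ r ∧ r < b ∧ ¬ f r ∧ ∀ i, a ≤ i → i < r → f i := by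
  classical
  push Not at h
  have h' : ∃ i, a ≤ i ∧ i < b ∧ ¬ f i := h
  refine ⟨Nat.find h', (Nat.find_spec h').1, (Nat.find_spec h').2.1, (Nat.find_spec h').2.2, ?_⟩
  intro i h1 h2
  have := Nat.find_min h' h2
  by_contra h3
  exact this ⟨h1, h2.trans (Nat.find_spec h').2.1, h3⟩

theorem exists_last (f : ℕ → Prop) (a b : ℕ) (h : ¬ ∀ i, a ≤ i → i < b → f i) :
    ∃ r, a ≤ r ∧ r < b ∧ ¬ f r ∧ ∀ i, r < i → i < b → f i := by
  obtain ⟨r, h1, h2, h3, h4⟩ := exists_first (fun i => f (a + b - 1 - i)) a b (by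
    intro h'
    apply h
    intro i hi hi'
    have := h' (a + b - 1 - i) (by omega) (by omega)
    rwa [show a + b - 1 - (a + b - 1 - i) = i by omega] at this)
  refine ⟨a + b - 1 - r, by omega, by omega, h3, fun i hi hi' => ?_⟩
  have := h4 (a + b - 1 - i) (by omega) (by omega)
  rwa [show a + b - 1 - (a + b - 1 - i) = i by omega] at this

theorem card_insert_insert_erase (z : ZMod n) {S : Finset (ZMod n)} {a b k : ℕ} (ha : a < n)
    (hb : b < n) (hab : a ≠ b) (hS : S.card + 2 = k) (h1 : z + (a : ZMod n) ∉ S)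
    (h2 : z + (b : ZMod n) ∉ S) :
    (insert (z + (a : ZMod n)) (insert (z + (b : ZMod n)) S)).card = k := by
  rw [Finset.card_insert_of_notMem, Finset.card_insert_of_notMem h2, ← hS]
  rw [Finset.mem_insert, add_natCast_inj z ha hb]
  tauto

/-- Let `β` be the first gap between the arc and `ξ`, and `δ` the last gap of the circle. With `S`
the common part, the relation reads P(0ξ) P(βδ) = P(0β) P(ξδ) + P(0δ) P(βξ). Filling `β` or `δ`
prolongs the arc, so P(0β) and P(0δ) are positive; P(βξ) is positive by induction with the origin
moved to `z + 1`. The right side is therefore positive and P(0ξ) cannot vanish. -/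
theorem pos_insert_of_arcs {k : ℕ} {P : Finset (ZMod n) → ℝ} (hP : CyclicPlucker k P)
    (h0 : ∀ J : Finset (ZMod n), J.card = k → 0 ≤ P J) {F : Finset (ZMod n)}
    (hF : ∀ (z : ZMod n) (l : ℕ), l ≤ n → (arc z l ∪ F).card = k → 0 < P (arc z l ∪ F)) (ξ : ℕ) :
    ∀ (z : ZMod n) (l : ℕ), ξ < n → l ≤ ξ → z + (ξ : ZMod n) ∉ F →
      (insert (z + (ξ : ZMod n)) (arc z l ∪ F)).card = k →
      0 < P (insert (z + (ξ : ZMod n)) (arc z l ∪ F)) := by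
  induction ξ using Nat.strong_induction_on with
  | _ ξ ih =>
  intro z l hξ hl hx hk
  have e0 : z + ((0 : ℕ) : ZMod n) = z := by simp
  have key : ∀ z' l', l' ≤ n → insert (z + (ξ : ZMod n)) (arc z l ∪ F) = arc z' l' ∪ F →
      0 < P (insert (z + (ξ : ZMod n)) (arc z l ∪ F)) := by
    intro z' l' hl' h
    rw [h] at hk ⊢
    exact hF z' l' hl' hk
  rcases Nat.eq_zero_or_pos l with rfl | hl0
  · refine key (z + (ξ : ZMod n)) 1 (by omega) (finset_ext_offset z fun i hi => ?_)
    simp (disch := omega) only [Finset.mem_insert, Finset.mem_union, mem_arc_offset z hi,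
      mem_arc_self z hi, add_natCast_inj z hi]
    grind
  by_cases hz : z ∈ F
  · have e1 : arc z l ∪ F = arc (z + ((1 : ℕ) : ZMod n)) (l - 1) ∪ F := by
      refine finset_ext_offset z fun i hi => ?_
      simp (disch := omega) only [Finset.mem_union, mem_arc_offset z hi, mem_arc_self z hi]
      rcases Nat.eq_zero_or_pos i with rfl | h
      · simp [hz]
      · grind
    rw [e1, ← offset_offset z (show 1 + (ξ - 1) = ξ by omega)] at hk ⊢
    rw [← offset_offset z (show 1 + (ξ - 1) = ξ by omega)] at hx
    exact ih (ξ - 1) (by omega) _ (l - 1) (by omega) (by omega) hx hk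
  by_cases hβ : ∀ i, l ≤ i → i < ξ → z + (i : ZMod n) ∈ F
  · refine key z (ξ + 1) (by omega) (finset_ext_offset z fun i hi => ?_)
    have := hβ i
    simp (disch := omega) only [Finset.mem_insert, Finset.mem_union, mem_arc_self z hi,
      add_natCast_inj z hi]
    grind
  by_cases hδ : ∀ i, ξ + 1 ≤ i → i < n → z + (i : ZMod n) ∈ F
  · refine key (z + (ξ : ZMod n)) (n - ξ + l) (by omega) (finset_ext_offset z fun i hi => ?_)
    have := hδ i
    simp (disch := omega) only [Finset.mem_insert, Finset.mem_union, mem_arc_self z hi,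
      mem_arc_offset z hi, add_natCast_inj z hi]
    grind
  obtain ⟨β, hβ1, hβ2, hβ3, hβ4⟩ := exists_first _ _ _ hβ
  obtain ⟨δ, hδ1, hδ2, hδ3, hδ4⟩ := exists_last _ _ _ hδ
  set S := (arc z l ∪ F).erase z with hS
  have hSm : ∀ i : ℕ, i < n → (z + (i : ZMod n) ∈ S ↔ i ≠ 0 ∧ (i < l ∨ z + (i : ZMod n) ∈ F)) := by
    intro i hi
    rw [hS, Finset.mem_erase, Finset.mem_union, mem_arc_self z hi (by omega)]
    have : z + (i : ZMod n) = z ↔ i = 0 := by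
      have := add_natCast_inj z hi (show 0 < n by omega)
      rwa [e0] at this
    rw [Ne, this]
  have hxS : z + (ξ : ZMod n) ∉ S := by rw [hSm ξ hξ]; grind
  have h0S : z + ((0 : ℕ) : ZMod n) ∉ S := by rw [hSm 0 (by omega)]; grind
  have hβS : z + (β : ZMod n) ∉ S := by rw [hSm β (by omega)]; grind
  have hδS : z + (δ : ZMod n) ∉ S := by rw [hSm δ (by omega)]; grind
  have e1 : insert (z + (ξ : ZMod n)) (arc z l ∪ F) =
      insert (z + ((0 : ℕ) : ZMod n)) (insert (z + (ξ : ZMod n)) S) := by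
    refine finset_ext_offset z fun i hi => ?_
    simp (disch := omega) only [Finset.mem_insert, Finset.mem_union, mem_arc_self z hi,
      add_natCast_inj z hi, hSm i hi]
    grind
  have e2 : insert (z + ((0 : ℕ) : ZMod n)) (insert (z + (β : ZMod n)) S) =
      arc z (β + 1) ∪ F := by
    refine finset_ext_offset z fun i hi => ?_
    have := hβ4 i
    simp (disch := omega) only [Finset.mem_insert, Finset.mem_union, mem_arc_self z hi,
      add_natCast_inj z hi, hSm i hi]
    grind
  have e3 : insert (z + ((0 : ℕ) : ZMod n)) (insert (z + (δ : ZMod n)) S) =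
      arc (z + (δ : ZMod n)) (n - δ + l) ∪ F := by
    refine finset_ext_offset z fun i hi => ?_
    have := hδ4 i
    simp (disch := omega) only [Finset.mem_insert, Finset.mem_union, mem_arc_offset z hi,
      add_natCast_inj z hi, hSm i hi]
    grind
  have e4 : insert (z + (β : ZMod n)) (insert (z + (ξ : ZMod n)) S) =
      insert (z + ((1 : ℕ) : ZMod n) + ((ξ - 1 : ℕ) : ZMod n))
        (arc (z + ((1 : ℕ) : ZMod n)) β ∪ F) := by
    refine finset_ext_offset z fun i hi => ?_
    have := hβ4 i
    have hz' : i = 0 → z + (i : ZMod n) ∉ F := by rintro rfl; rwa [e0]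
    rw [offset_offset z (show 1 + (ξ - 1) = ξ by omega)]
    simp (disch := omega) only [Finset.mem_insert, Finset.mem_union, mem_arc_offset z hi,
      add_natCast_inj z hi, hSm i hi]
    grind
  have hc : S.card + 2 = k := by
    rw [e1, Finset.card_insert_of_notMem, Finset.card_insert_of_notMem hxS] at hk
    · exact hk
    · rw [Finset.mem_insert, add_natCast_inj z (by omega) hξ]
      rintro (h | h)
      · omega
      · exact h0S h
  have hpl := hP z 0 β ξ δ (by omega) hβ2 (by omega) hδ2 S hc h0S hβS hxS hδS
  have p2 : 0 < P (insert (z + ((0 : ℕ) : ZMod n)) (insert (z + (β : ZMod n)) S)) := by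
    have := card_insert_insert_erase z (show 0 < n by omega) (show β < n by omega) (by omega) hc
      h0S hβS
    rw [e2] at this ⊢
    exact hF _ _ (by omega) this
  have p3 : 0 < P (insert (z + ((0 : ℕ) : ZMod n)) (insert (z + (δ : ZMod n)) S)) := by
    have := card_insert_insert_erase z (show 0 < n by omega) (show δ < n by omega) (by omega) hc
      h0S hδS
    rw [e3] at this ⊢
    exact hF _ _ (by omega) this
  have p4 : 0 < P (insert (z + (β : ZMod n)) (insert (z + (ξ : ZMod n)) S)) := by
    have := card_insert_insert_erase z (show β < n by omega) hξ (by omega) hc hβS hxS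
    rw [e4] at this ⊢
    exact ih (ξ - 1) (by omega) _ β (by omega) (by omega)
      (by rwa [offset_offset z (show 1 + (ξ - 1) = ξ by omega)]) this
  have p5 := h0 _ (card_insert_insert_erase z hξ hδ2 (by omega) hc hxS hδS)
  have p6 := h0 _ (card_insert_insert_erase z (show β < n by omega) hδ2 (by omega) hc hβS hδS)
  rw [e1] at hk ⊢
  refine lt_of_le_of_ne (h0 _ hk) fun h => ?_
  rw [← h, zero_mul] at hpl
  have := mul_nonneg p2.le p5
  have := mul_pos p3 p4
  linarith

/-- A nonnegative point of the Grassmannian is positive if its cyclically consecutive Plücker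
coordinates are. -/
theorem pos_of_arcs {k : ℕ} {P : Finset (ZMod n) → ℝ} (hP : CyclicPlucker k P)
    (h0 : ∀ J : Finset (ZMod n), J.card = k → 0 ≤ P J)
    (harc : ∀ (z : ZMod n) (l : ℕ), l ≤ n → (arc z l).card = k → 0 < P (arc z l))
    (J : Finset (ZMod n)) (hJ : J.card = k) : 0 < P J := by
  -- The set is built up one element at a time with the arc left arbitrary; at the end the arc is
  -- taken empty.
  have key : ∀ F : Finset (ZMod n), ∀ (z : ZMod n) (l : ℕ), l ≤ n → (arc z l ∪ F).card = k →
      0 < P (arc z l ∪ F) := by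
    intro F
    induction F using Finset.induction_on with
    | empty => simpa using harc
    | insert x F _ ih =>
      intro z l hl hk
      rw [Finset.union_insert] at hk ⊢
      by_cases hx : x ∈ arc z l ∪ F
      · rw [Finset.insert_eq_self.mpr hx] at hk ⊢
        exact ih z l hl hk
      · obtain ⟨i, hi, rfl⟩ := exists_offset z x
        rw [Finset.mem_union, mem_arc_self z hi hl] at hx
        exact pos_insert_of_arcs hP h0 ih i z l hi (by grind) (by tauto) hk
  have := key J 0 0 (Nat.zero_le _)
  simpa [arc, hJ] using this

end Arcs

/-! ### Positivity from unions of two cyclic intervals. -/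

section TwoArcs

variable {n : ℕ} [NeZero n]

/-- The index sets in the Plücker relation for offsets `0 < r < ξ < w`, where `r` and `w` are the
first gaps after the two arcs. Apart from the set of interest, each is a union of two arcs with `F`
or such a union with a point inserted at offset `ξ - 1` from `z + 1`. -/
theorem two_arcs_identities {F : Finset (ZMod n)} {z : ZMod n} {ξ l α m r w : ℕ} (hl0 : 0 < l)
    (hα : ξ < α) (hz : z ∉ F) (hr1 : l ≤ r) (hr2 : r < ξ)
    (hr4 : ∀ i : ℕ, l ≤ i → i < r → z + (i : ZMod n) ∈ F) (hw1 : α + m ≤ w) (hw2 : w < n)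
    (hw4 : ∀ i : ℕ, α + m ≤ i → i < w → z + (i : ZMod n) ∈ F) {S : Finset (ZMod n)}
    (hSm : ∀ i : ℕ, i < n → (z + (i : ZMod n) ∈ S ↔
      i ≠ 0 ∧ (i < l ∨ (α ≤ i ∧ i < α + m) ∨ z + (i : ZMod n) ∈ F))) :
    insert (z + (ξ : ZMod n)) (arc z l ∪ arc (z + (α : ZMod n)) m ∪ F) = insert (z + ((0 : ℕ) : ZMod n)) (insert (z + (ξ : ZMod n)) S) ∧
    insert (z + ((0 : ℕ) : ZMod n)) (insert (z + (r : ZMod n)) S) = arc z (r + 1) ∪ arc (z + (α : ZMod n)) m ∪ F ∧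
    insert (z + ((0 : ℕ) : ZMod n)) (insert (z + (w : ZMod n)) S) = arc z l ∪ arc (z + (α : ZMod n)) (w + 1 - α) ∪ F ∧
    insert (z + (r : ZMod n)) (insert (z + (w : ZMod n)) S) = arc (z + ((1 : ℕ) : ZMod n)) r ∪ arc (z + ((1 : ℕ) : ZMod n) + ((α - 1 : ℕ) : ZMod n)) (w + 1 - α) ∪ F ∧
    insert (z + (ξ : ZMod n)) (insert (z + (w : ZMod n)) S) = insert (z + ((1 : ℕ) : ZMod n) + ((ξ - 1 : ℕ) : ZMod n)) (arc (z + ((1 : ℕ) : ZMod n)) (l - 1) ∪ arc (z + ((1 : ℕ) : ZMod n) + ((α - 1 : ℕ) : ZMod n)) (w + 1 - α) ∪ F) ∧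
    insert (z + (r : ZMod n)) (insert (z + (ξ : ZMod n)) S) = insert (z + ((1 : ℕ) : ZMod n) + ((ξ - 1 : ℕ) : ZMod n)) (arc (z + ((1 : ℕ) : ZMod n)) r ∪ arc (z + ((1 : ℕ) : ZMod n) + ((α - 1 : ℕ) : ZMod n)) m ∪ F) := by
  have hz' : ∀ i : ℕ, i = 0 → z + (i : ZMod n) ∉ F := by rintro i rfl; simpa using hz
  rw [offset_offset z (show 1 + (ξ - 1) = ξ by omega),
    offset_offset z (show 1 + (α - 1) = α by omega)]
  refine ⟨?_, ?_, ?_, ?_, ?_, ?_⟩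
  all_goals
    refine finset_ext_offset z fun i hi => ?_
    have h1 : ¬ (l ≤ i ∧ i < r) ∨ z + (i : ZMod n) ∈ F := by have := hr4 i; tauto
    have h2 : ¬ (α + m ≤ i ∧ i < w) ∨ z + (i : ZMod n) ∈ F := by have := hw4 i; tauto
    have h3 : ¬ i = 0 ∨ z + (i : ZMod n) ∉ F := by have := hz' i; tauto
    simp (disch := omega) only [Finset.mem_insert, Finset.mem_union, mem_arc_self z hi,
      mem_arc_offset z hi, add_natCast_inj z hi, hSm i hi]
    clear hr4 hw4 hz' hSm hz
    generalize (z + (i : ZMod n) ∈ F) = f at *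
    by_cases hf : f
    · simp only [hf, or_true, and_true, not_true_eq_false, or_false, iff_true, true_iff] at *
      omega
    · simp only [hf, or_false, not_false_eq_true, or_true] at *
      omega

/-- As for one arc, but with the first gap `w` after the second arc in place of the last gap of the
circle. Now the other five coordinates in the Plücker relation are all known to be positive, so
nonnegativity need not be assumed. -/
theorem pos_insert_of_two_arcs {k : ℕ} {P : Finset (ZMod n) → ℝ} (hP : CyclicPlucker k P)
    {F : Finset (ZMod n)}
    (hF : ∀ (z : ZMod n) (l α m : ℕ), l ≤ α → α + m ≤ n →
      (arc z l ∪ arc (z + (α : ZMod n)) m ∪ F).card = k →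
      0 < P (arc z l ∪ arc (z + (α : ZMod n)) m ∪ F)) (ξ : ℕ) :
    ∀ (z : ZMod n) (l α m : ℕ), l ≤ ξ → ξ < α → α + m ≤ n → z + (ξ : ZMod n) ∉ F →
      (insert (z + (ξ : ZMod n)) (arc z l ∪ arc (z + (α : ZMod n)) m ∪ F)).card = k →
      0 < P (insert (z + (ξ : ZMod n)) (arc z l ∪ arc (z + (α : ZMod n)) m ∪ F)) := by
  induction ξ using Nat.strong_induction_on with
  | _ ξ ih =>
  intro z l α m hl hα hm hx hk
  have e0 : z + ((0 : ℕ) : ZMod n) = z := by simp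
  have hξ : ξ < n := by omega
  have key : ∀ z' l' α' m', l' ≤ α' → α' + m' ≤ n →
      insert (z + (ξ : ZMod n)) (arc z l ∪ arc (z + (α : ZMod n)) m ∪ F) =
        arc z' l' ∪ arc (z' + (α' : ZMod n)) m' ∪ F →
      0 < P (insert (z + (ξ : ZMod n)) (arc z l ∪ arc (z + (α : ZMod n)) m ∪ F)) := by
    intro z' l' α' m' hl' hm' h
    rw [h] at hk ⊢
    exact hF z' l' α' m' hl' hm' hk
  rcases Nat.eq_zero_or_pos l with rfl | hl0
  · refine key (z + (ξ : ZMod n)) 1 (α - ξ) m (by omega) (by omega)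
      (finset_ext_offset z fun i hi => ?_)
    rw [offset_offset z (show ξ + (α - ξ) = α by omega)]
    simp (disch := omega) only [Finset.mem_insert, Finset.mem_union, mem_arc_offset z hi,
      mem_arc_self z hi, add_natCast_inj z hi]
    grind
  by_cases hz : z ∈ F
  · have e1 : arc z l ∪ arc (z + (α : ZMod n)) m ∪ F = arc (z + ((1 : ℕ) : ZMod n)) (l - 1) ∪
        arc (z + ((1 : ℕ) : ZMod n) + ((α - 1 : ℕ) : ZMod n)) m ∪ F := by
      rw [offset_offset z (show 1 + (α - 1) = α by omega)]
      refine finset_ext_offset z fun i hi => ?_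
      simp (disch := omega) only [Finset.mem_union, mem_arc_offset z hi, mem_arc_self z hi]
      rcases Nat.eq_zero_or_pos i with rfl | h
      · simp [hz]
      · grind
    rw [e1, ← offset_offset z (show 1 + (ξ - 1) = ξ by omega)] at hk ⊢
    rw [← offset_offset z (show 1 + (ξ - 1) = ξ by omega)] at hx
    exact ih (ξ - 1) (by omega) _ (l - 1) (α - 1) m (by omega) (by omega) (by omega) hx hk
  by_cases hr : ∀ i, l ≤ i → i < ξ → z + (i : ZMod n) ∈ F
  · refine key z (ξ + 1) α m (by omega) (by omega) (finset_ext_offset z fun i hi => ?_)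
    have := hr i
    simp (disch := omega) only [Finset.mem_insert, Finset.mem_union, mem_arc_self z hi,
      mem_arc_offset z hi, add_natCast_inj z hi]
    grind
  by_cases hw : ∀ i, α + m ≤ i → i < n → z + (i : ZMod n) ∈ F
  · refine key (z + (ξ : ZMod n)) 1 (α - ξ) (n - α + l) (by omega) (by omega)
      (finset_ext_offset z fun i hi => ?_)
    have := hw i
    rw [offset_offset z (show ξ + (α - ξ) = α by omega)]
    simp (disch := omega) only [Finset.mem_insert, Finset.mem_union, mem_arc_self z hi,
      mem_arc_offset z hi, add_natCast_inj z hi]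
    grind
  obtain ⟨r, hr1, hr2, hr3, hr4⟩ := exists_first _ _ _ hr
  obtain ⟨w, hw1, hw2, hw3, hw4⟩ := exists_first _ _ _ hw
  have o1 : z + ((1 : ℕ) : ZMod n) + ((ξ - 1 : ℕ) : ZMod n) = z + (ξ : ZMod n) :=
    offset_offset z (by omega)
  set S := (arc z l ∪ arc (z + (α : ZMod n)) m ∪ F).erase z with hS
  have hSm : ∀ i : ℕ, i < n → (z + (i : ZMod n) ∈ S ↔
      i ≠ 0 ∧ (i < l ∨ (α ≤ i ∧ i < α + m) ∨ z + (i : ZMod n) ∈ F)) := by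
    intro i hi
    rw [hS, Finset.mem_erase, Finset.mem_union, Finset.mem_union, mem_arc_self z hi (by omega),
      mem_arc_offset z hi (by omega) (by omega)]
    have : z + (i : ZMod n) = z ↔ i = 0 := by
      have := add_natCast_inj z hi (show 0 < n by omega)
      rwa [e0] at this
    rw [Ne, this]
    grind
  have hxS : z + (ξ : ZMod n) ∉ S := by rw [hSm ξ hξ]; grind
  have h0S : z + ((0 : ℕ) : ZMod n) ∉ S := by rw [hSm 0 (by omega)]; grind
  have hrS : z + (r : ZMod n) ∉ S := by rw [hSm r (by omega)]; grind
  have hwS : z + (w : ZMod n) ∉ S := by rw [hSm w (by omega)]; grind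
  obtain ⟨e1, e2, e3, e4, e5, e6⟩ := two_arcs_identities hl0 hα hz hr1 hr2 hr4 hw1 hw2 hw4 hSm
  have hc : S.card + 2 = k := by
    rw [e1, Finset.card_insert_of_notMem, Finset.card_insert_of_notMem hxS] at hk
    · exact hk
    · rw [Finset.mem_insert, add_natCast_inj z (by omega) hξ]
      rintro (h | h)
      · omega
      · exact h0S h
  have hpl := hP z 0 r ξ w (by omega) hr2 (by omega) hw2 S hc h0S hrS hxS hwS
  have p2 : 0 < P (insert (z + ((0 : ℕ) : ZMod n)) (insert (z + (r : ZMod n)) S)) := by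
    have := card_insert_insert_erase z (show 0 < n by omega) (show r < n by omega) (by omega) hc
      h0S hrS
    rw [e2] at this ⊢
    exact hF _ _ _ _ (by omega) (by omega) this
  have p3 : 0 < P (insert (z + ((0 : ℕ) : ZMod n)) (insert (z + (w : ZMod n)) S)) := by
    have := card_insert_insert_erase z (show 0 < n by omega) hw2 (by omega) hc h0S hwS
    rw [e3] at this ⊢
    exact hF _ _ _ _ (by omega) (by omega) this
  have p4 : 0 < P (insert (z + (r : ZMod n)) (insert (z + (w : ZMod n)) S)) := by
    have := card_insert_insert_erase z (show r < n by omega) hw2 (by omega) hc hrS hwS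
    rw [e4] at this ⊢
    exact hF _ _ _ _ (by omega) (by omega) this
  have p5 : 0 < P (insert (z + (ξ : ZMod n)) (insert (z + (w : ZMod n)) S)) := by
    have := card_insert_insert_erase z hξ hw2 (by omega) hc hxS hwS
    rw [e5] at this ⊢
    exact ih (ξ - 1) (by omega) _ _ _ _ (by omega) (by omega) (by omega) (by rwa [o1]) this
  have p6 : 0 < P (insert (z + (r : ZMod n)) (insert (z + (ξ : ZMod n)) S)) := by
    have := card_insert_insert_erase z (show r < n by omega) hξ (by omega) hc hrS hxS
    rw [e6] at this ⊢
    exact ih (ξ - 1) (by omega) _ _ _ _ (by omega) (by omega) (by omega) (by rwa [o1]) this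
  rw [e1]
  have h1 := mul_pos p2 p5
  have h2 := mul_pos p3 p6
  exact pos_of_mul_pos_left (by rw [hpl]; linarith) p4.le

/-- A point of the Grassmannian is positive if its Plücker coordinates on unions of two cyclic
intervals are. -/
theorem pos_of_two_arcs {k : ℕ} {P : Finset (ZMod n) → ℝ} (hP : CyclicPlucker k P)
    (harc : ∀ (z : ZMod n) (l α m : ℕ), l ≤ α → α + m ≤ n →
      (arc z l ∪ arc (z + (α : ZMod n)) m).card = k →
      0 < P (arc z l ∪ arc (z + (α : ZMod n)) m))
    (J : Finset (ZMod n)) (hJ : J.card = k) : 0 < P J := by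
  have key : ∀ F : Finset (ZMod n), ∀ (z : ZMod n) (l α m : ℕ), l ≤ α → α + m ≤ n →
      (arc z l ∪ arc (z + (α : ZMod n)) m ∪ F).card = k →
      0 < P (arc z l ∪ arc (z + (α : ZMod n)) m ∪ F) := by
    intro F
    induction F using Finset.induction_on with
    | empty => simpa using harc
    | insert x F _ ih =>
      intro z l α m hl hm hk
      rw [Finset.union_insert] at hk ⊢
      by_cases hx : x ∈ arc z l ∪ arc (z + (α : ZMod n)) m ∪ F
      · rw [Finset.insert_eq_self.mpr hx] at hk ⊢
        exact ih z l α m hl hm hk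
      · obtain ⟨i, hi, rfl⟩ := exists_offset z x
        rw [Finset.mem_union, Finset.mem_union, mem_arc_self z hi (by omega),
          mem_arc_offset z hi (by omega) (by omega)] at hx
        rcases lt_or_ge i α with h | h
        · exact pos_insert_of_two_arcs hP ih i z l α m (by grind) h hm (by tauto) hk
        -- An element past the second arc lies in the other gap; the circle is read from the start
        -- of that arc.
        · have e1 : z + (α : ZMod n) + ((n - α : ℕ) : ZMod n) = z := by
            rw [offset_offset z (show α + (n - α) = n by omega)]
            simp
          have e2 : z + (α : ZMod n) + ((i - α : ℕ) : ZMod n) = z + (i : ZMod n) :=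
            offset_offset z (by omega)
          have := pos_insert_of_two_arcs hP ih (i - α) (z + (α : ZMod n)) m (n - α) l (by grind)
            (by omega) (by omega) (by rw [e2]; tauto)
          rw [e1, e2, Finset.union_comm (arc (z + (α : ZMod n)) m)] at this
          exact this hk
  have := key J 0 0 0 0 le_rfl (Nat.zero_le _)
  simpa [arc, hJ] using this

end TwoArcs

/-! ### Minors on index sets and their three-term Plücker relations. -/

section SetDet

variable {K : Type*} [Field K] {ι : Type*} [LinearOrder ι]

/-- The determinant of the vectors `u i`, `i ∈ T`, in increasing order; `0` if `T` does not have
the right number of elements. -/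
noncomputable def setDet {k : ℕ} (u : ι → Fin k → K) (T : Finset ι) : K :=
  if h : T.card = k then (Matrix.of fun r => u (T.orderEmbOfFin h r)).det else 0

theorem setDet_of_strictMono {k : ℕ} (u : ι → Fin k → K) {T : Finset ι} {a : Fin k → ι}
    (ha : StrictMono a) (hT : Finset.univ.image a = T) :
    setDet u T = (Matrix.of fun r => u (a r)).det := by
  have hc : T.card = k := by
    rw [← hT, Finset.card_image_of_injective _ ha.injective, Finset.card_univ, Fintype.card_fin]
  rw [setDet, dif_pos hc, ← Finset.orderEmbOfFin_unique hc (fun x => ?_) ha]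
  rw [← hT]
  exact Finset.mem_image_of_mem _ (Finset.mem_univ _)

theorem alternating_insertNth {V : Type*} [AddCommGroup V] [Module K V] {q : ℕ}
    (f : V [⋀^Fin (q + 1)]→ₗ[K] K) (p : Fin (q + 1)) (x : V) (v : Fin q → V) :
    f (p.insertNth x v) = (-1) ^ (p : ℕ) * f (Matrix.vecCons x v) := by
  have h : (p.insertNth x v : Fin (q + 1) → V) = Matrix.vecCons x v ∘ p.cycleRange :=
    (Fin.cons_comp_cycleRange x v p).symm
  rw [h, AlternatingMap.map_perm, Fin.sign_cycleRange]
  simp [Units.smul_def]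

theorem lt_card_filter_iff {q : ℕ} {S : Finset ι} (hS : S.card = q) (y : ι) (i : Fin q) :
    (i : ℕ) < (S.filter (· < y)).card ↔ S.orderEmbOfFin hS i < y := by
  have h1 : (S.filter (· < y)).card =
      (Finset.univ.filter fun i : Fin q => S.orderEmbOfFin hS i < y).card := by
    rw [← Finset.card_image_of_injective _ (S.orderEmbOfFin hS).injective]
    congr 1
    ext s
    simp only [Finset.mem_filter, Finset.mem_image, Finset.mem_univ, true_and]
    constructor
    · rintro ⟨h2, h3⟩
      have : s ∈ Set.range (S.orderEmbOfFin hS) := by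
        rw [Finset.range_orderEmbOfFin]; exact h2
      obtain ⟨j, rfl⟩ := this
      exact ⟨j, h3, rfl⟩
    · rintro ⟨j, h2, rfl⟩
      exact ⟨S.orderEmbOfFin_mem hS j, h2⟩
  rw [h1]
  constructor
  · intro h
    by_contra h2
    have : (Finset.univ.filter fun j : Fin q => S.orderEmbOfFin hS j < y) ⊆ Finset.Iio i := by
      intro j hj
      simp only [Finset.mem_filter, Finset.mem_univ, true_and, Finset.mem_Iio] at hj ⊢
      by_contra h3
      exact h2 (((S.orderEmbOfFin hS).monotone (not_lt.mp h3)).trans_lt hj)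
    have := Finset.card_le_card this
    rw [Fin.card_Iio] at this
    omega
  · intro h
    have : Finset.Iic i ⊆ (Finset.univ.filter fun j : Fin q => S.orderEmbOfFin hS j < y) := by
      intro j hj
      simp only [Finset.mem_filter, Finset.mem_univ, true_and, Finset.mem_Iic] at hj ⊢
      exact ((S.orderEmbOfFin hS).monotone hj).trans_lt h
    have := Finset.card_le_card this
    rw [Fin.card_Iic] at this
    omega

theorem orderEmbOfFin_insert {q : ℕ} {S : Finset ι} (hS : S.card = q) {y : ι} (hy : y ∉ S)
    (h : (insert y S).card = q + 1) :
    ((insert y S).orderEmbOfFin h : Fin (q + 1) → ι) =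
      Fin.insertNth ⟨(S.filter (· < y)).card,
        Nat.lt_succ_of_le ((Finset.card_filter_le _ _).trans hS.le)⟩ y (S.orderEmbOfFin hS) := by
  set p : Fin (q + 1) := ⟨(S.filter (· < y)).card,
    Nat.lt_succ_of_le ((Finset.card_filter_le _ _).trans hS.le)⟩ with hp
  have hlt : ∀ i : Fin q, i.castSucc < p ↔ S.orderEmbOfFin hS i < y :=
    fun i => lt_card_filter_iff hS y i
  have hne : ∀ i : Fin q, S.orderEmbOfFin hS i ≠ y := fun i h =>
    hy (h ▸ S.orderEmbOfFin_mem hS i)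
  symm
  refine Finset.orderEmbOfFin_unique h (fun x => ?_) ?_
  · rcases Fin.eq_self_or_eq_succAbove p x with rfl | ⟨i, rfl⟩
    · simp
    · rw [Fin.insertNth_apply_succAbove]
      exact Finset.mem_insert_of_mem (S.orderEmbOfFin_mem hS i)
  · intro a b hab
    rcases Fin.eq_self_or_eq_succAbove p a with rfl | ⟨i, rfl⟩ <;>
    rcases Fin.eq_self_or_eq_succAbove p b with rfl | ⟨j, rfl⟩
    · exact absurd hab (lt_irrefl _)
    · rw [Fin.insertNth_apply_same, Fin.insertNth_apply_succAbove]
      rw [Fin.lt_succAbove_iff_le_castSucc] at hab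
      refine lt_of_le_of_ne (not_lt.mp fun h => ?_) (hne j).symm
      exact absurd ((hlt j).mpr h) (not_lt.mpr hab)
    · rw [Fin.insertNth_apply_same, Fin.insertNth_apply_succAbove]
      rw [Fin.succAbove_lt_iff_castSucc_lt] at hab
      exact (hlt i).mp hab
    · rw [Fin.insertNth_apply_succAbove, Fin.insertNth_apply_succAbove]
      rw [Fin.succAbove_lt_succAbove_iff] at hab
      exact (S.orderEmbOfFin hS).strictMono hab

theorem comp_insertNth {α β : Type*} {q : ℕ} (f : α → β) (p : Fin (q + 1)) (x : α)
    (v : Fin q → α) : (fun r => f ((p.insertNth x v : Fin (q + 1) → α) r)) =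
      p.insertNth (f x) fun r => f (v r) := by
  funext r
  rcases Fin.eq_self_or_eq_succAbove p r with rfl | ⟨i, rfl⟩ <;> simp

theorem setDet_insert {q : ℕ} (u : ι → Fin (q + 1) → K) {S : Finset ι} (hS : S.card = q) {y : ι}
    (hy : y ∉ S) : setDet u (insert y S) = (-1) ^ (S.filter (· < y)).card *
      (Matrix.detRowAlternating (R := K)) (Matrix.vecCons (u y)
        fun r => u (S.orderEmbOfFin hS r)) := by
  have hc : (insert y S).card = q + 1 := by rw [Finset.card_insert_of_notMem hy, hS]
  rw [setDet, dif_pos hc, orderEmbOfFin_insert hS hy hc, comp_insertNth]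
  exact alternating_insertNth (Matrix.detRowAlternating (R := K))
    (⟨(S.filter (· < y)).card, Nat.lt_succ_of_le ((Finset.card_filter_le _ _).trans hS.le)⟩ :
      Fin (q + 1)) (u y) fun r => u (S.orderEmbOfFin hS r)

/-- The determinant with first two rows `x`, `y`. -/
noncomputable def detPair {q : ℕ} (s : Fin q → Fin (q + 2) → K) (x y : Fin (q + 2) → K) : K :=
  (Matrix.detRowAlternating (R := K)) (Matrix.vecCons x (Matrix.vecCons y s))

theorem setDet_insert_insert {q : ℕ} (u : ι → Fin (q + 2) → K) {S : Finset ι} (hS : S.card = q)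
    {x y : ι} (hxy : x < y) (hx : x ∉ S) (hy : y ∉ S) :
    setDet u (insert x (insert y S)) =
      (-1) ^ (S.filter (· < x)).card * (-1) ^ (S.filter (· < y)).card *
        detPair (fun r => u (S.orderEmbOfFin hS r)) (u x) (u y) := by
  have hc : (insert y S).card = q + 1 := by rw [Finset.card_insert_of_notMem hy, hS]
  rw [setDet_insert u hc (by simp [hxy.ne, hx])]
  have h1 : (insert y S).filter (· < x) = S.filter (· < x) := by
    rw [Finset.filter_insert, if_neg (not_lt.mpr hxy.le)]
  rw [h1, orderEmbOfFin_insert hS hy hc, comp_insertNth, mul_assoc, detPair]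
  congr 1
  rw [← AlternatingMap.curryLeft_apply_apply, alternating_insertNth,
    AlternatingMap.curryLeft_apply_apply]

theorem detPair_swap {q : ℕ} (s : Fin q → Fin (q + 2) → K) (x y : Fin (q + 2) → K) :
    detPair s x y = - detPair s y x := by
  have h := (Matrix.detRowAlternating (n := Fin (q + 2)) (R := K)).map_swap
    (Matrix.vecCons y (Matrix.vecCons x s)) (i := 0) (j := 1) (by simp)
  rw [detPair, detPair, ← h]
  congr 1
  funext r
  refine Fin.cases ?_ (fun r => Fin.cases ?_ (fun r => ?_) r) r
  · simp
  · simp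
  · rw [Function.comp_apply, Equiv.swap_apply_of_ne_of_ne]
    · simp
    · exact Fin.succ_ne_zero _
    · intro h
      have := congrArg Fin.val h
      simp at this

theorem detPair_self {q : ℕ} (s : Fin q → Fin (q + 2) → K) (x : Fin (q + 2) → K) :
    detPair s x x = 0 :=
  (Matrix.detRowAlternating (R := K)).map_eq_zero_of_eq _ (i := 0) (j := 1) (by simp) (by simp)

theorem detPair_row {q : ℕ} (s : Fin q → Fin (q + 2) → K) (y : Fin (q + 2) → K) (i : Fin q) :
    detPair s (s i) y = 0 :=
  (Matrix.detRowAlternating (R := K)).map_eq_zero_of_eq _ (i := 0) (j := i.succ.succ) (by simp)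
    (Fin.succ_ne_zero _).symm

/-- `detPair` as a linear form in the first argument. -/
noncomputable def detPairLeft {q : ℕ} (s : Fin q → Fin (q + 2) → K) (y : Fin (q + 2) → K) :
    (Fin (q + 2) → K) →ₗ[K] K where
  toFun x := detPair s x y
  map_add' x x' := by
    simp only [detPair, ← AlternatingMap.curryLeft_apply_apply, map_add, AlternatingMap.add_apply]
  map_smul' c x := by
    simp only [detPair, ← AlternatingMap.curryLeft_apply_apply, map_smul,
      AlternatingMap.smul_apply, RingHom.id_apply]

/-- Both sides are linear in `x`, and they agree on `e`, `f` and the rows of `s`, which form a basis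
since their determinant does not vanish. -/
theorem detPair_plucker_of_ne {q : ℕ} (s : Fin q → Fin (q + 2) → K) {e f : Fin (q + 2) → K}
    (h : detPair s e f ≠ 0) (x y : Fin (q + 2) → K) :
    detPair s x y * detPair s e f =
      detPair s x f * detPair s e y - detPair s x e * detPair s f y := by
  set L : (Fin (q + 2) → K) →ₗ[K] K := detPair s e f • detPairLeft s y -
    detPair s e y • detPairLeft s f + detPair s f y • detPairLeft s e with hL
  have hLx : ∀ x, L x = detPair s e f * detPair s x y - detPair s e y * detPair s x f +
    detPair s f y * detPair s x e := fun x => rfl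
  have h0 : L = 0 := by
    refine linear_eq_zero_of_det_ne_zero
      (M := Matrix.of (Matrix.vecCons e (Matrix.vecCons f s))) h L fun r => ?_
    refine Fin.cases ?_ (fun r => Fin.cases ?_ (fun r => ?_) r) r
    · change L e = 0
      rw [hLx, detPair_self]
      ring
    · change L f = 0
      rw [hLx, detPair_self, detPair_swap s f e]
      ring
    · change L (s r) = 0
      rw [hLx, detPair_row, detPair_row, detPair_row]
      ring
  have := hLx x
  rw [h0, LinearMap.zero_apply] at this
  linear_combination -this

/-- Any nonvanishing pair containing `x` can serve as part of the basis; if there is none, every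
term is zero. -/
theorem detPair_plucker {q : ℕ} (s : Fin q → Fin (q + 2) → K) (x y z w : Fin (q + 2) → K) :
    detPair s x z * detPair s y w =
      detPair s x y * detPair s z w + detPair s x w * detPair s y z := by
  have s1 := detPair_swap s y x
  have s2 := detPair_swap s z x
  have s3 := detPair_swap s w x
  have s4 := detPair_swap s z y
  have s5 := detPair_swap s w y
  have s6 := detPair_swap s w z
  by_cases h1 : detPair s x y = 0
  · by_cases h2 : detPair s x w = 0
    · by_cases h3 : detPair s x z = 0
      · rw [h1, h2, h3]; ring
      · have := detPair_plucker_of_ne s h3 y w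
        rw [s1, h1, h2] at this
        rw [h1, h2]
        linear_combination this
    · have := detPair_plucker_of_ne s h2 y z
      rw [s1, s6] at this
      linear_combination -this
  · have := detPair_plucker_of_ne s h1 z w
    rw [s4, s2] at this
    linear_combination -this

theorem setDet_plucker {k : ℕ} (u : ι → Fin k → K) {S : Finset ι} (hS : S.card + 2 = k)
    {a b c d : ι} (hab : a < b) (hbc : b < c) (hcd : c < d) (ha : a ∉ S) (hb : b ∉ S)
    (hc : c ∉ S) (hd : d ∉ S) :
    setDet u (insert a (insert c S)) * setDet u (insert b (insert d S)) =
      setDet u (insert a (insert b S)) * setDet u (insert c (insert d S)) +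
      setDet u (insert a (insert d S)) * setDet u (insert b (insert c S)) := by
  subst hS
  rw [setDet_insert_insert u rfl (hab.trans hbc) ha hc,
    setDet_insert_insert u rfl (hbc.trans hcd) hb hd, setDet_insert_insert u rfl hab ha hb,
    setDet_insert_insert u rfl hcd hc hd,
    setDet_insert_insert u rfl (hab.trans (hbc.trans hcd)) ha hd,
    setDet_insert_insert u rfl hbc hb hc]
  have := detPair_plucker (fun r => u (S.orderEmbOfFin rfl r)) (u a) (u b) (u c) (u d)
  -- Each of `a`, `b`, `c`, `d` enters every term exactly once, so all terms carry the same product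
  -- of four sorting signs.
  linear_combination (-1) ^ (S.filter (· < a)).card * (-1) ^ (S.filter (· < b)).card *
    (-1) ^ (S.filter (· < c)).card * (-1) ^ (S.filter (· < d)).card * this

end SetDet

/-! ### Sets of residues and their integer lifts. -/

section Residues

variable {n : ℕ} [NeZero n]

/-- The representatives in `[z, z + n)` of a set of residues. -/
noncomputable def liftSet (z : ℤ) (J : Finset (ZMod n)) : Finset ℤ :=
  (Finset.Ico z (z + n)).filter fun i => (i : ZMod n) ∈ J

theorem mem_liftSet {z i : ℤ} {J : Finset (ZMod n)} :
    i ∈ liftSet z J ↔ (z ≤ i ∧ i < z + n) ∧ (i : ZMod n) ∈ J := by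
  simp [liftSet]

theorem intCast_eq_of_window {z i j : ℤ} (hi : z ≤ i ∧ i < z + n) (hj : z ≤ j ∧ j < z + n)
    (h : (i : ZMod n) = (j : ZMod n)) : i = j := by
  rw [ZMod.intCast_eq_intCast_iff_dvd_sub] at h
  have := Int.eq_zero_of_abs_lt_dvd h (by rw [abs_lt]; omega)
  omega

theorem exists_mem_window (z : ℤ) (y : ZMod n) : ∃ i : ℤ, (z ≤ i ∧ i < z + n) ∧ (i : ZMod n) = y := by
  have hn : 0 < (n : ℤ) := by exact_mod_cast NeZero.pos n
  refine ⟨z + ((y.val : ℤ) - z) % n, ⟨?_, ?_⟩, ?_⟩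
  · have := Int.emod_nonneg ((y.val : ℤ) - z) hn.ne'; omega
  · have := Int.emod_lt_of_pos ((y.val : ℤ) - z) hn; omega
  · push_cast
    simp

theorem liftSet_image {z : ℤ} {T : Finset ℤ} (hT : ∀ i ∈ T, z ≤ i ∧ i < z + n) :
    liftSet z (T.image (Int.cast : ℤ → ZMod n)) = T := by
  ext i
  rw [mem_liftSet, Finset.mem_image]
  constructor
  · rintro ⟨h1, j, hj, h2⟩
    rwa [← intCast_eq_of_window (hT j hj) h1 h2]
  · intro h
    exact ⟨hT i h, i, h, rfl⟩

theorem liftSet_insert {z i : ℤ} (hi : z ≤ i ∧ i < z + n) (J : Finset (ZMod n)) :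
    liftSet z (insert (i : ZMod n) J) = insert i (liftSet z J) := by
  ext j
  rw [mem_liftSet, Finset.mem_insert, Finset.mem_insert, mem_liftSet]
  constructor
  · rintro ⟨h1, h2 | h2⟩
    · exact Or.inl (intCast_eq_of_window h1 hi h2)
    · exact Or.inr ⟨h1, h2⟩
  · rintro (rfl | h)
    · exact ⟨hi, Or.inl rfl⟩
    · exact ⟨h.1, Or.inr h.2⟩

theorem card_liftSet (z : ℤ) (J : Finset (ZMod n)) : (liftSet z J).card = J.card := by
  refine Finset.card_bij (fun i _ => (i : ZMod n)) ?_ ?_ ?_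
  · intro i hi; exact (mem_liftSet.mp hi).2
  · intro i hi j hj h
    exact intCast_eq_of_window (mem_liftSet.mp hi).1 (mem_liftSet.mp hj).1 h
  · intro y hy
    obtain ⟨i, hi, rfl⟩ := exists_mem_window z y
    exact ⟨i, mem_liftSet.mpr ⟨hi, hy⟩, rfl⟩

end Residues

/-! ### Minors under cyclic rotation of the index set. -/

section Rotation

variable {K : Type*} [Field K] {m n : ℕ} [NeZero n]

/-- The number of turns made by a finite set of integers around `ZMod n`. -/
def turns (n : ℕ) (T : Finset ℤ) : ℤ := ∑ i ∈ T, i / n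

/-- Moving the first row behind the `m` others costs the sign `(-1) ^ m`, which the multiplier
cancels, leaving `t`. -/
theorem setDet_rotate {t : K} {u : ℤ → Fin (m + 1) → K} (hu : QuasiPeriodic n ((-1) ^ m * t) u)
    {z : ℤ} {T : Finset ℤ} (hT : ∀ i ∈ T, z < i ∧ i < z + n) :
    t * setDet u (insert (z + n) T) = setDet u (insert z T) := by
  have h1 : z + n ∉ T := fun h => by have := (hT _ h).2; omega
  have h2 : z ∉ T := fun h => by have := (hT _ h).1; omega
  by_cases hc : T.card = m
  · rw [setDet_insert u hc h1, setDet_insert u hc h2]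
    have e1 : T.filter (· < z + n) = T := Finset.filter_true_of_mem fun i hi => (hT i hi).2
    have e2 : T.filter (· < z) = ∅ :=
      Finset.filter_false_of_mem fun i hi => not_lt.mpr (hT i hi).1.le
    rw [e1, e2, ← hu z, ← AlternatingMap.curryLeft_apply_apply,
      ← AlternatingMap.curryLeft_apply_apply, map_smul, AlternatingMap.smul_apply, hc,
      Finset.card_empty, pow_zero, smul_eq_mul]
    ring
  · rw [setDet, setDet, dif_neg, dif_neg, mul_zero]
    · rw [Finset.card_insert_of_notMem h2]; omega
    · rw [Finset.card_insert_of_notMem h1]; omega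

/-- The Plücker coordinates of `u`, indexed by sets of residues. -/
noncomputable def residueDet (u : ℤ → Fin (m + 1) → K) (J : Finset (ZMod n)) : K :=
  setDet u (liftSet 0 J)

/-- Only the class of `z` can change its lift, to `z + n`; this raises `turns` by one, which makes
up for the factor `t` in `setDet_rotate`. -/
theorem setDet_liftSet_succ {t : K} (ht : t ≠ 0) {u : ℤ → Fin (m + 1) → K}
    (hu : QuasiPeriodic n ((-1) ^ m * t) u) (J : Finset (ZMod n)) (z : ℤ) :
    setDet u (liftSet (z + 1) J) * t ^ turns n (liftSet (z + 1) J) =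
      setDet u (liftSet z J) * t ^ turns n (liftSet z J) := by
  have hn : 0 < (n : ℤ) := by exact_mod_cast NeZero.pos n
  set T : Finset ℤ := (Finset.Ioo z (z + n)).filter fun i : ℤ => (i : ZMod n) ∈ J with hTd
  have hT : ∀ i ∈ T, z < i ∧ i < z + n := by
    intro i hi
    rw [hTd, Finset.mem_filter, Finset.mem_Ioo] at hi
    exact hi.1
  have hTm : ∀ i, i ∈ T ↔ (z < i ∧ i < z + n) ∧ (i : ZMod n) ∈ J := by
    intro i; rw [hTd, Finset.mem_filter, Finset.mem_Ioo]
  by_cases hz : (z : ZMod n) ∈ J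
  · have hz' : ((z + n : ℤ) : ZMod n) ∈ J := by push_cast; simpa using hz
    have e1 : liftSet (z + 1) J = insert (z + n) T := by
      ext i
      rw [mem_liftSet, Finset.mem_insert, hTm]
      constructor
      · rintro ⟨h1, h2⟩
        by_cases h : i = z + n
        · exact Or.inl h
        · exact Or.inr ⟨by omega, h2⟩
      · rintro (rfl | ⟨h1, h2⟩)
        · exact ⟨by omega, hz'⟩
        · exact ⟨by omega, h2⟩
    have e2 : liftSet z J = insert z T := by
      ext i
      rw [mem_liftSet, Finset.mem_insert, hTm]
      constructor
      · rintro ⟨h1, h2⟩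
        by_cases h : i = z
        · exact Or.inl h
        · exact Or.inr ⟨by omega, h2⟩
      · rintro (rfl | ⟨h1, h2⟩)
        · exact ⟨by omega, hz⟩
        · exact ⟨by omega, h2⟩
    have h1 : z + n ∉ T := fun h => by have := (hT _ h).2; omega
    have h2 : z ∉ T := fun h => by have := (hT _ h).1; omega
    rw [e1, e2, ← setDet_rotate hu hT, turns, turns, Finset.sum_insert h1, Finset.sum_insert h2,
      Int.add_ediv_of_dvd_right (dvd_refl _), Int.ediv_self hn.ne', add_right_comm,
      zpow_add_one₀ ht]
    ring
  · have hz' : ((z + n : ℤ) : ZMod n) ∉ J := by push_cast; simpa using hz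
    have e1 : liftSet (z + 1) J = liftSet z J := by
      ext i
      rw [mem_liftSet, mem_liftSet]
      constructor
      · rintro ⟨h1, h2⟩
        have : i ≠ z + n := by rintro rfl; exact hz' h2
        exact ⟨by omega, h2⟩
      · rintro ⟨h1, h2⟩
        have : i ≠ z := by rintro rfl; exact hz h2
        exact ⟨by omega, h2⟩
    rw [e1]

theorem setDet_liftSet {t : K} (ht : t ≠ 0) {u : ℤ → Fin (m + 1) → K}
    (hu : QuasiPeriodic n ((-1) ^ m * t) u) (J : Finset (ZMod n)) (z : ℤ) :
    setDet u (liftSet z J) * t ^ turns n (liftSet z J) = residueDet u J := by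
  induction z with
  | zero =>
    have : turns n (liftSet 0 J) = 0 := by
      refine Finset.sum_eq_zero fun i hi => ?_
      have := (mem_liftSet.mp hi).1
      exact Int.ediv_eq_zero_of_lt this.1 (by omega)
    rw [this, zpow_zero, mul_one, residueDet]
  | succ z ih => rw [setDet_liftSet_succ ht hu, ih]
  | pred z ih => rw [← ih, ← setDet_liftSet_succ ht hu, sub_add_cancel]

theorem setDet_eq {t : K} (ht : t ≠ 0) {u : ℤ → Fin (m + 1) → K}
    (hu : QuasiPeriodic n ((-1) ^ m * t) u) {z : ℤ} {T : Finset ℤ}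
    (hT : ∀ i ∈ T, z ≤ i ∧ i < z + n) :
    setDet u T * t ^ turns n T = residueDet u (T.image (Int.cast : ℤ → ZMod n)) := by
  have := setDet_liftSet ht hu (T.image (Int.cast : ℤ → ZMod n)) z
  rwa [liftSet_image hT] at this

theorem residueDet_insert_insert {t : K} (ht : t ≠ 0) {u : ℤ → Fin (m + 1) → K}
    (hu : QuasiPeriodic n ((-1) ^ m * t) u) (z : ZMod n) {a b : ℕ} (ha : a < n) (hb : b < n)
    (hab : a ≠ b) {S : Finset (ZMod n)} (haS : z + (a : ZMod n) ∉ S)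
    (hbS : z + (b : ZMod n) ∉ S) :
    ((z.val + a : ℕ) : ℤ) ∉ liftSet z.val S ∧
    residueDet u (insert (z + (a : ZMod n)) (insert (z + (b : ZMod n)) S)) =
      setDet u (insert ((z.val + a : ℕ) : ℤ) (insert ((z.val + b : ℕ) : ℤ) (liftSet z.val S))) *
        (t ^ (((z.val + a : ℕ) : ℤ) / n) * t ^ (((z.val + b : ℕ) : ℤ) / n) *
          t ^ turns n (liftSet z.val S)) := by
  have ea : z + (a : ZMod n) = (((z.val + a : ℕ) : ℤ) : ZMod n) := by simp
  have eb : z + (b : ZMod n) = (((z.val + b : ℕ) : ℤ) : ZMod n) := by simp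
  have ha' : ((z.val + a : ℕ) : ℤ) ∉ liftSet z.val S := by
    rw [mem_liftSet, ← ea]; exact fun h => haS h.2
  have hb' : ((z.val + b : ℕ) : ℤ) ∉ liftSet z.val S := by
    rw [mem_liftSet, ← eb]; exact fun h => hbS h.2
  refine ⟨ha', ?_⟩
  rw [← setDet_liftSet ht hu _ (z.val : ℤ), ea, eb, liftSet_insert (by push_cast; omega),
    liftSet_insert (by push_cast; omega)]
  congr 1
  rw [turns, Finset.sum_insert, Finset.sum_insert hb', zpow_add₀ ht, zpow_add₀ ht, turns, mul_assoc]
  rw [Finset.mem_insert]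
  rintro (h | h)
  · apply hab; omega
  · exact ha' h

end Rotation

/-! ### Positive points and criteria for positivity. -/

section Positive

variable {m n : ℕ}

/-- Lifting to the window at `z.val` puts the four residues in increasing order. The powers of `t`
are multiplicative over the lifted elements, so the ordinary relation is multiplied by a common
factor. -/
theorem cyclicPlucker_residueDet [NeZero n] {t : ℝ} (ht : t ≠ 0) {u : ℤ → Fin (m + 1) → ℝ}
    (hu : QuasiPeriodic n ((-1) ^ m * t) u) :
    CyclicPlucker (n := n) (m + 1) (residueDet u) := by
  intro z a b c d hab hbc hcd hd S hS ha' hb' hc' hd'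
  obtain ⟨na, h1⟩ := residueDet_insert_insert ht hu z (show a < n by omega) (show c < n by omega)
    (by omega) ha' hc'
  obtain ⟨nb, h2⟩ := residueDet_insert_insert ht hu z (show b < n by omega) (show d < n by omega)
    (by omega) hb' hd'
  obtain ⟨-, h3⟩ := residueDet_insert_insert ht hu z (show a < n by omega) (show b < n by omega)
    (by omega) ha' hb'
  obtain ⟨nc, h4⟩ := residueDet_insert_insert ht hu z (show c < n by omega) (show d < n by omega)
    (by omega) hc' hd'
  obtain ⟨-, h5⟩ := residueDet_insert_insert ht hu z (show a < n by omega) (show d < n by omega)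
    (by omega) ha' hd'
  obtain ⟨-, h6⟩ := residueDet_insert_insert ht hu z (show b < n by omega) (show c < n by omega)
    (by omega) hb' hc'
  obtain ⟨nd, -⟩ := residueDet_insert_insert ht hu z (show d < n by omega) (show a < n by omega)
    (by omega) hd' ha'
  rw [h1, h2, h3, h4, h5, h6]
  have := setDet_plucker u (S := liftSet z.val S) (by rw [card_liftSet, hS])
    (a := ((z.val + a : ℕ) : ℤ)) (b := ((z.val + b : ℕ) : ℤ)) (c := ((z.val + c : ℕ) : ℤ))
    (d := ((z.val + d : ℕ) : ℤ)) (by omega) (by omega) (by omega) na nb nc nd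
  generalize t ^ turns n (liftSet z.val S) = w
  generalize t ^ (((z.val + a : ℕ) : ℤ) / n) = wa
  generalize t ^ (((z.val + b : ℕ) : ℤ) / n) = wb
  generalize t ^ (((z.val + c : ℕ) : ℤ) / n) = wc
  generalize t ^ (((z.val + d : ℕ) : ℤ) / n) = wd
  linear_combination wa * wb * wc * wd * w ^ 2 * this

/-- `u` represents a positive point: all its maximal minors inside one period are positive. -/
structure TotallyPositive (n : ℕ) (t : ℝ) (u : ℤ → Fin (m + 1) → ℝ) : Prop where
  lt : m + 1 < n
  pos : 0 < t
  periodic : QuasiPeriodic n ((-1) ^ m * t) u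
  setDet_pos : ∀ (z : ℤ) (T : Finset ℤ), T.card = m + 1 → (∀ i ∈ T, z ≤ i ∧ i < z + n) →
    0 < setDet u T

theorem TotallyPositive.det_pos {t : ℝ} {u : ℤ → Fin (m + 1) → ℝ} (hu : TotallyPositive n t u)
    {a : Fin (m + 1) → ℤ} (ha : StrictMono a) (z : ℤ) (hz : ∀ r, z ≤ a r ∧ a r < z + n) :
    0 < (Matrix.of fun r => u (a r)).det := by
  rw [← setDet_of_strictMono u ha rfl]
  refine hu.setDet_pos z _ ?_ ?_
  · rw [Finset.card_image_of_injective _ ha.injective, Finset.card_univ, Fintype.card_fin]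
  · intro i hi
    obtain ⟨r, -, rfl⟩ := Finset.mem_image.mp hi
    exact hz r

theorem TotallyPositive.window_pos {t : ℝ} {u : ℤ → Fin (m + 1) → ℝ} (hu : TotallyPositive n t u)
    (a : ℤ) : 0 < (window u a).det := by
  have := hu.lt
  refine hu.det_pos (a := fun r : Fin (m + 1) => a + (r : ℕ)) ?_ a fun r => ?_
  · intro r s hrs
    have : (r : ℕ) < s := hrs
    simp only
    omega
  · have := r.2
    omega

theorem TotallyPositive.nondegenerate {t : ℝ} {u : ℤ → Fin (m + 1) → ℝ}
    (hu : TotallyPositive n t u) : Nondegenerate n t u :=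
  ⟨hu.lt, hu.pos.ne', hu.periodic, fun a => (hu.window_pos a).ne'⟩

/-- Lifts of the same residues to different windows have minors differing by a power of `t > 0`, so
a single window decides. -/
theorem totallyPositive_iff [NeZero n] (hlt : m + 1 < n) {t : ℝ} (ht : 0 < t)
    {u : ℤ → Fin (m + 1) → ℝ} (hu : QuasiPeriodic n ((-1) ^ m * t) u) :
    TotallyPositive n t u ↔ ∀ J : Finset (ZMod n), J.card = m + 1 → 0 < residueDet u J := by
  constructor
  · intro h J hJ
    exact h.setDet_pos 0 _ (by rw [card_liftSet, hJ]) fun i hi => (mem_liftSet.mp hi).1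
  · intro h
    refine ⟨hlt, ht, hu, fun z T hT hz => ?_⟩
    have h1 := setDet_eq ht.ne' hu hz
    have h2 : 0 < residueDet u (T.image (Int.cast : ℤ → ZMod n)) := by
      apply h
      rw [← card_liftSet z, liftSet_image hz, hT]
    rw [← h1] at h2
    exact pos_of_mul_pos_left h2 (zpow_pos ht _).le

theorem card_arc [NeZero n] (z : ZMod n) {l : ℕ} (hl : l ≤ n) : (arc z l).card = l := by
  rw [arc, Finset.card_image_of_injOn, Finset.card_range]
  intro i hi j hj h
  simp only [Finset.coe_range, Set.mem_Iio] at hi hj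
  exact (add_natCast_inj z (by omega) (by omega)).mp h

theorem image_Ico [NeZero n] (a : ℤ) (l : ℕ) :
    (Finset.Ico a (a + l)).image (Int.cast : ℤ → ZMod n) = arc (a : ZMod n) l := by
  ext y
  simp only [arc, Finset.mem_image, Finset.mem_Ico, Finset.mem_range]
  constructor
  · rintro ⟨i, hi, rfl⟩
    refine ⟨(i - a).toNat, by omega, ?_⟩
    rw [← Int.cast_natCast (i - a).toNat, Int.toNat_of_nonneg (by omega)]
    push_cast
    ring
  · rintro ⟨i, hi, rfl⟩
    exact ⟨a + i, by omega, by push_cast; ring⟩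

theorem setDet_Ico {K : Type*} [Field K] (u : ℤ → Fin (m + 1) → K) (a : ℤ) :
    setDet u (Finset.Ico a (a + (m + 1 : ℕ))) = (window u a).det := by
  refine setDet_of_strictMono u (a := fun r : Fin (m + 1) => a + (r : ℕ)) ?_ ?_
  · intro r s hrs
    have : (r : ℕ) < s := hrs
    simp only
    omega
  · ext i
    simp only [Finset.mem_image, Finset.mem_univ, true_and, Finset.mem_Ico]
    constructor
    · rintro ⟨r, rfl⟩; omega
    · intro h
      exact ⟨⟨(i - a).toNat, by omega⟩, by simp only; omega⟩

/-- A nonnegative point with positive cyclically consecutive minors is positive. -/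
theorem totallyPositive_of_nonneg (hlt : m + 1 < n) {t : ℝ} (ht : 0 < t)
    {u : ℤ → Fin (m + 1) → ℝ} (hu : QuasiPeriodic n ((-1) ^ m * t) u)
    (h0 : ∀ T : Finset ℤ, (∀ i ∈ T, 0 ≤ i ∧ i < 0 + (n : ℤ)) → 0 ≤ setDet u T)
    (hw : ∀ a, 0 < (window u a).det) : TotallyPositive n t u := by
  have : NeZero n := ⟨by omega⟩
  rw [totallyPositive_iff hlt ht hu]
  refine pos_of_arcs (cyclicPlucker_residueDet ht.ne' hu)
    (fun J _ => h0 _ fun i hi => (mem_liftSet.mp hi).1) fun z l hl hc => ?_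
  rw [card_arc z hl] at hc
  subst hc
  have h1 := setDet_eq ht.ne' hu (z := (z.val : ℤ))
    (T := Finset.Ico (z.val : ℤ) (z.val + (m + 1 : ℕ))) (fun i hi => by
      rw [Finset.mem_Ico] at hi; omega)
  rw [image_Ico, setDet_Ico] at h1
  have h2 : (((z.val : ℕ) : ℤ) : ZMod n) = z := by simp
  rw [h2] at h1
  rw [← h1]
  exact mul_pos (hw _) (zpow_pos ht _)

/-- A point whose minors on unions of two cyclic intervals are positive is positive. -/
theorem totallyPositive_of_two_intervals (hlt : m + 1 < n) {t : ℝ} (ht : 0 < t)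
    {u : ℤ → Fin (m + 1) → ℝ} (hu : QuasiPeriodic n ((-1) ^ m * t) u)
    (hw : ∀ (a b : ℤ) (p q : ℕ), p + q = m + 1 → a + p ≤ b → b + q ≤ a + n →
      0 < setDet u (Finset.Ico a (a + p) ∪ Finset.Ico b (b + q))) : TotallyPositive n t u := by
  have : NeZero n := ⟨by omega⟩
  rw [totallyPositive_iff hlt ht hu]
  refine pos_of_two_arcs (cyclicPlucker_residueDet ht.ne' hu) fun z l α q hl hq hc => ?_
  have hT : ∀ i ∈ Finset.Ico (z.val : ℤ) (z.val + l) ∪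
      Finset.Ico ((z.val : ℤ) + α) ((z.val : ℤ) + α + q),
      (z.val : ℤ) ≤ i ∧ i < z.val + n := by
    intro i hi
    rw [Finset.mem_union, Finset.mem_Ico, Finset.mem_Ico] at hi
    omega
  have h1 := setDet_eq ht.ne' hu hT
  have h2 : (((z.val : ℕ) : ℤ) : ZMod n) = z := by simp
  rw [Finset.image_union, image_Ico, image_Ico, Int.cast_add, h2, Int.cast_natCast] at h1
  have hd : Disjoint (arc z l) (arc (z + (α : ZMod n)) q) := by
    rw [Finset.disjoint_left]
    intro y hy hy'
    obtain ⟨i, hi, rfl⟩ := exists_offset z y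
    rw [mem_arc_self z hi (by omega)] at hy
    rw [mem_arc_offset z hi (by omega) (by omega)] at hy'
    omega
  rw [Finset.card_union_of_disjoint hd, card_arc _ (by omega), card_arc _ (by omega)] at hc
  rw [← h1]
  exact mul_pos (hw _ _ l q hc (by omega) (by omega)) (zpow_pos ht _)

end Positive

/-! ### The twist and its pairing with the original point. -/

section Twist

variable {K : Type*} [Field K] {m n : ℕ}

/-- The vector of the linear form `bracket u j`. -/
noncomputable def twist (u : ℤ → Fin (m + 1) → K) (j : ℤ) : Fin (m + 1) → K :=
  fun l => bracket u j (Pi.single l 1)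

theorem bracket_eq_sum (u : ℤ → Fin (m + 1) → K) (j : ℤ) (x : Fin (m + 1) → K) :
    bracket u j x = ∑ l, twist u j l * x l := by
  rw [LinearMap.pi_apply_eq_sum_univ (bracket u j) x]
  refine Finset.sum_congr rfl fun l _ => ?_
  rw [smul_eq_mul, mul_comm, twist]
  congr 2
  funext j
  simp [Pi.single_apply, eq_comm]

theorem twist_quasiPeriodic {t : K} (ht : t ≠ 0) {u : ℤ → Fin (m + 1) → K}
    (hu : QuasiPeriodic n ((-1) ^ m * t) u) :
    QuasiPeriodic n ((-1) ^ m * t ^ m) (twist u) := by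
  intro j
  funext l
  have h := bracket_add (twist_ne ht) hu j (Pi.single l 1)
  rw [mul_pow, ← pow_mul] at h
  have e : ((-1 : K)) ^ (m * m) = (-1) ^ m := by
    rcases Nat.even_or_odd m with hm | hm
    · rw [hm.neg_one_pow, (hm.mul_right m).neg_one_pow]
    · rw [hm.neg_one_pow, (hm.mul hm).neg_one_pow]
  rw [e] at h
  exact h

/-- Brackets are scalar products of twist vectors with vectors of `u`, so their matrix is a product
of two square matrices. The indexing by `ι` allows sums of intervals, for block decompositions. -/
theorem det_pairing {ι : Type*} [Fintype ι] [DecidableEq ι] (e : Fin (m + 1) ≃ ι)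
    (u : ℤ → Fin (m + 1) → K) (x y : ι → ℤ) :
    (Matrix.of fun r s => bracket u (x r) (u (y s))).det =
      (Matrix.of fun r => twist u (x (e r))).det * (Matrix.of fun r => u (y (e r))).det := by
  rw [← Matrix.det_submatrix_equiv_self e, ← Matrix.det_transpose (Matrix.of fun r => u (y (e r))),
    ← Matrix.det_mul]
  congr 1
  ext r s
  simp only [Matrix.submatrix_apply, Matrix.of_apply, Matrix.mul_apply, Matrix.transpose_apply]
  exact bracket_eq_sum _ _ _

theorem det_bracket_interval (u : ℤ → Fin (m + 1) → K) (a : ℤ) {q : ℕ} (hq : q ≤ m + 1) :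
    (Matrix.of fun r s : Fin q => bracket u (a + (r : ℕ)) (u (a + (s : ℕ)))).det =
      ∏ r : Fin q, (window u (a + (r : ℕ) - m)).det := by
  rw [Matrix.det_of_isUpperTriangular]
  · exact Finset.prod_congr rfl fun r _ => bracket_self u _
  · intro r s hsr
    have h : (s : ℕ) < r := hsr
    have := r.2
    exact bracket_eq_zero u (by omega) (by omega)

end Twist

/-! ### Operations preserving positivity, and Cauchy–Binet. -/

section Positive

variable {m n : ℕ}

theorem strictMono_elim {p q k : ℕ} (h : k = p + q) {a b : ℤ} (hab : a + p ≤ b) :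
    StrictMono fun r : Fin k => Sum.elim (fun r : Fin p => a + (r : ℕ))
      (fun r : Fin q => b + (r : ℕ)) (((finCongr h).trans finSumFinEquiv.symm) r) := by
  subst h
  intro r s hrs
  have hrs' : (r : ℕ) < s := hrs
  simp only [finCongr_refl, Equiv.refl_trans]
  induction r using Fin.addCases <;> induction s using Fin.addCases <;>
    simp at hrs' ⊢ <;> omega

theorem image_elim {p q k : ℕ} (h : k = p + q) (a b : ℤ) :
    Finset.univ.image (fun r : Fin k => Sum.elim (fun r : Fin p => a + (r : ℕ))
      (fun r : Fin q => b + (r : ℕ)) (((finCongr h).trans finSumFinEquiv.symm) r)) =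
      Finset.Ico a (a + p) ∪ Finset.Ico b (b + q) := by
  ext i
  simp only [Finset.mem_image, Finset.mem_univ, true_and, Finset.mem_union, Finset.mem_Ico]
  constructor
  · rintro ⟨r, rfl⟩
    generalize ((finCongr h).trans finSumFinEquiv.symm) r = x
    rcases x with x | x
    · left; simp
    · right; simp
  · rintro (h1 | h1)
    · refine ⟨((finCongr h).trans finSumFinEquiv.symm).symm (Sum.inl ⟨(i - a).toNat, by omega⟩), ?_⟩
      rw [Equiv.apply_symm_apply]
      simp only [Sum.elim_inl]
      omega
    · refine ⟨((finCongr h).trans finSumFinEquiv.symm).symm (Sum.inr ⟨(i - b).toNat, by omega⟩), ?_⟩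
      rw [Equiv.apply_symm_apply]
      simp only [Sum.elim_inr]
      omega

theorem elim_mem {p q : ℕ} {a b : ℤ} (hab : a + p ≤ b) (hb : b + q ≤ a + n) (x : Fin p ⊕ Fin q) :
    a ≤ Sum.elim (fun r : Fin p => a + (r : ℕ)) (fun r : Fin q => b + (r : ℕ)) x ∧
      Sum.elim (fun r : Fin p => a + (r : ℕ)) (fun r : Fin q => b + (r : ℕ)) x < a + n := by
  rcases x with x | x <;> simp only [Sum.elim_inl, Sum.elim_inr] <;> have := x.2 <;> omega

/-- It suffices to treat rows in two intervals. Pairing them with suitable rows of `u` gives a block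
triangular matrix, whose blocks are `P` and a triangular one with positive diagonal. The same `P`
occurs when a full interval of twist rows is paired with two intervals of `u`, and interval minors
of the twist are positive by a triangular pairing. So `P` has positive determinant. -/
theorem TotallyPositive.twist {t : ℝ} {u : ℤ → Fin (m + 1) → ℝ} (hu : TotallyPositive n t u) :
    TotallyPositive n (t ^ m) (twist u) := by
  have hlt := hu.lt
  refine totallyPositive_of_two_intervals hu.lt (pow_pos hu.pos m)
    (twist_quasiPeriodic hu.pos.ne' hu.periodic) fun a b p q hpq hab hb => ?_
  have hprod : ∀ (c : ℤ) (l : ℕ), 0 < ∏ r : Fin l, (window u (c + (r : ℕ) - m)).det :=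
    fun c l => Finset.prod_pos fun r _ => hu.window_pos _
  have h3 := det_pairing (Equiv.refl _) u (fun r : Fin (m + 1) => a - q + (r : ℕ))
    (fun r => a - q + (r : ℕ))
  rw [det_bracket_interval u _ le_rfl] at h3
  have h3' : 0 < (Matrix.of fun r : Fin (m + 1) =>
      GeometricR.twist u (a - q + (r : ℕ))).det := by
    refine pos_of_mul_pos_left ?_ (hu.window_pos (a - q)).le
    refine lt_of_lt_of_eq (hprod (a - q) (m + 1)) h3
  set P : Matrix (Fin p) (Fin p) ℝ :=
    Matrix.of fun r s => bracket u (a + (r : ℕ)) (u (b - p + (s : ℕ))) with hP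
  have h2 := det_pairing ((finCongr (show m + 1 = q + p by omega)).trans finSumFinEquiv.symm) u
    (Sum.elim (fun r : Fin q => a - q + (r : ℕ)) (fun r : Fin p => a + (r : ℕ)))
    (Sum.elim (fun r : Fin q => a - q + (r : ℕ)) (fun r : Fin p => b - p + (r : ℕ)))
  have e2 : (Matrix.of fun r s => bracket u
      (Sum.elim (fun r : Fin q => a - q + (r : ℕ)) (fun r : Fin p => a + (r : ℕ)) r)
      (u (Sum.elim (fun r : Fin q => a - q + (r : ℕ)) (fun r : Fin p => b - p + (r : ℕ)) s))) =
      Matrix.fromBlocks (Matrix.of fun r s : Fin q => bracket u (a - q + (r : ℕ))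
        (u (a - q + (s : ℕ))))
        (Matrix.of fun (r : Fin q) (s : Fin p) => bracket u (a - q + (r : ℕ))
        (u (b - p + (s : ℕ)))) 0 P := by
    ext r s
    rcases r with r | r <;> rcases s with s | s <;> simp only [Matrix.of_apply, Sum.elim_inl,
      Sum.elim_inr, Matrix.fromBlocks_apply₁₁, Matrix.fromBlocks_apply₁₂,
      Matrix.fromBlocks_apply₂₁, Matrix.fromBlocks_apply₂₂, Matrix.zero_apply, hP]
    have := r.2
    have := s.2
    exact bracket_eq_zero u (by omega) (by omega)
  have h2w : 0 < (Matrix.of fun r => u ((Sum.elim (fun r : Fin q => a - q + (r : ℕ))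
      (fun r : Fin p => b - p + (r : ℕ)))
      (((finCongr (show m + 1 = q + p by omega)).trans finSumFinEquiv.symm) r))).det :=
    hu.det_pos (strictMono_elim _ (by omega)) (a - q) fun r => elim_mem (by omega) (by omega) _
  have h2t : (fun r => Sum.elim (fun r : Fin q => a - q + (r : ℕ)) (fun r : Fin p => a + (r : ℕ))
      (((finCongr (show m + 1 = q + p by omega)).trans finSumFinEquiv.symm) r)) =
      fun r : Fin (m + 1) => a - q + (r : ℕ) := by
    have s1 : StrictMono fun r : Fin (m + 1) => a - q + ((r : ℕ) : ℤ) := by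
      intro r s hrs
      have : (r : ℕ) < s := hrs
      simp only
      omega
    have hc : ((Finset.Ico (a - q) (a - q + (m + 1 : ℕ)))).card = m + 1 := by simp
    have s2 := strictMono_elim (p := q) (q := p) (k := m + 1) (a := a - q) (b := a) (by omega)
      (by omega)
    refine (Finset.orderEmbOfFin_unique hc (fun r => ?_) s2).trans
      (Finset.orderEmbOfFin_unique hc (fun r => ?_) s1).symm
    · have := elim_mem (n := m + 1) (a := a - q) (b := a) (p := q) (q := p) (by omega) (by omega)
        (((finCongr (show m + 1 = q + p by omega)).trans finSumFinEquiv.symm) r)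
      rw [Finset.mem_Ico]; exact this
    · rw [Finset.mem_Ico]; have := r.2; omega
  rw [e2, Matrix.det_fromBlocks_zero₂₁, det_bracket_interval u _ (by omega)] at h2
  have hPpos : 0 < P.det := by
    refine pos_of_mul_pos_right ?_ (hprod (a - q) q).le
    rw [h2]
    refine mul_pos ?_ h2w
    have := congrFun h2t
    simp only [this]
    exact h3'
  have h1 := det_pairing ((finCongr (show m + 1 = p + q by omega)).trans finSumFinEquiv.symm) u
    (Sum.elim (fun r : Fin p => a + (r : ℕ)) (fun r : Fin q => b + (r : ℕ)))
    (Sum.elim (fun r : Fin p => b - p + (r : ℕ)) (fun r : Fin q => b + (r : ℕ)))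
  have e1 : (Matrix.of fun r s => bracket u
      (Sum.elim (fun r : Fin p => a + (r : ℕ)) (fun r : Fin q => b + (r : ℕ)) r)
      (u (Sum.elim (fun r : Fin p => b - p + (r : ℕ)) (fun r : Fin q => b + (r : ℕ)) s))) =
      Matrix.fromBlocks P (Matrix.of fun (r : Fin p) (s : Fin q) => bracket u (a + (r : ℕ)) (u (b + (s : ℕ)))) 0
        (Matrix.of fun r s : Fin q => bracket u (b + (r : ℕ)) (u (b + (s : ℕ)))) := by
    ext r s
    rcases r with r | r <;> rcases s with s | s <;> simp only [Matrix.of_apply, Sum.elim_inl,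
      Sum.elim_inr, Matrix.fromBlocks_apply₁₁, Matrix.fromBlocks_apply₁₂,
      Matrix.fromBlocks_apply₂₁, Matrix.fromBlocks_apply₂₂, Matrix.zero_apply, hP]
    have := r.2
    have := s.2
    exact bracket_eq_zero u (by omega) (by omega)
  rw [e1, Matrix.det_fromBlocks_zero₂₁, det_bracket_interval u _ (by omega)] at h1
  have h1w : 0 < (Matrix.of fun r => u ((Sum.elim (fun r : Fin p => b - p + (r : ℕ))
      (fun r : Fin q => b + (r : ℕ)))
      (((finCongr (show m + 1 = p + q by omega)).trans finSumFinEquiv.symm) r))).det :=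
    hu.det_pos (strictMono_elim _ (by omega)) (b - p) fun r => elim_mem (by omega) (by omega) _
  rw [setDet_of_strictMono _ (strictMono_elim (show m + 1 = p + q by omega) hab) (image_elim _ a b)]
  exact pos_of_mul_pos_left (by rw [← h1]; exact mul_pos hPpos (hprod b q)) h1w.le

/-- Rescaling the rows of a positive point. -/
theorem TotallyPositive.rescale {t α : ℝ} {u : ℤ → Fin (m + 1) → ℝ} (hu : TotallyPositive n t u)
    {c : ℤ → ℝ} (hc : ∀ i, 0 < c i) (hα : 0 < α) (h : ∀ i, α * c (i + n) = c i) :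
    TotallyPositive n (t * α) fun i => c i • u i := by
  refine ⟨hu.lt, mul_pos hu.pos hα, ?_, ?_⟩
  · intro i
    simp only
    rw [← h i, ← hu.periodic i, smul_smul, smul_smul]
    congr 1
    ring
  · intro z T hT hz
    have := hu.setDet_pos z T hT hz
    rw [setDet, dif_pos hT] at this ⊢
    have e : (Matrix.of fun r => c (T.orderEmbOfFin hT r) • u (T.orderEmbOfFin hT r)) =
        Matrix.of fun r l => c (T.orderEmbOfFin hT r) *
          (Matrix.of fun r => u (T.orderEmbOfFin hT r)) r l := by
      ext r l; simp
    rw [e, Matrix.det_mul_column]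
    exact mul_pos (Finset.prod_pos fun r _ => hc _) this

/-- Reversing both the order of the rows and the order of the coordinates. -/
def reflect (u : ℤ → Fin (m + 1) → ℝ) (i : ℤ) : Fin (m + 1) → ℝ := fun l => u (-i) l.rev

/-- Reversing rows and coordinates together permutes the two sides of each minor by the same
permutation, so no sign appears. -/
theorem TotallyPositive.reflect {t : ℝ} {u : ℤ → Fin (m + 1) → ℝ} (hu : TotallyPositive n t u) :
    TotallyPositive n t⁻¹ (reflect u) := by
  have ht := hu.pos
  refine ⟨hu.lt, inv_pos.mpr hu.pos, ?_, ?_⟩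
  · intro i
    have h := hu.periodic (-i - n)
    rw [sub_add_cancel] at h
    funext l
    have h' := congrFun h l.rev
    simp only [GeometricR.reflect, Pi.smul_apply, smul_eq_mul] at h' ⊢
    rw [show -(i + (n : ℤ)) = -i - n by ring, ← h']
    have e : ((-1 : ℝ)) ^ m * (-1) ^ m = 1 := by rw [← mul_pow]; norm_num
    field_simp
    linear_combination (u (-i) l.rev) * e
  · intro z T hT hz
    rw [setDet, dif_pos hT]
    have hmono : StrictMono fun r : Fin (m + 1) => -(T.orderEmbOfFin hT r.rev) := by
      intro r s hrs
      have : T.orderEmbOfFin hT s.rev < T.orderEmbOfFin hT r.rev :=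
        (T.orderEmbOfFin hT).strictMono (Fin.rev_lt_rev.mpr hrs)
      simp only
      omega
    have := hu.det_pos hmono (-z - n + 1) fun r => by
      have := hz _ (T.orderEmbOfFin_mem hT r.rev)
      omega
    rw [← Matrix.det_submatrix_equiv_self Fin.revPerm] at this
    have e : (Matrix.of fun r => GeometricR.reflect u (T.orderEmbOfFin hT r)) =
        (Matrix.of fun r => u (-(T.orderEmbOfFin hT r.rev))).submatrix Fin.revPerm Fin.revPerm := by
      ext r l
      simp [GeometricR.reflect]
    rw [e]
    exact this

theorem det_submatrix_sq {r : ℕ} {ι : Type*} (A : Matrix (Fin r) ι ℝ) (B : Matrix ι (Fin r) ℝ)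
    (f : Fin r → ι) (σ : Equiv.Perm (Fin r)) :
    (A.submatrix id f).det * (B.submatrix f id).det =
      (A.submatrix id (f ∘ σ)).det * (B.submatrix (f ∘ σ) id).det := by
  have h1 : (A.submatrix id (f ∘ σ)).det = ((Equiv.Perm.sign σ : ℤ) : ℝ) * (A.submatrix id f).det := by
    rw [← Matrix.det_permute' σ]; rfl
  have h2 : (B.submatrix (f ∘ σ) id).det = ((Equiv.Perm.sign σ : ℤ) : ℝ) * (B.submatrix f id).det := by
    rw [← Matrix.det_permute σ]; rfl
  rw [h1, h2]
  have : (((Equiv.Perm.sign σ : ℤ) : ℝ)) * ((Equiv.Perm.sign σ : ℤ) : ℝ) = 1 := by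
    rcases Int.units_eq_one_or (Equiv.Perm.sign σ) with h | h <;> rw [h] <;> norm_num
  linear_combination -(A.submatrix id f).det * (B.submatrix f id).det * this

/-- The Cauchy–Binet formula, summed over all tuples of indices. -/
theorem factorial_mul_det_mul {r : ℕ} {ι : Type*} [Fintype ι] [DecidableEq ι]
    (A : Matrix (Fin r) ι ℝ) (B : Matrix ι (Fin r) ℝ) :
    (r.factorial : ℝ) * (A * B).det =
      ∑ f : Fin r → ι, (A.submatrix id f).det * (B.submatrix f id).det := by
  have h1 : (A * B).det = ∑ f : Fin r → ι, (∏ i, A i (f i)) * (B.submatrix f id).det := by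
    have : A * B = Matrix.of fun i => ∑ j, A i j • B j := by
      ext i l
      simp [Matrix.mul_apply, Finset.sum_apply]
    rw [this]
    change (Matrix.detRowAlternating (R := ℝ)).toMultilinearMap (fun i => ∑ j, A i j • B j) = _
    rw [MultilinearMap.map_sum]
    refine Finset.sum_congr rfl fun f _ => ?_
    rw [MultilinearMap.map_smul_univ]
    rfl
  have h2 : ∀ σ : Equiv.Perm (Fin r), (A * B).det =
      ∑ f : Fin r → ι, ((Equiv.Perm.sign σ : ℤ) : ℝ) * (∏ i, A i (f (σ i))) *
        (B.submatrix f id).det := by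
    intro σ
    rw [h1, ← (Equiv.arrowCongr σ (Equiv.refl ι)).symm.sum_comp]
    refine Finset.sum_congr rfl fun f _ => ?_
    have e : ((Equiv.arrowCongr σ (Equiv.refl ι)).symm f) = f ∘ σ := rfl
    rw [e]
    have : (B.submatrix (f ∘ σ) id).det = ((Equiv.Perm.sign σ : ℤ) : ℝ) * (B.submatrix f id).det := by
      rw [← Matrix.det_permute σ]; rfl
    rw [this]
    simp only [Function.comp_apply]
    ring
  have h3 : ∑ σ : Equiv.Perm (Fin r), (A * B).det = (r.factorial : ℝ) * (A * B).det := by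
    rw [Finset.sum_const, Finset.card_univ, Fintype.card_perm, Fintype.card_fin, nsmul_eq_mul]
  rw [← h3, Finset.sum_congr rfl fun σ _ => h2 σ, Finset.sum_comm]
  refine Finset.sum_congr rfl fun f _ => ?_
  rw [← Finset.sum_mul]
  congr 1
  rw [← Matrix.det_transpose, Matrix.det_apply']
  rfl

/-- In the sum over all tuples, reordering a tuple changes both minors by the same sign and
repetitions contribute zero, so increasing tuples control every term. -/
theorem det_mul_pos {r : ℕ} {ι : Type*} [Fintype ι] [LinearOrder ι]
    (A : Matrix (Fin r) ι ℝ) (B : Matrix ι (Fin r) ℝ)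
    (h0 : ∀ f : Fin r → ι, StrictMono f → 0 ≤ (A.submatrix id f).det * (B.submatrix f id).det)
    (h1 : ∃ f : Fin r → ι, 0 < (A.submatrix id f).det * (B.submatrix f id).det) :
    0 < (A * B).det := by
  have hf : (0 : ℝ) < r.factorial := by exact_mod_cast r.factorial_pos
  refine pos_of_mul_pos_right ?_ hf.le
  rw [factorial_mul_det_mul]
  obtain ⟨f, hf⟩ := h1
  refine Finset.sum_pos' (fun f _ => ?_) ⟨f, Finset.mem_univ _, hf⟩
  by_cases hi : Function.Injective f
  · rw [det_submatrix_sq A B f (Tuple.sort f)]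
    exact h0 _ ((Tuple.monotone_sort f).strictMono_of_injective
      (hi.comp (Tuple.sort f).injective))
  · simp only [Function.Injective, not_forall] at hi
    obtain ⟨i, j, hij, hne⟩ := hi
    rw [Matrix.det_zero_of_row_eq (M := B.submatrix f id) hne (by ext l; simp [hij]), mul_zero]

end Positive

/-! ### Minors of the band matrix on consecutive rows. -/

section IntervalMinors

variable {m m₁ m₂ n : ℕ}

theorem strictMono_elim_of_lt {p q k : ℕ} (h : k = p + q) {f : Fin p → ℤ} {g : Fin q → ℤ}
    (hf : StrictMono f) (hg : StrictMono g) (hfg : ∀ r s, f r < g s) :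
    StrictMono fun r : Fin k => Sum.elim f g (((finCongr h).trans finSumFinEquiv.symm) r) := by
  subst h
  intro r s hrs
  simp only [finCongr_refl, Equiv.refl_trans]
  induction r using Fin.addCases with
  | left r =>
    induction s using Fin.addCases with
    | left s =>
      have h : (r : ℕ) < s := hrs
      simpa using hf (show r < s from h)
    | right s => simpa using hfg r s
  | right r =>
    induction s using Fin.addCases with
    | left s =>
      have : p + (r : ℕ) < s := hrs
      have := s.2
      omega
    | right s =>
      have h : p + (r : ℕ) < p + s := hrs
      simpa using hg (show r < s from by rw [Fin.lt_def]; omega)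

/-- Completing the columns to a full interval makes the matrix block triangular with positive second
block, so the sign is that of a minor of the twist. If two of its indices differ by `n`, two rows
are proportional and the minor is zero; otherwise the indices increase inside one period and the
minor is positive. -/
theorem TotallyPositive.det_bracket_nonneg {t : ℝ} {u : ℤ → Fin (m + 1) → ℝ}
    (hu : TotallyPositive n t u) {q : ℕ} (hq : q ≤ m + 1) (a : ℤ) {f : Fin q → ℤ}
    (hf : StrictMono f) (hfa : ∀ r, a + q ≤ f r + n ∧ f r < a + q) :
    0 ≤ (Matrix.of fun r s : Fin q => bracket u (f r) (u (a + (s : ℕ)))).det := by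
  have hlt := hu.lt
  obtain ⟨p, hp⟩ := Nat.exists_eq_add_of_le hq
  set g : Fin p → ℤ := fun r => a + q + (r : ℕ) with hg
  have hgm : StrictMono g := by
    intro r s hrs
    have : (r : ℕ) < s := hrs
    simp only [hg]
    omega
  have h1 := det_pairing ((finCongr hp).trans finSumFinEquiv.symm) u (Sum.elim f g)
    (Sum.elim (fun r : Fin q => a + (r : ℕ)) fun r : Fin p => a + q + (r : ℕ))
  set P : Matrix (Fin q) (Fin q) ℝ := Matrix.of fun r s => bracket u (f r) (u (a + (s : ℕ))) with hP
  have e1 : (Matrix.of fun r s => bracket u (Sum.elim f g r)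
      (u (Sum.elim (fun r : Fin q => a + (r : ℕ)) (fun r : Fin p => a + q + (r : ℕ)) s))) =
      Matrix.fromBlocks P
        (Matrix.of fun (r : Fin q) (s : Fin p) => bracket u (f r) (u (a + q + (s : ℕ)))) 0
        (Matrix.of fun r s : Fin p => bracket u (a + q + (r : ℕ)) (u (a + q + (s : ℕ)))) := by
    ext r s
    rcases r with r | r <;> rcases s with s | s <;> simp only [Matrix.of_apply, Sum.elim_inl,
      Sum.elim_inr, Matrix.fromBlocks_apply₁₁, Matrix.fromBlocks_apply₁₂,
      Matrix.fromBlocks_apply₂₁, Matrix.fromBlocks_apply₂₂, Matrix.zero_apply, hP, hg]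
    have := r.2
    have := s.2
    exact bracket_eq_zero u (by omega) (by omega)
  rw [e1, Matrix.det_fromBlocks_zero₂₁, det_bracket_interval u _ (by omega)] at h1
  have hw : 0 < (Matrix.of fun r => u (Sum.elim (fun r : Fin q => a + (r : ℕ))
      (fun r : Fin p => a + q + (r : ℕ)) (((finCongr hp).trans finSumFinEquiv.symm) r))).det :=
    hu.det_pos (strictMono_elim hp le_rfl) a fun r => elim_mem le_rfl (by omega) _
  have hprod : 0 < ∏ r : Fin p, (window u (a + q + (r : ℕ) - m)).det :=
    Finset.prod_pos fun r _ => hu.window_pos _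
  refine nonneg_of_mul_nonneg_left ?_ hprod
  rw [h1]
  refine mul_nonneg ?_ hw.le
  by_cases hc : ∃ r, f r + n < a + q + p
  · obtain ⟨r, hr⟩ := hc
    refine le_of_eq (Eq.symm ?_)
    have hra := hfa r
    set s : Fin p := ⟨(f r + n - (a + q)).toNat, by omega⟩ with hs
    have hgs : g s = f r + n := by simp only [hg, hs]; omega
    have hper := hu.twist.periodic (f r)
    set e := (finCongr hp).trans finSumFinEquiv.symm with he
    set M : Matrix (Fin (m + 1)) (Fin (m + 1)) ℝ :=
      Matrix.of fun r => GeometricR.twist u (Sum.elim f g (e r)) with hM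
    have hMr : M (e.symm (Sum.inl r)) = ((-1) ^ m * t ^ m) • M (e.symm (Sum.inr s)) := by
      have hMa : ∀ x, M x = GeometricR.twist u (Sum.elim f g (e x)) := fun x => rfl
      rw [hMa, hMa, Equiv.apply_symm_apply, Equiv.apply_symm_apply, Sum.elim_inl, Sum.elim_inr, hgs, hper]
    have hne : e.symm (Sum.inl r) ≠ e.symm (Sum.inr s) := by simp
    have : M = M.updateRow (e.symm (Sum.inl r)) (((-1) ^ m * t ^ m) • M (e.symm (Sum.inr s))) := by
      rw [← hMr, Matrix.updateRow_eq_self]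
    rw [this, Matrix.det_updateRow_smul]
    have h0 : (M.updateRow (e.symm (Sum.inl r)) (M (e.symm (Sum.inr s)))).det = 0 :=
      Matrix.det_zero_of_row_eq hne (by rw [Matrix.updateRow_self, Matrix.updateRow_ne hne.symm])
    rw [h0, mul_zero]
  · push Not at hc
    refine (hu.twist.det_pos (strictMono_elim_of_lt hp hf hgm fun r s => ?_) (a + q + p - n)
      fun r => ?_).le
    · have := hfa r
      simp only [hg]
      omega
    · generalize ((finCongr hp).trans finSumFinEquiv.symm) r = x
      rcases x with x | x
      · have := hfa x
        have := hc x
        simp only [Sum.elim_inl]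
        omega
      · have := x.2
        simp only [Sum.elim_inr, hg]
        omega

theorem bandOp_apply {K : Type*} [Field K] (A : ℤ → ℤ → K) (v : ℤ → Fin (m + 1) → K) (i : ℤ)
    (l : Fin (m + 1)) : bandOp n A v i l = bandOp n A (fun j => v j l) i := by
  simp [bandOp, Finset.sum_apply]

/-- The cyclically consecutive minors of the image of a positive point are positive. -/
theorem TotallyPositive.window_bandOp_pos {s t : ℝ} {u : ℤ → Fin (m₁ + 1) → ℝ}
    {v : ℤ → Fin (m₂ + 1) → ℝ} (hu : TotallyPositive n s u) (hv : TotallyPositive n t v)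
    (hm : m₂ ≤ m₁) (a : ℤ) : 0 < (window (bandOp n (bandEntry n s u) v) a).det := by
  have hlt := hu.lt
  -- The `n` columns of the local form at `a + m₂`. It covers the rows from `a` on because `m₂ ≤
  -- m₁`.
  set I := Finset.Ioc (a + m₂ - n) (a + m₂) with hI
  have hs := hu.pos
  set A : Matrix (Fin (m₂ + 1)) I ℝ := Matrix.of fun r j =>
    s / (window u ((j : ℤ) - m₁ - 1)).det * bracket u j (u (a + (r : ℕ))) with hA
  set B : Matrix I (Fin (m₂ + 1)) ℝ := Matrix.of fun j => v j with hB
  have hAB : window (bandOp n (bandEntry n s u) v) a = A * B := by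
    ext r l
    have := r.2
    rw [window_apply, bandOp_apply, hu.nondegenerate.bandOp_eq_localForm _ (a := a + m₂)
      (by omega) (by omega), localForm, LinearMap.sum_apply, Matrix.mul_apply,
      ← Finset.sum_coe_sort]
    refine Finset.sum_congr rfl fun j _ => ?_
    simp only [hA, hB, Matrix.of_apply, LinearMap.smul_apply, smul_eq_mul]
    ring
  have hdetA : ∀ f : Fin (m₂ + 1) → I, (A.submatrix id f).det =
      (∏ r, s / (window u ((f r : ℤ) - m₁ - 1)).det) *
        (Matrix.of fun r s : Fin (m₂ + 1) => bracket u (f r) (u (a + (s : ℕ)))).det := by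
    intro f
    rw [← Matrix.det_mul_column, ← Matrix.det_transpose]
    congr 1
  have hprod : ∀ f : Fin (m₂ + 1) → I, 0 < ∏ r, s / (window u ((f r : ℤ) - m₁ - 1)).det :=
    fun f => Finset.prod_pos fun r _ => div_pos hs (hu.window_pos _)
  have hdetB : ∀ f : Fin (m₂ + 1) → I, StrictMono f → 0 < (B.submatrix f id).det := by
    intro f hf
    have hf' : StrictMono fun r => (f r : ℤ) := fun r s h => hf h
    refine hv.det_pos hf' (a + m₂ - n + 1) fun r => ?_
    have := Finset.mem_Ioc.mp (f r).2
    omega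
  rw [hAB]
  refine det_mul_pos A B (fun f hf => ?_) ?_
  · refine mul_nonneg ?_ (hdetB f hf).le
    rw [hdetA]
    refine mul_nonneg (hprod f).le (hu.det_bracket_nonneg (by omega) a (fun r s h => hf h) ?_)
    intro r
    have := Finset.mem_Ioc.mp (f r).2
    push_cast
    omega
  -- The columns `a, …, a + m₂` give a triangular minor with positive diagonal, hence a strictly
  -- positive summand.
  · set f : Fin (m₂ + 1) → I := fun r =>
      ⟨a + (r : ℕ), Finset.mem_Ioc.mpr (by have := r.2; omega)⟩ with hf
    have hfm : StrictMono f := by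
      intro r s h
      have : (r : ℕ) < s := h
      rw [← Subtype.coe_lt_coe]
      simp only [hf]
      omega
    refine ⟨f, mul_pos ?_ (hdetB f hfm)⟩
    rw [hdetA]
    refine mul_pos (hprod f) ?_
    have := det_bracket_interval u a (q := m₂ + 1) (by omega)
    rw [show (Matrix.of fun r s : Fin (m₂ + 1) => bracket u (f r) (u (a + (s : ℕ)))) =
      Matrix.of fun r s : Fin (m₂ + 1) => bracket u (a + (r : ℕ)) (u (a + (s : ℕ))) from rfl, this]
    exact Finset.prod_pos fun r _ => hu.window_pos _

end IntervalMinors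

/-! ### Rescaled rows, and the finite matrix of a band operator. -/

section Rescale

variable {K : Type*} [Field K] {m n : ℕ} {E : Type*} [AddCommGroup E] [Module K E]

theorem det_window_rescale (c : ℤ → K) (u : ℤ → Fin (m + 1) → K) (a : ℤ) :
    (window (fun i => c i • u i) a).det =
      (∏ r : Fin (m + 1), c (a + (r : ℕ))) * (window u a).det := by
  rw [← Matrix.det_mul_column]
  congr 1

theorem bracket_rescale (c : ℤ → K) (u : ℤ → Fin (m + 1) → K) (j : ℤ) (x : Fin (m + 1) → K) :
    bracket (fun i => c i • u i) j x = (∏ r : Fin m, c (j - m + (r : ℕ))) * bracket u j x := by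
  rw [bracket_apply, bracket_apply]
  have h : (∏ r : Fin m, c (j - m + (r : ℕ))) =
      ∏ r : Fin (m + 1), if r = Fin.last m then 1 else c (j - m + (r : ℕ)) := by
    rw [Fin.prod_univ_castSucc, if_pos rfl, mul_one]
    refine Finset.prod_congr rfl fun r _ => ?_
    rw [if_neg (Fin.castSucc_lt_last r).ne]
    rfl
  rw [h, ← Matrix.det_mul_column]
  congr 1
  ext r l
  by_cases hr : r = Fin.last m
  · subst hr
    simp
  · rw [Matrix.updateRow_ne hr, Matrix.of_apply, if_neg hr, Matrix.updateRow_ne hr]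
    rfl

/-- The factors of rows `j - m, …, j - 1` occur in both determinants and cancel; those of row `i`
above and row `j - m - 1` below remain. -/
theorem bandEntry_rescale (t α : K) {c : ℤ → K} (hc : ∀ i, c i ≠ 0) (u : ℤ → Fin (m + 1) → K)
    (i j : ℤ) : bandEntry n (t * α) (fun i => c i • u i) i j =
      α * c i / c (j - m - 1) * bandEntry n t u i j := by
  unfold bandEntry
  split_ifs with h
  · rw [bracket_rescale, det_window_rescale, map_smul, smul_eq_mul, Fin.prod_univ_succ]
    have e : ∏ r : Fin m, c (j - m - 1 + ((r.succ : Fin (m + 1)) : ℕ)) =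
        ∏ r : Fin m, c (j - m + (r : ℕ)) := by
      refine Finset.prod_congr rfl fun r _ => ?_
      congr 1
      rw [Fin.val_succ]
      push_cast
      ring
    have hne : ∏ r : Fin m, c (j - m + (r : ℕ)) ≠ 0 := Finset.prod_ne_zero_iff.mpr fun r _ => hc _
    rw [e, Fin.val_zero, Nat.cast_zero, add_zero]
    have := hc (j - m - 1)
    by_cases hd : (window u (j - m - 1)).det = 0
    · simp [hd]
    · field_simp
  · rw [mul_zero]

theorem bandOp_eq_single (A : ℤ → ℤ → K) (x : ℤ → E) {i d : ℤ} (h0 : 0 ≤ d) (hd : d ≤ n)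
    (h : ∀ j, j ≠ i - d → A i j = 0) : bandOp n A x i = A i (i - d) • x (i - d) := by
  unfold bandOp
  refine Finset.sum_eq_single _ (fun j _ hj => by rw [h j hj, zero_smul]) fun hj => ?_
  exact absurd (Finset.mem_Icc.mpr (by omega)) hj

/-- The matrix of the operator `bandOp n A` on sequences with multiplier `lam`. -/
def foldMatrix (n : ℕ) (lam : K) (A : ℤ → ℤ → K) : Matrix (Fin n) (Fin n) K :=
  Matrix.of fun i j => A (i : ℕ) (j : ℕ) + lam * A (i : ℕ) ((j : ℕ) - n)

theorem bandOp_eq_foldMatrix {lam : K} {A : ℤ → ℤ → K}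
    (hs : ∀ i j : ℤ, ¬ (j ≤ i ∧ i < j + n) → A i j = 0) {x : ℤ → E} (hx : QuasiPeriodic n lam x)
    (i : Fin n) : bandOp n A x (i : ℕ) = ∑ j : Fin n, foldMatrix n lam A i j • x (j : ℕ) := by
  have hi := i.2
  have e1 : ∀ f : ℤ → E, ∑ j : Fin n, f (j : ℕ) = ∑ j ∈ Finset.Ico (0 : ℤ) n, f j := by
    intro f
    refine Finset.sum_bij (fun j _ => ((j : ℕ) : ℤ)) ?_ ?_ ?_ ?_
    · intro j _; have := j.2; rw [Finset.mem_Ico]; omega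
    · intro j _ l _ h; ext; exact_mod_cast h
    · intro j hj
      rw [Finset.mem_Ico] at hj
      exact ⟨⟨j.toNat, by omega⟩, Finset.mem_univ _, by simp only; omega⟩
    · intro j _; rfl
  have e2 : ∑ j : Fin n, foldMatrix n lam A i j • x (j : ℕ) =
      ∑ j : Fin n, A (i : ℕ) (j : ℕ) • x (j : ℕ) +
        ∑ j : Fin n, A (i : ℕ) ((j : ℕ) - n) • x ((j : ℕ) - n) := by
    rw [← Finset.sum_add_distrib]
    refine Finset.sum_congr rfl fun j _ => ?_
    have := hx ((j : ℕ) - n)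
    rw [sub_add_cancel] at this
    rw [← this, smul_smul, ← add_smul, foldMatrix, Matrix.of_apply, mul_comm lam]
  rw [e2, e1 fun j => A (i : ℕ) j • x j, e1 fun j => A (i : ℕ) (j - n) • x (j - n)]
  have e3 : ∑ j ∈ Finset.Ico (0 : ℤ) n, A (i : ℕ) (j - n) • x (j - n) =
      ∑ j ∈ Finset.Ico (-(n : ℤ)) 0, A (i : ℕ) j • x j := by
    refine Finset.sum_bij (fun j _ => j - n) ?_ ?_ ?_ ?_
    · intro j hj; rw [Finset.mem_Ico] at hj ⊢; omega
    · intro j _ l _ h; omega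
    · intro j hj
      rw [Finset.mem_Ico] at hj
      exact ⟨j + n, by rw [Finset.mem_Ico]; omega, by omega⟩
    · intro j _; rfl
  rw [e3, add_comm, ← Finset.sum_union (by
    rw [Finset.disjoint_left]; intro j; rw [Finset.mem_Ico, Finset.mem_Ico]; omega)]
  refine Finset.sum_subset (fun j hj => ?_) fun j _ hj => ?_
  · rw [Finset.mem_Icc] at hj
    rw [Finset.mem_union, Finset.mem_Ico, Finset.mem_Ico]
    omega
  · rw [Finset.mem_Icc] at hj
    rw [hs _ _ (by omega), zero_smul]

/-- The quasi-periodic extension of a tuple indexed by one period. -/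
def extend (n : ℕ) [NeZero n] (lam : K) (w : Fin n → E) (i : ℤ) : E :=
  (lam ^ (i / n))⁻¹ • w ⟨(i % n).toNat, by
    have hn : 0 < (n : ℤ) := by exact_mod_cast NeZero.pos n
    have h1 := Int.emod_nonneg i hn.ne'
    have h2 := Int.emod_lt_of_pos i hn
    omega⟩

theorem extend_quasiPeriodic [NeZero n] {lam : K} (hl : lam ≠ 0) (w : Fin n → E) :
    QuasiPeriodic n lam (extend n lam w) := by
  have hn : (n : ℤ) ≠ 0 := by exact_mod_cast NeZero.ne n
  intro i
  simp only [extend, Int.add_emod_right, Int.add_ediv_of_dvd_right (dvd_refl (n : ℤ)),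
    Int.ediv_self hn, zpow_add_one₀ hl, smul_smul]
  congr 1
  field_simp

theorem extend_apply [NeZero n] (lam : K) (w : Fin n → E) (i : Fin n) :
    extend n lam w (i : ℕ) = w i := by
  have h1 : ((i : ℕ) : ℤ) / n = 0 := Int.ediv_eq_zero_of_lt (by omega) (by have := i.2; omega)
  have h2 : ((i : ℕ) : ℤ) % n = (i : ℕ) := Int.emod_eq_of_lt (by omega) (by have := i.2; omega)
  simp only [extend, h1, h2, zpow_zero, inv_one, one_smul]
  congr 1

theorem eq_of_eq_on_period {lam : K} (hl : lam ≠ 0) (hn : 0 < n) {x y : ℤ → E}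
    (hx : QuasiPeriodic n lam x) (hy : QuasiPeriodic n lam y)
    (h : ∀ i : Fin n, x (i : ℕ) = y (i : ℕ)) : x = y := by
  refine hx.eq_of_window hl hn hy 0 fun i h1 h2 => ?_
  have := h ⟨i.toNat, by omega⟩
  simpa only [Int.toNat_of_nonneg h1] using this

theorem det_foldMatrix_ne_zero {lam : K} (hn : 0 < n) (hl : lam ≠ 0) {A : ℤ → ℤ → K}
    (hs : ∀ i j : ℤ, ¬ (j ≤ i ∧ i < j + n) → A i j = 0)
    (hA : ∀ i j, A (i + n) (j + n) = A i j)
    (hi : ∀ x : ℤ → K, QuasiPeriodic n lam x → (∀ i, bandOp n A x i = 0) → ∀ i, x i = 0) :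
    (foldMatrix n lam A).det ≠ 0 := by
  have : NeZero n := ⟨hn.ne'⟩
  intro h
  obtain ⟨w, hw, h0⟩ := Matrix.exists_mulVec_eq_zero_iff.mpr h
  apply hw
  have hp := extend_quasiPeriodic hl w
  have hz := hi (extend n lam w) hp fun i => by
    refine (bandOp_quasiPeriodic hA hp).eq_zero_of_window hl hn 0 (fun i h1 h2 => ?_) i
    have := bandOp_eq_foldMatrix hs hp ⟨i.toNat, by omega⟩
    simp only [Int.toNat_of_nonneg h1] at this
    rw [this]
    simp only [extend_apply]
    exact congrFun h0 _
  funext i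
  rw [← extend_apply lam w i, hz]
  rfl

end Rescale

/-! ### Propagation of positivity along paths. -/

section Paths

variable {m m₁ m₂ n : ℕ}

theorem continuousOn_det {p : ℕ} {S : Set ℝ} {M : ℝ → Matrix (Fin p) (Fin p) ℝ}
    (h : ∀ r l, ContinuousOn (fun τ => M τ r l) S) : ContinuousOn (fun τ => (M τ).det) S := by
  have : ContinuousOn M S := continuousOn_pi.mpr fun r => continuousOn_pi.mpr fun l => h r l
  exact (continuous_id.matrix_det).comp_continuousOn this

theorem continuousOn_setDet {S : Set ℝ} {y : ℝ → ℤ → Fin (m + 1) → ℝ}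
    (hy : ∀ i l, ContinuousOn (fun τ => y τ i l) S) (T : Finset ℤ) :
    ContinuousOn (fun τ => setDet (y τ) T) S := by
  unfold setDet
  split_ifs
  · exact continuousOn_det fun r l => hy _ l
  · exact continuousOn_const

/-- Positivity propagates along paths on which the cyclically consecutive minors do not vanish. -/
theorem totallyPositive_path {t : ℝ} {y : ℝ → ℤ → Fin (m + 1) → ℝ}
    (hy : ∀ i l, ContinuousOn (fun τ => y τ i l) (Set.Icc 0 1))
    (hp : ∀ τ ∈ Set.Icc (0 : ℝ) 1, QuasiPeriodic n ((-1) ^ m * t) (y τ))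
    (hw : ∀ τ ∈ Set.Icc (0 : ℝ) 1, ∀ a, (window (y τ) a).det ≠ 0)
    (h0 : TotallyPositive n t (y 0)) : TotallyPositive n t (y 1) := by
  have hlt := h0.lt
  have ht := h0.pos
  have hpos : ∀ τ ∈ Set.Icc (0 : ℝ) 1, ∀ a, 0 < (window (y τ) a).det := by
    intro τ hτ a
    by_contra hneg
    have hc : ContinuousOn (fun τ => (window (y τ) a).det) (Set.Icc 0 τ) :=
      (continuousOn_det fun r l => hy _ l).mono (Set.Icc_subset_Icc_right hτ.2)
    obtain ⟨σ, hσ, h⟩ := intermediate_value_Icc' hτ.1 hc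
      ⟨not_lt.mp hneg, (h0.window_pos a).le⟩
    exact hw σ ⟨hσ.1, hσ.2.trans hτ.2⟩ a h
  set 𝒯 := (Finset.Ico (0 : ℤ) n).powerset with h𝒯
  set S : Set ℝ := {τ | ∀ T ∈ 𝒯, 0 ≤ setDet (y τ) T} with hS
  have hTP : ∀ τ ∈ S, τ ∈ Set.Icc (0 : ℝ) 1 → TotallyPositive n t (y τ) := by
    intro τ h1 h2
    refine totallyPositive_of_nonneg hlt ht (hp τ h2) (fun T hT => h1 T ?_) (hpos τ h2)
    rw [h𝒯, Finset.mem_powerset]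
    intro i hi
    rw [Finset.mem_Ico]
    have := hT i hi
    omega
  have hnn : ∀ τ, TotallyPositive n t (y τ) → τ ∈ S := by
    intro τ h T hT
    by_cases hc : T.card = m + 1
    · refine (h.setDet_pos 0 T hc fun i hi => ?_).le
      rw [h𝒯, Finset.mem_powerset] at hT
      have := Finset.mem_Ico.mp (hT hi)
      omega
    · rw [setDet, dif_neg hc]
  -- Nonnegativity is a closed condition; where it holds the point is positive by `hTP`, and
  -- positivity of finitely many minors is open. So it extends over the whole interval.
  have hsub : Set.Icc (0 : ℝ) 1 ⊆ S := by
    refine IsClosed.Icc_subset_of_forall_mem_nhdsWithin ?_ (hnn 0 h0) ?_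
    · have : S ∩ Set.Icc (0 : ℝ) 1 = Set.Icc 0 1 ∩ ⋂ T ∈ 𝒯, (Set.Icc (0 : ℝ) 1 ∩
          (fun τ => setDet (y τ) T) ⁻¹' Set.Ici 0) := by
        ext τ
        simp only [hS, Set.mem_inter_iff, Set.mem_ofPred_eq, Set.mem_iInter, Set.mem_preimage,
          Set.mem_Ici]
        constructor
        · rintro ⟨h1, h2⟩; exact ⟨h2, fun T hT => ⟨h2, h1 T hT⟩⟩
        · rintro ⟨h1, h2⟩; exact ⟨fun T hT => (h2 T hT).2, h1⟩
      rw [this]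
      refine isClosed_Icc.inter (isClosed_biInter fun T _ => ?_)
      exact (continuousOn_setDet hy T).preimage_isClosed_of_isClosed isClosed_Icc isClosed_Ici
    · rintro τ ⟨h1, h2⟩
      have hτ : τ ∈ Set.Icc (0 : ℝ) 1 := ⟨h2.1, h2.2.le⟩
      have hP := hTP τ h1 hτ
      have key : ∀ T ∈ 𝒯, ∀ᶠ σ in nhdsWithin τ (Set.Ioi τ), 0 ≤ setDet (y σ) T := by
        intro T hT
        by_cases hc : T.card = m + 1
        · have hpT : 0 < setDet (y τ) T := by
            refine hP.setDet_pos 0 T hc fun i hi => ?_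
            rw [h𝒯, Finset.mem_powerset] at hT
            have := Finset.mem_Ico.mp (hT hi)
            omega
          have hcw : ContinuousWithinAt (fun σ => setDet (y σ) T) (Set.Icc 0 1) τ :=
            continuousOn_setDet hy T τ hτ
          have h3 : ∀ᶠ σ in nhdsWithin τ (Set.Icc 0 1), 0 < setDet (y σ) T :=
            hcw.eventually (lt_mem_nhds hpT)
          have h4 : nhdsWithin τ (Set.Ioi τ) ≤ nhdsWithin τ (Set.Icc 0 1) := by
            rw [← nhdsWithin_Ioo_eq_nhdsGT h2.2]
            exact nhdsWithin_mono _ fun σ hσ => ⟨h2.1.trans hσ.1.le, hσ.2.le⟩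
          exact (h3.filter_mono h4).mono fun σ hσ => hσ.le
        · exact Filter.Eventually.of_forall fun σ => by rw [setDet, dif_neg hc]
      exact (Filter.eventually_all_finset 𝒯).mpr key
  exact hTP 1 (hsub ⟨zero_le_one, le_rfl⟩) ⟨zero_le_one, le_rfl⟩

/-- Rescaling by a geometric progression. -/
theorem TotallyPositive.zpow_rescale {t : ℝ} {u : ℤ → Fin (m + 1) → ℝ}
    (hu : TotallyPositive n t u) {σ : ℝ} (hσ : 0 < σ) :
    TotallyPositive n (t * (σ ^ n)⁻¹) fun i => σ ^ i • u i := by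
  refine hu.rescale (fun i => zpow_pos hσ i) (inv_pos.mpr (pow_pos hσ n)) fun i => ?_
  rw [zpow_add₀ hσ.ne', zpow_natCast]
  field_simp

theorem TotallyPositive.shift {t : ℝ} {u : ℤ → Fin (m + 1) → ℝ} (hu : TotallyPositive n t u)
    (d : ℤ) : TotallyPositive n t fun i => u (i + d) := by
  refine ⟨hu.lt, hu.pos, fun i => ?_, fun z T hT hz => ?_⟩
  · have := hu.periodic (i + d)
    rw [add_right_comm] at this
    exact this
  · rw [setDet, dif_pos hT]
    refine hu.det_pos (a := fun r => T.orderEmbOfFin hT r + d) (fun r s h => ?_) (z + d) fun r => ?_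
    · have := (T.orderEmbOfFin hT).strictMono h
      simp only
      omega
    · have := hz _ (T.orderEmbOfFin_mem hT r)
      omega

theorem pow_toNat {σ : ℝ} {a : ℤ} (ha : 0 ≤ a) : σ ^ a.toNat = σ ^ a := by
  rw [← zpow_natCast, Int.toNat_of_nonneg ha]

theorem TotallyPositive.bandEntry_self_pos {t : ℝ} {u : ℤ → Fin (m + 1) → ℝ}
    (hu : TotallyPositive n t u) (i : ℤ) : 0 < bandEntry n t u i i := by
  rw [hu.nondegenerate.bandEntry_self]
  exact div_pos (mul_pos hu.pos (hu.window_pos _)) (hu.window_pos _)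

/-- The image of `v` under a one-parameter deformation of the band operator of `u`. -/
noncomputable def deformed (n : ℕ) (s : ℝ) (u : ℤ → Fin (m₁ + 1) → ℝ) (v : ℤ → Fin (m₂ + 1) → ℝ)
    (τ : ℝ) : ℤ → Fin (m₂ + 1) → ℝ :=
  bandOp n (fun i j => τ ^ (i - j).toNat * bandEntry n s u i j) v

/-- The opposite one-parameter deformation. -/
noncomputable def codeformed (n : ℕ) (s : ℝ) (u : ℤ → Fin (m₁ + 1) → ℝ)
    (v : ℤ → Fin (m₂ + 1) → ℝ) (τ : ℝ) : ℤ → Fin (m₂ + 1) → ℝ :=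
  bandOp n (fun i j => τ ^ ((n : ℤ) - m₁ - 1 - (i - j)).toNat * bandEntry n s u i j) v

theorem continuous_bandOp_pow (e : ℤ → ℤ → ℕ) (A : ℤ → ℤ → ℝ) (v : ℤ → Fin (m + 1) → ℝ) (i : ℤ)
    (l : Fin (m + 1)) : Continuous fun τ : ℝ => bandOp n (fun i j => τ ^ e i j * A i j) v i l := by
  simp only [bandOp_apply]
  unfold bandOp
  simp only [smul_eq_mul]
  fun_prop

section

variable {s t : ℝ} {u : ℤ → Fin (m₁ + 1) → ℝ} {v : ℤ → Fin (m₂ + 1) → ℝ}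

theorem deformed_quasiPeriodic (hu : TotallyPositive n s u) (hv : TotallyPositive n t v) (τ : ℝ) :
    QuasiPeriodic n ((-1) ^ m₂ * t) (deformed n s u v τ) := by
  refine bandOp_quasiPeriodic (fun i j => ?_) hv.periodic
  rw [hu.nondegenerate.bandEntry_add, add_sub_add_right_eq_sub]

/-- Only the diagonal of the operator survives, which rescales `v` by positive `n`-periodic factors.
-/
theorem deformed_zero (hu : TotallyPositive n s u) (hv : TotallyPositive n t v) :
    TotallyPositive n t (deformed n s u v 0) := by
  have e : deformed n s u v 0 = fun i => bandEntry n s u i i • v i := by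
    funext i
    unfold deformed
    rw [bandOp_eq_single (d := 0) _ _ le_rfl (by omega)]
    · simp
    · intro j hj
      by_cases h : j ≤ i
      · rw [zero_pow (by omega), zero_mul]
      · rw [bandEntry_of_not (by omega), mul_zero]
  rw [e]
  have := hv.rescale (c := fun i => bandEntry n s u i i) (α := 1) hu.bandEntry_self_pos one_pos
    fun i => by rw [one_mul, hu.nondegenerate.bandEntry_add]
  rwa [mul_one] at this

/-- Rescaling `u` by `τ ^ i` weights the entries by a power of `τ` depending on `i - j`, so the
deformed operator is again that of a positive point, up to a scalar. -/
theorem deformed_eq (hu : TotallyPositive n s u) {τ : ℝ} (hτ : 0 < τ) :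
    deformed n s u v τ = fun i => τ ^ (n - m₁ - 1) •
      bandOp n (bandEntry n (s * (τ ^ n)⁻¹) fun i => τ ^ i • u i) v i := by
  have hlt := hu.lt
  rw [← bandOp_smul]
  funext i
  unfold deformed bandOp
  refine Finset.sum_congr rfl fun j _ => ?_
  rw [bandEntry_rescale _ _ (fun i => (zpow_pos hτ i).ne'), smul_smul]
  congr 1
  beta_reduce
  by_cases h : j ≤ i ∧ i + (m₁ + 1) ≤ j + n
  · rw [mul_right_comm]
    congr 1
    rw [pow_toNat (by omega), ← zpow_natCast, ← zpow_natCast, ← zpow_neg, ← zpow_add₀ hτ.ne',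
      ← zpow_sub₀ hτ.ne', ← zpow_add₀ hτ.ne']
    congr 1
    omega
  · rw [bandEntry_of_not h, mul_zero, mul_zero, zero_mul]

/-- Along the deformation from the diagonal operator, each stage with `τ > 0` comes from a positive
point, so its consecutive minors are positive by `window_bandOp_pos`; all other minors follow by
continuity. -/
theorem TotallyPositive.bandOp (hu : TotallyPositive n s u) (hv : TotallyPositive n t v)
    (hm : m₂ ≤ m₁) : TotallyPositive n t (bandOp n (bandEntry n s u) v) := by
  have h1 : deformed n s u v 1 = GeometricR.bandOp n (bandEntry n s u) v := by
    simp [deformed]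
  rw [← h1]
  refine totallyPositive_path (fun i l => (continuous_bandOp_pow _ _ _ _ _).continuousOn)
    (fun τ _ => deformed_quasiPeriodic hu hv τ) (fun τ hτ a => ?_) (deformed_zero hu hv)
  rcases hτ.1.eq_or_lt with rfl | h
  · exact ((deformed_zero hu hv).window_pos a).ne'
  · rw [deformed_eq hu h, det_window_rescale (fun _ => τ ^ (n - m₁ - 1))]
    exact mul_ne_zero (Finset.prod_ne_zero_iff.mpr fun _ _ => pow_ne_zero _ h.ne')
      ((hu.zpow_rescale h).window_bandOp_pos hv hm a).ne'

end

end Paths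

/-! ### The second new factor when the second parameter is the smaller one. -/

section Deformation

variable {m m₁ m₂ n : ℕ}

theorem continuousOn_bandEntry {S : Set ℝ} {y : ℝ → ℤ → Fin (m + 1) → ℝ} (t : ℝ)
    (hy : ∀ i l, ContinuousOn (fun τ => y τ i l) S)
    (hw : ∀ τ ∈ S, ∀ a, (window (y τ) a).det ≠ 0) (i j : ℤ) :
    ContinuousOn (fun τ => bandEntry n t (y τ) i j) S := by
  unfold bandEntry
  split_ifs
  · refine ContinuousOn.div (continuousOn_const.mul ?_) (continuousOn_det fun r l => hy _ l)
      fun τ hτ => hw τ hτ _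
    simp only [bracket_apply]
    refine continuousOn_det fun r l => ?_
    by_cases hr : r = Fin.last m
    · subst hr
      simpa using hy i l
    · simp only [Matrix.updateRow_ne hr]
      exact hy _ l
  · exact continuousOn_const

theorem twist_mul_ne {s t : ℝ} (hs : 0 < s) (ht : 0 < t) (h : s ≠ t) :
    (-1) ^ m₁ * s ≠ (-1) ^ m₂ * t := by
  rcases neg_one_pow_eq_or ℝ m₁ with h1 | h1 <;> rcases neg_one_pow_eq_or ℝ m₂ with h2 | h2 <;>
    rw [h1, h2] <;> intro h3 <;> exact h (by linarith)

/-- Solving `bandOp n (c τ) w = u` along a path. -/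
theorem exists_preimage_path {s : ℝ} {u : ℤ → Fin (m + 1) → ℝ} (hu : TotallyPositive n s u)
    {c : ℝ → ℤ → ℤ → ℝ} (hs : ∀ τ, ∀ i j : ℤ, ¬ (j ≤ i ∧ i < j + n) → c τ i j = 0)
    (hA : ∀ τ ∈ Set.Icc (0 : ℝ) 1, ∀ i j, c τ (i + n) (j + n) = c τ i j)
    (hc : ∀ i j, ContinuousOn (fun τ => c τ i j) (Set.Icc 0 1))
    (hinj : ∀ τ ∈ Set.Icc (0 : ℝ) 1, ∀ x : ℤ → ℝ, QuasiPeriodic n ((-1) ^ m * s) x →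
      (∀ i, bandOp n (c τ) x i = 0) → ∀ i, x i = 0)
    (hw : ∀ τ ∈ Set.Ioc (0 : ℝ) 1, ∀ w : ℤ → Fin (m + 1) → ℝ,
      QuasiPeriodic n ((-1) ^ m * s) w → bandOp n (c τ) w = u → ∀ a, (window w a).det ≠ 0)
    (h0 : ∀ w : ℤ → Fin (m + 1) → ℝ, QuasiPeriodic n ((-1) ^ m * s) w →
      bandOp n (c 0) w = u → TotallyPositive n s w) :
    ∃ w, TotallyPositive n s w ∧ bandOp n (c 1) w = u := by
  have hn := hu.nondegenerate.pos
  have hl := hu.nondegenerate.twist_ne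
  have : NeZero n := ⟨hn.ne'⟩
  set G : ℝ → Matrix (Fin n) (Fin n) ℝ := fun τ => foldMatrix n ((-1) ^ m * s) (c τ) with hG
  have hdet : ∀ τ ∈ Set.Icc (0 : ℝ) 1, (G τ).det ≠ 0 := fun τ hτ =>
    det_foldMatrix_ne_zero hn hl (hs τ) (hA τ hτ) (hinj τ hτ)
  -- The unique solution, found by inverting the matrix on one period. It depends continuously on
  -- `τ` because the inverse is the adjugate divided by a nonvanishing determinant.
  set w : ℝ → ℤ → Fin (m + 1) → ℝ := fun τ => extend n ((-1) ^ m * s)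
    (fun i : Fin n => ∑ j : Fin n, (G τ)⁻¹ i j • u (j : ℕ)) with hwd
  have hwp : ∀ τ, QuasiPeriodic n ((-1) ^ m * s) (w τ) := fun τ => extend_quasiPeriodic hl _
  have hsol : ∀ τ ∈ Set.Icc (0 : ℝ) 1, bandOp n (c τ) (w τ) = u := by
    intro τ hτ
    refine eq_of_eq_on_period hl hn (bandOp_quasiPeriodic (hA τ hτ) (hwp τ)) hu.periodic fun i => ?_
    rw [bandOp_eq_foldMatrix (hs τ) (hwp τ)]
    simp only [hwd, extend_apply, Finset.smul_sum, smul_smul]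
    rw [Finset.sum_comm]
    have hmul : G τ * (G τ)⁻¹ = 1 := Matrix.mul_nonsing_inv _ (Ne.isUnit (hdet τ hτ))
    have : ∀ l : Fin n, ∑ j : Fin n, (foldMatrix n ((-1) ^ m * s) (c τ) i j * (G τ)⁻¹ j l) •
        u (l : ℕ) = (1 : Matrix (Fin n) (Fin n) ℝ) i l • u (l : ℕ) := by
      intro l
      rw [← Finset.sum_smul, ← hmul, Matrix.mul_apply]
    rw [Finset.sum_congr rfl fun l _ => this l, Finset.sum_eq_single i]
    · rw [Matrix.one_apply_eq, one_smul]
    · intro l _ hl; rw [Matrix.one_apply_ne hl.symm, zero_smul]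
    · intro h; exact absurd (Finset.mem_univ _) h
  have hGc : ContinuousOn G (Set.Icc 0 1) := by
    refine continuousOn_pi.mpr fun i => continuousOn_pi.mpr fun j => ?_
    exact (hc _ _).add (continuousOn_const.mul (hc _ _))
  have hinv : ∀ i j, ContinuousOn (fun τ => (G τ)⁻¹ i j) (Set.Icc 0 1) := by
    intro i j
    have h1 : ContinuousOn (fun τ => (G τ).det) (Set.Icc 0 1) :=
      continuous_id.matrix_det.comp_continuousOn hGc
    have h2 : ContinuousOn (fun τ => (G τ).adjugate i j) (Set.Icc 0 1) :=
      (continuous_id.matrix_adjugate.matrix_elem i j).comp_continuousOn hGc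
    have h3 : ∀ τ, (G τ)⁻¹ i j = (G τ).det⁻¹ * (G τ).adjugate i j := by
      intro τ
      rw [Matrix.inv_def, Ring.inverse_eq_inv', Matrix.smul_apply, smul_eq_mul]
    simp only [h3]
    exact (h1.inv₀ hdet).mul h2
  have h00 : TotallyPositive n s (w 0) := h0 _ (hwp 0) (hsol 0 ⟨le_rfl, zero_le_one⟩)
  refine ⟨w 1, totallyPositive_path (fun i l => ?_) (fun τ _ => hwp τ) (fun τ hτ a => ?_) h00,
    hsol 1 ⟨zero_le_one, le_rfl⟩⟩
  · simp only [hwd, extend, Pi.smul_apply, Finset.sum_apply, smul_eq_mul]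
    refine continuousOn_const.mul (continuousOn_finsetSum _ fun j _ => ?_)
    exact (hinv _ _).mul continuousOn_const
  · rcases hτ.1.eq_or_lt with rfl | h
    · exact (h00.window_pos a).ne'
    · exact hw τ ⟨h, hτ.2⟩ _ (hwp τ) (hsol τ hτ) a

variable {s t : ℝ} {u : ℤ → Fin (m₁ + 1) → ℝ} {v : ℤ → Fin (m₂ + 1) → ℝ}

theorem TotallyPositive.const_smul {u : ℤ → Fin (m + 1) → ℝ} (hu : TotallyPositive n t u) {κ : ℝ}
    (hκ : 0 < κ) : TotallyPositive n t fun i => κ • u i := by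
  have := hu.rescale (c := fun _ => κ) (α := 1) (fun _ => hκ) one_pos fun _ => one_mul κ
  rwa [mul_one] at this

theorem bandOp_const_mul {E : Type*} [AddCommGroup E] [Module ℝ E] (κ : ℝ) (A : ℤ → ℤ → ℝ)
    (x : ℤ → E) : bandOp n (fun i j => κ * A i j) x = bandOp n A fun i => κ • x i := by
  funext i
  unfold GeometricR.bandOp
  exact Finset.sum_congr rfl fun j _ => by rw [smul_smul, mul_comm]

theorem bandOp_injective_of_ne {y : ℤ → Fin (m₂ + 1) → ℝ} (hs : 0 < s)
    (hy : TotallyPositive n t y) (hst : s ≠ t) {κ : ℝ} (hκ : κ ≠ 0) {x : ℤ → ℝ}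
    (hx : QuasiPeriodic n ((-1) ^ m₁ * s) x)
    (h : ∀ i, bandOp n (fun i j => κ * bandEntry n t y i j) x i = 0) (i : ℤ) : x i = 0 := by
  refine eq_zero_of_bandOp_eq_zero hy.nondegenerate (twist_ne hs.ne')
    (twist_mul_ne hs hy.pos hst) hx (fun i => ?_) i
  have := h i
  rw [bandOp_const_mul, bandOp_smul] at this
  exact (smul_eq_zero.mp this).resolve_left hκ

theorem window_ne_zero_of_exchange (hu : TotallyPositive n s u) (hv : TotallyPositive n t v)
    (hv' : TotallyPositive n t (bandOp n (bandEntry n s u) v)) (hst : s ≠ t) {κ : ℝ}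
    {w : ℤ → Fin (m₁ + 1) → ℝ} (hw : QuasiPeriodic n ((-1) ^ m₁ * s) w)
    (h : bandOp n (fun i j => κ * bandEntry n t (bandOp n (bandEntry n s u) v) i j) w = u) (a : ℤ) :
    (window w a).det ≠ 0 := by
  rw [bandOp_const_mul] at h
  have := det_window_ne_zero_of_exchange hu.nondegenerate hv.nondegenerate hv'.nondegenerate rfl
    (u' := fun i => κ • w i) (fun i => by simp only; rw [smul_comm, hw i]) h.symm
    (twist_mul_ne hu.pos hv.pos hst) a
  rw [det_window_rescale (fun _ => κ)] at this
  exact right_ne_zero_of_mul this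

theorem TotallyPositive.deformed (hu : TotallyPositive n s u) (hv : TotallyPositive n t v)
    (hm : m₂ ≤ m₁) {τ : ℝ} (hτ : 0 ≤ τ) : TotallyPositive n t (deformed n s u v τ) := by
  rcases hτ.eq_or_lt with rfl | h
  · exact deformed_zero hu hv
  · rw [deformed_eq hu h]
    exact ((hu.zpow_rescale h).bandOp hv hm).const_smul (pow_pos h _)

theorem bandOp_zpow_eq_deformed {τ : ℝ} (hτ : 0 < τ) :
    bandOp n (bandEntry n s u) (fun i => τ⁻¹ ^ i • v i) =
      fun i => τ⁻¹ ^ i • GeometricR.deformed n s u v τ i := by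
  funext i
  unfold GeometricR.deformed bandOp
  rw [Finset.smul_sum]
  refine Finset.sum_congr rfl fun j _ => ?_
  rw [smul_smul, smul_smul]
  congr 1
  by_cases h : j ≤ i ∧ i + (m₁ + 1) ≤ j + n
  · rw [mul_comm, ← mul_assoc]
    congr 1
    rw [pow_toNat (by omega), inv_zpow', inv_zpow', ← zpow_add₀ hτ.ne']
    congr 1
    omega
  · rw [bandEntry_of_not h, zero_mul]
    beta_reduce
    rw [bandEntry_of_not h, mul_zero, mul_zero]

/-- Replacing `v` by its rescaling with `τ⁻¹ ^ i` turns `t` into `t * τ ^ n` and weights each entry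
of the image's band matrix by its distance from the bottom diagonal. As `τ` tends to 0 a pure shift
remains. -/
theorem bandEntry_deformed {τ : ℝ} (hτ : 0 < τ) (i j : ℤ) :
    bandEntry n (t * (τ⁻¹ ^ n)⁻¹) (bandOp n (bandEntry n s u) fun i => τ⁻¹ ^ i • v i) i j =
      τ ^ ((n : ℤ) - m₂ - 1 - (i - j)).toNat *
        bandEntry n t (GeometricR.deformed n s u v τ) i j := by
  rw [bandOp_zpow_eq_deformed hτ, bandEntry_rescale _ _ fun i => (zpow_pos (inv_pos.mpr hτ) i).ne']
  by_cases h : j ≤ i ∧ i + (m₂ + 1) ≤ j + n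
  · congr 1
    rw [pow_toNat (by omega), inv_pow, inv_inv, inv_zpow', inv_zpow', ← zpow_natCast,
      ← zpow_add₀ hτ.ne', ← zpow_sub₀ hτ.ne']
    congr 1
    omega
  · rw [bandEntry_of_not h, mul_zero, mul_zero]

/-- The rescaled second factor has parameter `t * τ ^ n ≤ t < s`, so the exchange never degenerates
for `0 < τ ≤ 1`. At `τ = 0` the equation is a shift and its solution a shifted copy of `u`. -/
theorem exists_preimage_of_lt (hu : TotallyPositive n s u) (hv : TotallyPositive n t v)
    (hm : m₂ ≤ m₁) (hts : t < s) :
    ∃ w, TotallyPositive n s w ∧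
      bandOp n (bandEntry n t (bandOp n (bandEntry n s u) v)) w = u := by
  have hlt := hv.lt
  set y := GeometricR.deformed n s u v with hy
  have hyc : ∀ i l, ContinuousOn (fun τ => y τ i l) (Set.Icc 0 1) := fun i l =>
    (continuous_bandOp_pow _ _ _ _ _).continuousOn
  have hyP : ∀ τ ∈ Set.Icc (0 : ℝ) 1, TotallyPositive n t (y τ) := fun τ hτ =>
    hu.deformed hv hm hτ.1
  have hlt_s : ∀ τ ∈ Set.Ioc (0 : ℝ) 1, s ≠ t * (τ⁻¹ ^ n)⁻¹ := by
    intro τ hτ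
    rw [inv_pow, inv_inv]
    have h1 : τ ^ n ≤ 1 := pow_le_one₀ hτ.1.le hτ.2
    have := mul_le_of_le_one_right hv.pos.le h1
    exact (this.trans_lt hts).ne'
  have hbe : ∀ τ, 0 < τ → (fun i j => τ ^ ((n : ℤ) - m₂ - 1 - (i - j)).toNat *
      bandEntry n t (y τ) i j) = fun i j => 1 * bandEntry n (t * (τ⁻¹ ^ n)⁻¹)
        (bandOp n (bandEntry n s u) fun i => τ⁻¹ ^ i • v i) i j := by
    intro τ hτ
    funext i j
    rw [bandEntry_deformed hτ, one_mul]
  have hzero : ∀ {E : Type} [AddCommGroup E] [Module ℝ E] (x : ℤ → E) (i : ℤ),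
      bandOp n (fun i j => (0 : ℝ) ^ ((n : ℤ) - m₂ - 1 - (i - j)).toNat *
        bandEntry n t (y 0) i j) x i = x (i - (n - m₂ - 1)) := by
    intro E _ _ x i
    rw [bandOp_eq_single (d := n - m₂ - 1) _ _ (by omega) (by omega)]
    · have h1 := (hyP 0 ⟨le_rfl, zero_le_one⟩).nondegenerate.bandEntry_bottom
        (i - (n - m₂ - 1))
      rw [show i - (n - m₂ - 1) + n - m₂ - 1 = i by ring] at h1
      rw [h1, show ((n : ℤ) - m₂ - 1 - (i - (i - (n - m₂ - 1)))).toNat = 0 by omega]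
      simp
    · intro j hj
      by_cases h : j ≤ i ∧ i + (m₂ + 1) ≤ j + n
      · rw [zero_pow (by omega), zero_mul]
      · rw [bandEntry_of_not h, mul_zero]
  have hN : ∀ τ ∈ Set.Ioc (0 : ℝ) 1, TotallyPositive n (t * (τ⁻¹ ^ n)⁻¹)
      (bandOp n (bandEntry n s u) fun i => τ⁻¹ ^ i • v i) := by
    intro τ hτ
    rw [bandOp_zpow_eq_deformed hτ.1]
    exact (hyP τ ⟨hτ.1.le, hτ.2⟩).zpow_rescale (inv_pos.mpr hτ.1)
  refine (exists_preimage_path hu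
    (c := fun τ i j => τ ^ ((n : ℤ) - m₂ - 1 - (i - j)).toNat * bandEntry n t (y τ) i j)
    (fun τ i j h => by rw [bandEntry_of_not (by omega), mul_zero])
    (fun τ hτ i j => by
      rw [(hyP τ hτ).nondegenerate.bandEntry_add, add_sub_add_right_eq_sub])
    (fun i j => (continuous_pow _).continuousOn.mul
      (continuousOn_bandEntry t hyc (fun τ hτ a => ((hyP τ hτ).window_pos a).ne') i j)) ?_ ?_ ?_).imp fun w hw => ⟨hw.1, ?_⟩
  · intro τ hτ x hx h
    rcases hτ.1.eq_or_lt with rfl | hτ0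
    · intro i
      have := h (i + (n - m₂ - 1))
      rwa [hzero, add_sub_cancel_right] at this
    · exact bandOp_injective_of_ne hu.pos (hN τ ⟨hτ0, hτ.2⟩) (hlt_s τ ⟨hτ0, hτ.2⟩) one_ne_zero hx
        fun i => by rw [← hbe τ hτ0]; exact h i
  · intro τ hτ w hw h a
    beta_reduce at h
    rw [hbe τ hτ.1] at h
    exact window_ne_zero_of_exchange hu (hv.zpow_rescale (inv_pos.mpr hτ.1)) (hN τ hτ)
      (hlt_s τ hτ) hw h a
  · intro w hw h
    have : w = fun i => u (i + (n - m₂ - 1)) := by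
      funext i
      rw [← h, hzero, add_sub_cancel_right]
    rw [this]
    exact hu.shift _
  · simpa [hy, GeometricR.deformed] using hw.2

end Deformation

/-! ### The opposite deformation and the exchange for `m₂ ≤ m₁`. -/

section Codeformation

variable {m m₁ m₂ n : ℕ} {s t : ℝ} {u : ℤ → Fin (m₁ + 1) → ℝ} {v : ℤ → Fin (m₂ + 1) → ℝ}

theorem codeformed_zero (hu : TotallyPositive n s u) :
    codeformed n s u v 0 = fun i => v (i - (n - m₁ - 1)) := by
  have hlt := hu.lt
  funext i
  unfold codeformed
  rw [bandOp_eq_single (d := n - m₁ - 1) _ _ (by omega) (by omega)]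
  · have h1 := hu.nondegenerate.bandEntry_bottom (i - (n - m₁ - 1))
    rw [show i - (n - m₁ - 1) + n - m₁ - 1 = i by ring] at h1
    rw [h1, show ((n : ℤ) - m₁ - 1 - (i - (i - (n - m₁ - 1)))).toNat = 0 by omega]
    simp
  · intro j hj
    by_cases h : j ≤ i ∧ i + (m₁ + 1) ≤ j + n
    · rw [zero_pow (by omega), zero_mul]
    · rw [bandEntry_of_not h, mul_zero]

theorem codeformed_eq {τ : ℝ} (hτ : 0 < τ) :
    codeformed n s u v τ =
      bandOp n (bandEntry n (s * (τ⁻¹ ^ n)⁻¹) fun i => τ⁻¹ ^ i • u i) v := by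
  funext i
  unfold codeformed bandOp
  refine Finset.sum_congr rfl fun j _ => ?_
  rw [bandEntry_rescale _ _ fun i => (zpow_pos (inv_pos.mpr hτ) i).ne']
  congr 1
  beta_reduce
  by_cases h : j ≤ i ∧ i + (m₁ + 1) ≤ j + n
  · congr 1
    rw [pow_toNat (by omega), inv_pow, inv_inv, inv_zpow', inv_zpow', ← zpow_natCast,
      ← zpow_add₀ hτ.ne', ← zpow_sub₀ hτ.ne']
    congr 1
    omega
  · rw [bandEntry_of_not h, mul_zero, mul_zero]

theorem TotallyPositive.codeformed (hu : TotallyPositive n s u) (hv : TotallyPositive n t v)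
    (hm : m₂ ≤ m₁) {τ : ℝ} (hτ : 0 ≤ τ) : TotallyPositive n t (codeformed n s u v τ) := by
  rcases hτ.eq_or_lt with rfl | h
  · rw [codeformed_zero hu]
    have := hv.shift (-(n - m₁ - 1))
    exact this
  · rw [codeformed_eq h]
    exact (hu.zpow_rescale (inv_pos.mpr h)).bandOp hv hm

theorem bandOp_zpow_eq_codeformed {τ : ℝ} (hτ : 0 < τ) :
    bandOp n (bandEntry n s u) (fun i => τ ^ i • v i) =
      fun i : ℤ => τ ^ (i - ((n : ℤ) - m₁ - 1)) • GeometricR.codeformed n s u v τ i := by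
  funext i
  unfold GeometricR.codeformed bandOp
  rw [Finset.smul_sum]
  refine Finset.sum_congr rfl fun j _ => ?_
  rw [smul_smul, smul_smul]
  congr 1
  by_cases h : j ≤ i ∧ i + (m₁ + 1) ≤ j + n
  · rw [mul_comm, ← mul_assoc]
    congr 1
    rw [pow_toNat (by omega), ← zpow_add₀ hτ.ne']
    congr 1
    omega
  · rw [bandEntry_of_not h, zero_mul]
    beta_reduce
    rw [bandEntry_of_not h, mul_zero, mul_zero]

/-- Here entries are weighted by their distance from the main diagonal, up to a scalar, while the
parameter grows to `t * (τ ^ n)⁻¹`. -/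
theorem bandEntry_codeformed (hlt : m₂ + 1 < n) {τ : ℝ} (hτ : 0 < τ) (i j : ℤ) :
    τ ^ (n - m₂ - 1) *
      bandEntry n (t * (τ ^ n)⁻¹) (bandOp n (bandEntry n s u) fun i => τ ^ i • v i) i j =
      τ ^ (i - j).toNat * bandEntry n t (GeometricR.codeformed n s u v τ) i j := by
  rw [bandOp_zpow_eq_codeformed hτ,
    bandEntry_rescale (c := fun i => τ ^ (i - ((n : ℤ) - m₁ - 1))) _ _ fun i => (zpow_pos hτ _).ne']
  by_cases h : j ≤ i ∧ i + (m₂ + 1) ≤ j + n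
  · rw [← mul_assoc]
    congr 1
    rw [pow_toNat (by omega), ← zpow_natCast, ← zpow_natCast, ← zpow_neg, ← zpow_add₀ hτ.ne',
      ← zpow_sub₀ hτ.ne', ← zpow_add₀ hτ.ne']
    congr 1
    omega
  · rw [bandEntry_of_not h, mul_zero, mul_zero, mul_zero]

/-- The moving parameter `t * (τ ^ n)⁻¹` stays at least `t > s`. At `τ = 0` the operator is diagonal
with positive periodic entries, so the solution is a positive rescaling of `u`. -/
theorem exists_preimage_of_gt (hu : TotallyPositive n s u) (hv : TotallyPositive n t v)
    (hm : m₂ ≤ m₁) (hst : s < t) :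
    ∃ w, TotallyPositive n s w ∧
      bandOp n (bandEntry n t (bandOp n (bandEntry n s u) v)) w = u := by
  have hlt := hv.lt
  set y := GeometricR.codeformed n s u v with hy
  have hyc : ∀ i l, ContinuousOn (fun τ => y τ i l) (Set.Icc 0 1) := fun i l =>
    (continuous_bandOp_pow _ _ _ _ _).continuousOn
  have hyP : ∀ τ ∈ Set.Icc (0 : ℝ) 1, TotallyPositive n t (y τ) := fun τ hτ =>
    hu.codeformed hv hm hτ.1
  have hlt_s : ∀ τ ∈ Set.Ioc (0 : ℝ) 1, s ≠ t * (τ ^ n)⁻¹ := by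
    intro τ hτ
    have h1 : 1 ≤ (τ ^ n)⁻¹ := (one_le_inv₀ (pow_pos hτ.1 n)).mpr (pow_le_one₀ hτ.1.le hτ.2)
    have := le_mul_of_one_le_right hv.pos.le h1
    exact (hst.trans_le this).ne
  have hbe : ∀ τ, 0 < τ → (fun i j => τ ^ (i - j).toNat * bandEntry n t (y τ) i j) =
      fun i j => τ ^ (n - m₂ - 1) * bandEntry n (t * (τ ^ n)⁻¹)
        (bandOp n (bandEntry n s u) fun i => τ ^ i • v i) i j := by
    intro τ hτ
    funext i j
    rw [bandEntry_codeformed hlt hτ]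
  have h0P := hyP 0 ⟨le_rfl, zero_le_one⟩
  have hzero : ∀ {E : Type} [AddCommGroup E] [Module ℝ E] (x : ℤ → E) (i : ℤ),
      bandOp n (fun i j => (0 : ℝ) ^ (i - j).toNat * bandEntry n t (y 0) i j) x i =
        bandEntry n t (y 0) i i • x i := by
    intro E _ _ x i
    rw [bandOp_eq_single (d := 0) _ _ le_rfl (by omega)]
    · simp
    · intro j hj
      by_cases h : j ≤ i
      · rw [zero_pow (by omega), zero_mul]
      · rw [bandEntry_of_not (by omega), mul_zero]
  have hN : ∀ τ ∈ Set.Ioc (0 : ℝ) 1, TotallyPositive n (t * (τ ^ n)⁻¹)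
      (bandOp n (bandEntry n s u) fun i => τ ^ i • v i) := by
    intro τ hτ
    rw [bandOp_zpow_eq_codeformed hτ.1]
    refine (hyP τ ⟨hτ.1.le, hτ.2⟩).rescale (c := fun i => τ ^ (i - ((n : ℤ) - m₁ - 1)))
      (fun i => zpow_pos hτ.1 _) (inv_pos.mpr (pow_pos hτ.1 n)) fun i => ?_
    have := hτ.1.ne'
    rw [add_sub_right_comm, zpow_add₀ this, zpow_natCast]
    field_simp
  refine (exists_preimage_path hu
    (c := fun τ i j => τ ^ (i - j).toNat * bandEntry n t (y τ) i j)
    (fun τ i j h => by rw [bandEntry_of_not (by omega), mul_zero])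
    (fun τ hτ i j => by
      rw [(hyP τ hτ).nondegenerate.bandEntry_add, add_sub_add_right_eq_sub])
    (fun i j => (continuous_pow _).continuousOn.mul
      (continuousOn_bandEntry t hyc (fun τ hτ a => ((hyP τ hτ).window_pos a).ne') i j)) ?_ ?_ ?_).imp fun w hw => ⟨hw.1, ?_⟩
  · intro τ hτ x hx h
    rcases hτ.1.eq_or_lt with rfl | hτ0
    · intro i
      have := h i
      rw [hzero] at this
      exact (smul_eq_zero.mp this).resolve_left (h0P.bandEntry_self_pos i).ne'
    · exact bandOp_injective_of_ne hu.pos (hN τ ⟨hτ0, hτ.2⟩) (hlt_s τ ⟨hτ0, hτ.2⟩)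
        (pow_pos hτ0 _).ne' hx fun i => by rw [← hbe τ hτ0]; exact h i
  · intro τ hτ w hw h a
    beta_reduce at h
    rw [hbe τ hτ.1] at h
    exact window_ne_zero_of_exchange hu (hv.zpow_rescale hτ.1) (hN τ hτ)
      (hlt_s τ hτ) hw h a
  · intro w hw h
    have hb := h0P.bandEntry_self_pos
    have : w = fun i => (bandEntry n t (y 0) i i)⁻¹ • u i := by
      funext i
      rw [← h, hzero, smul_smul, inv_mul_cancel₀ (hb i).ne', one_smul]
    rw [this]
    have := hu.rescale (c := fun i => (bandEntry n t (y 0) i i)⁻¹) (α := 1)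
      (fun i => inv_pos.mpr (hb i)) one_pos
      fun i => by rw [one_mul, h0P.nondegenerate.bandEntry_add]
    rwa [mul_one] at this
  · simpa [hy, GeometricR.codeformed] using hw.2

/-- Exchanging the factors of a product, when the second one has the smaller rank. -/
theorem exists_exchange_of_le (hu : TotallyPositive n s u) (hv : TotallyPositive n t v)
    (hm : m₂ ≤ m₁) (hst : s ≠ t) :
    ∃ (v' : ℤ → Fin (m₂ + 1) → ℝ) (u' : ℤ → Fin (m₁ + 1) → ℝ),
      TotallyPositive n t v' ∧ TotallyPositive n s u' ∧
      ∀ j, bandOp n (bandEntry n s u) (fun i => bandEntry n t v i j) =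
        bandOp n (bandEntry n t v') (fun i => bandEntry n s u' i j) := by
  have hv' := hu.bandOp hv hm
  obtain ⟨w, hw, hw'⟩ : ∃ w, TotallyPositive n s w ∧
      bandOp n (bandEntry n t (bandOp n (bandEntry n s u) v)) w = u := by
    rcases hst.lt_or_gt with h | h
    · exact exists_preimage_of_gt hu hv hm h
    · exact exists_preimage_of_lt hu hv hm h
  exact ⟨_, w, hv', hw, bandEntry_exchange hu.nondegenerate hv.nondegenerate hv'.nondegenerate rfl
    hw.nondegenerate hw'.symm (twist_mul_ne hu.pos hv.pos hst)⟩

end Codeformation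

/-! ### Anti-transposition and the exchange for arbitrary ranks. -/

section Duality

variable {m m₁ m₂ n : ℕ} {s t : ℝ} {u : ℤ → Fin (m₁ + 1) → ℝ} {v : ℤ → Fin (m₂ + 1) → ℝ}

/-- The columns of a band matrix are characterized by their support, their bottom entry and the
span of `u`. -/
theorem Nondegenerate.bandEntry_unique {K : Type*} [Field K] {t : K} {u : ℤ → Fin (m + 1) → K}
    (hu : Nondegenerate n t u) {x : ℤ → K} {j : ℤ} (hx : SupportedIn x j (j + n - m - 1))
    (h1 : x (j + n - m - 1) = 1) (hs : InSpan u (fold n ((-1) ^ m * t) x)) (i : ℤ) :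
    x i = bandEntry n t u i j := by
  have hlt := hu.lt
  have hc : SupportedIn (fun i => bandEntry n t u i j) j (j + n - m - 1) := fun i hi =>
    bandEntry_of_not (by omega)
  have hcs : InSpan u (fold n ((-1) ^ m * t) fun i => bandEntry n t u i j) := by
    rw [← bandOp_column, fold_bandOp hu.pos hu.bandEntry_add (a := j) (b := j)]
    · exact hu.bandOp_inSpan (fold_quasiPeriodic _ hu.twist_ne _)
    · intro i hi
      exact Pi.single_eq_of_ne (by omega) _
  have hd : SupportedIn (fun i => x i - bandEntry n t u i j) j (j + n - m - 2) := by
    intro i hi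
    beta_reduce
    by_cases h : i = j + n - m - 1
    · rw [h, h1, hu.bandEntry_bottom, sub_self]
    · rw [hx i (by omega), bandEntry_of_not (by omega), sub_zero]
  refine sub_eq_zero.mp (eq_zero_of_fold_inSpan hu hd (by omega) ?_ i)
  rw [fold_sub hu.pos hx hc]
  exact hs.sub hcs

/-- The point whose band matrix is the anti-transpose of that of `u`. -/
noncomputable def dual (u : ℤ → Fin (m + 1) → ℝ) : ℤ → Fin (m + 1) → ℝ :=
  reflect fun j => (window u (j - m - 1)).det⁻¹ • twist u j

/-- The normalization by consecutive minors contributes `(t ^ (m + 1))⁻¹` to the parameter, without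
sign as `m * (m + 1)` is even. Together with `t ^ m` from the twist this is `t⁻¹`, which `reflect`
inverts. -/
theorem TotallyPositive.dual {u : ℤ → Fin (m + 1) → ℝ} (hu : TotallyPositive n t u) :
    TotallyPositive n t (dual u) := by
  have ht := hu.pos
  have h := (hu.twist.rescale (c := fun j => (window u (j - m - 1)).det⁻¹)
    (α := (t ^ (m + 1))⁻¹) (fun i => inv_pos.mpr (hu.window_pos _))
    (inv_pos.mpr (pow_pos ht _)) fun i => ?_).reflect
  · have e : (t ^ m * (t ^ (m + 1))⁻¹)⁻¹ = t := by
      rw [pow_succ]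
      field_simp
    rwa [e] at h
  · have h1 := det_window_add hu.periodic (i - m - 1)
    rw [mul_pow, ← pow_mul, (Nat.even_mul_succ_self m).neg_one_pow, one_mul] at h1
    rw [show i + (n : ℤ) - m - 1 = i - m - 1 + n by ring, ← h1, mul_inv]

/-- By `bandEntry_unique` only the span needs an argument: along a row of the matrix of `u` the
entries pair varying normalized twist vectors with one fixed vector `u (-j)`, hence are values of
one linear form on the dual. -/
theorem TotallyPositive.bandEntry_dual {u : ℤ → Fin (m + 1) → ℝ} (hu : TotallyPositive n t u)
    (i j : ℤ) : bandEntry n t (GeometricR.dual u) i j = bandEntry n t u (-j) (-i) := by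
  have hlt := hu.lt
  have hd := hu.dual
  have hl := hd.nondegenerate.twist_ne
  have hx : SupportedIn (fun i => bandEntry n t u (-j) (-i)) j (j + n - m - 1) := fun i hi =>
    bandEntry_of_not (by omega)
  refine (hd.nondegenerate.bandEntry_unique (x := fun i => bandEntry n t u (-j) (-i)) hx ?_ ?_
    i).symm
  · have := hu.nondegenerate.bandEntry_bottom (-(j + n - m - 1))
    rw [show -(j + (n : ℤ) - m - 1) + n - m - 1 = -j by ring] at this
    exact this
  · set h : (Fin (m + 1) → ℝ) →ₗ[ℝ] ℝ :=
      t • ∑ l : Fin (m + 1), u (-j) l • LinearMap.proj l.rev with hh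
    refine ⟨h, fun i => congrFun (QuasiPeriodic.eq_of_window hl hu.nondegenerate.pos
      (fold_quasiPeriodic _ hl _) (hd.periodic.map h) j fun i h1 h2 => ?_) i⟩
    rw [fold_apply_of_lt hu.nondegenerate.pos (a := j) (fun i hi => hx i (by omega)) h1 h2,
      hu.nondegenerate.entry_eq (by omega) (by omega), bracket_eq_sum, hh, LinearMap.smul_apply,
      LinearMap.sum_apply, smul_eq_mul, mul_div_assoc, Finset.sum_div]
    congr 1
    refine Finset.sum_congr rfl fun l _ => ?_
    simp only [LinearMap.smul_apply, LinearMap.proj_apply, GeometricR.dual, GeometricR.reflect, Fin.rev_rev,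
      Pi.smul_apply, smul_eq_mul]
    ring

/-- Anti-transposition reverses products; since both matrices are banded, the two summation ranges
can be cut to their intersection. -/
theorem bandOp_antitranspose {K : Type*} [Field K] {A B : ℤ → ℤ → K}
    (hA : ∀ i j : ℤ, ¬ (j ≤ i ∧ i < j + n) → A i j = 0)
    (hB : ∀ i j : ℤ, ¬ (j ≤ i ∧ i < j + n) → B i j = 0) (i j : ℤ) :
    bandOp n A (fun l => B l j) i =
      bandOp n (fun a b => B (-b) (-a)) (fun l => A i (-l)) (-j) := by
  have e1 : bandOp n (fun a b => B (-b) (-a)) (fun l => A i (-l)) (-j) =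
      ∑ l ∈ Finset.Icc j (j + n), A i l * B l j := by
    unfold bandOp
    refine Finset.sum_bij (fun l _ => -l) ?_ ?_ ?_ ?_
    · intro l hl; rw [Finset.mem_Icc] at hl ⊢; omega
    · intro l _ l' _ h; omega
    · intro l hl
      rw [Finset.mem_Icc] at hl
      exact ⟨-l, by rw [Finset.mem_Icc]; omega, neg_neg l⟩
    · intro l _
      beta_reduce
      rw [neg_neg, smul_eq_mul, mul_comm]
  have e2 : ∀ S : Finset ℤ, Finset.Icc (i - n) i ∩ Finset.Icc j (j + n) ⊆ S →
      ∑ l ∈ S, A i l * B l j =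
        ∑ l ∈ Finset.Icc (i - n) i ∩ Finset.Icc j (j + n), A i l * B l j := by
    intro S hS
    refine (Finset.sum_subset hS fun l _ hl => ?_).symm
    rw [Finset.mem_inter, Finset.mem_Icc, Finset.mem_Icc] at hl
    by_cases h : l ≤ i ∧ i < l + n
    · rw [hB l j (by omega), mul_zero]
    · rw [hA i l h, zero_mul]
  rw [e1, e2 _ Finset.inter_subset_right, ← e2 _ Finset.inter_subset_left]
  rfl

theorem bandEntry_of_not_lt {K : Type*} [Field K] {t : K} {u : ℤ → Fin (m + 1) → K} (i j : ℤ)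
    (h : ¬ (j ≤ i ∧ i < j + n)) : bandEntry n t u i j = 0 := bandEntry_of_not (by omega)

/-- Every product of two positive band matrices with distinct parameters can be refactored in the
opposite order. -/
theorem exists_exchange (hu : TotallyPositive n s u) (hv : TotallyPositive n t v) (hst : s ≠ t) :
    ∃ (v' : ℤ → Fin (m₂ + 1) → ℝ) (u' : ℤ → Fin (m₁ + 1) → ℝ),
      TotallyPositive n t v' ∧ TotallyPositive n s u' ∧
      ∀ i j, bandOp n (bandEntry n s u) (fun i => bandEntry n t v i j) i =
        bandOp n (bandEntry n t v') (fun i => bandEntry n s u' i j) i := by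
  rcases le_total m₂ m₁ with hm | hm
  · obtain ⟨v', u', h1, h2, h3⟩ := exists_exchange_of_le hu hv hm hst
    exact ⟨v', u', h1, h2, fun i j => congrFun (h3 j) i⟩
  -- The dual product has its factors in the opposite order, so the rank condition holds for it;
  -- dualizing the result back gives the exchange.
  · obtain ⟨a, b, ha, hb, hab⟩ := exists_exchange_of_le hv.dual hu.dual hm hst.symm
    refine ⟨dual b, dual a, hb.dual, ha.dual, fun i j => ?_⟩
    have h1 : bandOp n (bandEntry n s u) (fun i => bandEntry n t v i j) i =
        bandOp n (bandEntry n t (dual v)) (fun l => bandEntry n s (dual u) l (-i)) (-j) := by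
      rw [bandOp_antitranspose bandEntry_of_not_lt bandEntry_of_not_lt]
      simp only [funext₂ hv.bandEntry_dual, hu.bandEntry_dual, neg_neg]
    have h2 : bandOp n (bandEntry n t (dual b)) (fun i => bandEntry n s (dual a) i j) i =
        bandOp n (bandEntry n s a) (fun l => bandEntry n t b l (-i)) (-j) := by
      rw [bandOp_antitranspose bandEntry_of_not_lt bandEntry_of_not_lt]
      simp only [hb.bandEntry_dual, ha.bandEntry_dual, neg_neg]
    rw [h1, h2, hab]

end Duality

/-! ### Minors indexed by `Fin n` as minors of integer sequences. -/

section SetDet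

variable {ι κ K : Type*} [LinearOrder ι] [LinearOrder κ] [Field K] {m n k : ℕ}

theorem setDet_map (u : κ → Fin k → K) (f : ι ↪o κ) (I : Finset ι) :
    setDet u (I.map f.toEmbedding) = setDet (fun i => u (f i)) I := by
  by_cases h : I.card = k
  · rw [setDet_of_strictMono u (a := fun r => f (I.orderEmbOfFin h r)), setDet, dif_pos h]
    · exact f.strictMono.comp (I.orderEmbOfFin h).strictMono
    · ext x
      simp only [Finset.mem_image, Finset.mem_univ, true_and, Finset.mem_map,
        RelEmbedding.coe_toEmbedding]
      constructor
      · rintro ⟨r, rfl⟩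
        exact ⟨_, I.orderEmbOfFin_mem h r, rfl⟩
      · rintro ⟨i, hi, rfl⟩
        have : i ∈ Set.range (I.orderEmbOfFin h) := by rwa [Finset.range_orderEmbOfFin]
        obtain ⟨r, rfl⟩ := this
        exact ⟨r, rfl⟩
  · rw [setDet, setDet, dif_neg h, dif_neg (by rwa [Finset.card_map])]

theorem setDet_ringHom {L : Type*} [Field L] (φ : K →+* L) (u : ι → Fin k → K) (I : Finset ι) :
    setDet (fun i l => φ (u i l)) I = φ (setDet u I) := by
  unfold setDet
  split_ifs
  · rw [RingHom.map_det]; rfl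
  · rw [map_zero]

theorem maxMinor_eq_setDet {n k : ℕ} (A : Matrix (Fin n) (Fin k) ℂ) (I : Finset (Fin n)) :
    maxMinor A I = setDet A I := rfl

/-- The embedding of `Fin n` in the integers. -/
noncomputable def finInt (n : ℕ) : Fin n ↪o ℤ :=
  OrderEmbedding.ofStrictMono (fun i => ((i : ℕ) : ℤ)) fun i j h => by
    have : (i : ℕ) < j := h
    simp only
    omega

theorem finInt_apply (i : Fin n) : finInt n i = ((i : ℕ) : ℤ) := rfl

theorem map_finInt_filter [NeZero n] (J : Finset (ZMod n)) :
    (Finset.univ.filter fun i : Fin n => (((i : ℕ) : ℤ) : ZMod n) ∈ J).map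
      (finInt n).toEmbedding = liftSet 0 J := by
  ext x
  simp only [Finset.mem_map, Finset.mem_filter, Finset.mem_univ, true_and,
    RelEmbedding.coe_toEmbedding, finInt_apply, mem_liftSet]
  constructor
  · rintro ⟨i, hi, rfl⟩
    exact ⟨⟨by omega, by have := i.2; omega⟩, hi⟩
  · rintro ⟨⟨h1, h2⟩, h3⟩
    refine ⟨⟨x.toNat, by omega⟩, ?_, by simp only; omega⟩
    simpa only [Int.toNat_of_nonneg h1] using h3

theorem map_finInt_residues [NeZero n] (T : Finset ℤ) :
    (residues n T).map (finInt n).toEmbedding = liftSet 0 (T.image (Int.cast : ℤ → ZMod n)) := by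
  rw [← map_finInt_filter]
  congr 1
  ext i
  simp only [residues, Finset.mem_filter, Finset.mem_univ, true_and, Finset.mem_image,
    ← ZMod.intCast_eq_intCast_iff]

end SetDet

/-! ### Real positive representatives of points of the Grassmannian. -/

section Representatives

variable {m n : ℕ}

/-- The first period of `u`, as a complex matrix. -/
noncomputable def columns (n : ℕ) (u : ℤ → Fin (m + 1) → ℝ) : Matrix (Fin n) (Fin (m + 1)) ℂ :=
  Matrix.of fun i l => ((u (i : ℕ) l : ℝ) : ℂ)

/-- `u` is a positive representative of the point `N|t`. -/
structure Represents (t : ℝ) (u : ℤ → Fin (m + 1) → ℝ) (x : X n (m + 1)) : Prop where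
  totallyPositive : TotallyPositive n t u
  coe_eq : (t : ℂ) = x.2
  range_eq : LinearMap.range (columns n u).mulVecLin = x.1.1

theorem Gr.range_rep {k : ℕ} (N : Gr n k) : LinearMap.range N.rep.mulVecLin = N.1 := by
  rw [Matrix.range_mulVecLin]
  have h := (Module.finBasisOfFinrankEq ℂ N.1 N.2).span_eq
  have h2 := congrArg (Submodule.map N.1.subtype) h
  rw [Submodule.map_span, Submodule.map_top, Submodule.range_subtype, ← Set.range_comp] at h2
  exact h2

theorem maxMinor_columns (u : ℤ → Fin (m + 1) → ℝ) (I : Finset (Fin n)) :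
    maxMinor (columns n u) I = ((setDet u (I.map (finInt n).toEmbedding) : ℝ) : ℂ) := by
  rw [maxMinor_eq_setDet, setDet_map]
  exact setDet_ringHom Complex.ofRealHom (fun i : Fin n => u (i : ℕ)) I

theorem Represents.isPositive {t : ℝ} {u : ℤ → Fin (m + 1) → ℝ} {x : X n (m + 1)}
    (h : Represents t u x) : IsPositive x := by
  refine ⟨by rw [← h.coe_eq]; exact Complex.zero_lt_real.mpr h.totallyPositive.pos, ?_⟩
  obtain ⟨c, hc, hcI⟩ := x.1.plucker_of_span (columns n u) (by
    rw [← h.range_eq, Matrix.range_mulVecLin]; rfl)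
  refine ⟨c, hc, fun J hJ => ?_⟩
  rw [← hcI, maxMinor_columns]
  refine Complex.zero_lt_real.mpr (h.totallyPositive.setDet_pos 0 _ (by rw [Finset.card_map, hJ])
    fun i hi => ?_)
  obtain ⟨j, -, rfl⟩ := Finset.mem_map.mp hi
  have := j.2
  change 0 ≤ ((j : ℕ) : ℤ) ∧ ((j : ℕ) : ℤ) < 0 + n
  omega

theorem columns_submatrix (u : ℤ → Fin (m + 1) → ℝ) (hlt : m + 1 ≤ n) :
    ((columns n u).submatrix (Fin.castLE hlt) id).det = (((window u 0).det : ℝ) : ℂ) := by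
  change _ = Complex.ofRealHom _
  rw [RingHom.map_det]
  congr 1
  ext r l
  simp [columns, window_apply]

theorem exists_represents (s : ℝ) (u : ℤ → Fin (m + 1) → ℝ) (hu : TotallyPositive n s u) (t : ℂˣ)
    (ht : (s : ℂ) = t) : ∃ N : Gr n (m + 1), Represents s u (N, t) := by
  have hinj : Function.Injective (columns n u).mulVecLin := by
    rw [← LinearMap.ker_eq_bot, LinearMap.ker_eq_bot']
    intro x hx
    have hd : ((columns n u).submatrix (Fin.castLE hu.lt.le) id).det ≠ 0 := by
      rw [columns_submatrix]
      exact_mod_cast (hu.window_pos 0).ne'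
    by_contra hne
    refine hd (Matrix.exists_mulVec_eq_zero_iff.mp ⟨x, hne, ?_⟩)
    funext r
    exact congrFun hx (Fin.castLE hu.lt.le r)
  refine ⟨⟨LinearMap.range (columns n u).mulVecLin, ?_⟩, hu, ht, rfl⟩
  rw [LinearMap.finrank_range_of_inj hinj, Module.finrank_fin_fun]

theorem IsPositive.exists_represents (hlt : m + 1 < n) {x : X n (m + 1)} (h : IsPositive x) :
    ∃ t u, Represents t u x := by
  obtain ⟨ht, c, hc, hJ⟩ := h
  have : NeZero n := ⟨by omega⟩
  set A := x.1.rep with hA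
  have hreal : ∀ z : ℂ, 0 < z → ((z.re : ℝ) : ℂ) = z := fun z hz => by
    rw [Complex.lt_def] at hz
    exact Complex.ext rfl (by simpa using hz.2)
  have hmono : ∀ a : Fin (m + 1) → Fin n, StrictMono a → 0 < c * (A.submatrix a id).det := by
    intro a ha
    have h1 : maxMinor A (Finset.univ.image a) = (A.submatrix a id).det :=
      setDet_of_strictMono A ha rfl
    rw [← h1]
    refine hJ _ ?_
    rw [Finset.card_image_of_injective _ ha.injective, Finset.card_univ, Fintype.card_fin]
  set a₀ : Fin (m + 1) → Fin n := Fin.castLE hlt.le with ha₀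
  set B := A.submatrix a₀ id with hB
  have hB0 : 0 < c * B.det := hmono a₀ (Fin.strictMono_castLE hlt.le)
  have hBne : B.det ≠ 0 := right_ne_zero_of_mul hB0.ne'
  -- Ratios of maximal minors are real: sorting the row indices costs a sign, and the common scalar
  -- `c` cancels.
  have hr : ∀ a : Fin (m + 1) → Fin n, ∃ r : ℝ, (A.submatrix a id).det = r * B.det := by
    intro a
    by_cases hi : Function.Injective a
    · have hs := hmono (a ∘ Tuple.sort a) ((Tuple.monotone_sort a).strictMono_of_injective
        (hi.comp (Tuple.sort a).injective))
      have hp : (A.submatrix (a ∘ Tuple.sort a) id).det =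
          ((Equiv.Perm.sign (Tuple.sort a) : ℤ) : ℂ) * (A.submatrix a id).det := by
        rw [← Matrix.det_permute (Tuple.sort a)]; rfl
      have hsq : (((Equiv.Perm.sign (Tuple.sort a) : ℤ) : ℂ)) *
          ((Equiv.Perm.sign (Tuple.sort a) : ℤ) : ℂ) = 1 := by
        rcases Int.units_eq_one_or (Equiv.Perm.sign (Tuple.sort a)) with h | h <;> rw [h] <;>
          norm_num
      refine ⟨((Equiv.Perm.sign (Tuple.sort a) : ℤ) : ℝ) *
        ((c * (A.submatrix (a ∘ Tuple.sort a) id).det).re / (c * B.det).re), ?_⟩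
      push_cast
      rw [hreal _ hs, hreal _ hB0, hp]
      field_simp
      linear_combination -(A.submatrix a id).det * hsq
    · simp only [Function.Injective, not_forall] at hi
      obtain ⟨i, j, hij, hne⟩ := hi
      refine ⟨0, ?_⟩
      rw [Matrix.det_zero_of_row_eq (M := A.submatrix a id) hne (by ext l; simp [hij])]
      simp
  choose r hr using hr
  -- The entries of `A * B⁻¹` by Cramer's rule: row `l` of the block `B` is replaced by row `i` of
  -- `A`. They are ratios of maximal minors, hence real.
  set u₀ : Fin n → Fin (m + 1) → ℝ := fun i l => r (Function.update a₀ l i) with hu₀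
  set s := (x.2 : ℂ).re with hs
  have hs0 : 0 < s := by
    rw [← Complex.zero_lt_real, hreal _ ht]; exact ht
  set u := extend n ((-1) ^ m * s) u₀ with hu
  have hup : QuasiPeriodic n ((-1) ^ m * s) u := extend_quasiPeriodic (twist_ne hs0.ne') _
  have huu : ∀ i : Fin n, u (i : ℕ) = u₀ i := extend_apply _ _
  have hfac : A = columns n u * B := by
    ext i l
    have h1 := congrFun (Matrix.mulVec_cramer B.transpose (A i)) l
    have h2 : ∀ j, Matrix.cramer B.transpose (A i) j = u₀ i j * B.det := by
      intro j
      rw [Matrix.cramer_transpose_apply, ← hr]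
      congr 1
      ext p q
      by_cases hp : p = j
      · subst hp; simp
      · simp [hp, hB]
    rw [Matrix.det_transpose, Pi.smul_apply, smul_eq_mul, Matrix.mulVec, dotProduct] at h1
    simp only [h2, Matrix.transpose_apply] at h1
    apply mul_left_cancel₀ hBne
    rw [← h1, Matrix.mul_apply, Finset.mul_sum]
    refine Finset.sum_congr rfl fun j _ => ?_
    rw [columns, Matrix.of_apply, huu]
    ring
  refine ⟨s, u, ?_, hreal _ ht, ?_⟩
  · rw [totallyPositive_iff hlt hs0 hup]
    intro J hJc
    have h1 : maxMinor A (Finset.univ.filter fun i : Fin n => (((i : ℕ) : ℤ) : ZMod n) ∈ J) =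
        B.det * ((residueDet u J : ℝ) : ℂ) := by
      rw [hfac, maxMinor_mul, maxMinor_columns, map_finInt_filter]
      rfl
    have h2 := hJ (Finset.univ.filter fun i : Fin n => (((i : ℕ) : ℤ) : ZMod n) ∈ J) (by
      rw [← Finset.card_map (finInt n).toEmbedding, map_finInt_filter, card_liftSet, hJc])
    change 0 < c * maxMinor A _ at h2
    rw [h1, ← mul_assoc] at h2
    exact Complex.zero_lt_real.mp (pos_of_mul_pos_right h2 hB0.le)
  · rw [← Gr.range_rep, ← hA, hfac, Matrix.mulVecLin_mul]
    symm
    refine LinearMap.range_comp_of_range_eq_top _ ?_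
    rw [LinearMap.range_eq_top]
    exact Matrix.mulVec_surjective_iff_isUnit.mpr
      ((Matrix.isUnit_iff_isUnit_det _).mpr (Ne.isUnit hBne))

end Representatives

/-! ### The entries of g and the band matrix. -/

section Entries

variable {m n : ℕ}

section RealCase

variable {K : Type*} [Field K]

theorem setDet_Icc_union (u : ℤ → Fin (m + 1) → K) {i j : ℤ} (h : j - m ≤ i) :
    setDet u (Finset.Icc (j - m) (j - 1) ∪ {i}) = bracket u j (u i) := by
  rcases lt_or_ge i j with hij | hij
  · rw [bracket_eq_zero u h hij, setDet, dif_neg]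
    intro hc
    rw [Finset.union_eq_left.mpr (Finset.singleton_subset_iff.mpr (Finset.mem_Icc.mpr
      ⟨h, by omega⟩)), Int.card_Icc] at hc
    omega
  · rw [setDet_of_strictMono u
      (a := fun r : Fin (m + 1) => if r = Fin.last m then i else j - m + (r : ℕ)), bracket_apply]
    · congr 1
      ext r l
      by_cases hr : r = Fin.last m
      · subst hr; simp
      · rw [Matrix.updateRow_ne hr, Matrix.of_apply, if_neg hr, window_apply]
    · intro r s hrs
      have h1 : (r : ℕ) < s := hrs
      have h2 := s.2
      have h3 : r ≠ Fin.last m := fun e => by rw [e, Fin.val_last] at h1; omega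
      simp only [if_neg h3]
      split_ifs <;> omega
    · ext x
      simp only [Finset.mem_image, Finset.mem_univ, true_and, Finset.mem_union, Finset.mem_Icc,
        Finset.mem_singleton]
      constructor
      · rintro ⟨r, rfl⟩
        split_ifs with hr
        · exact Or.inr rfl
        · have : (r : ℕ) ≠ m := fun e => hr (Fin.ext e)
          have := r.2
          left; omega
      · rintro (h1 | rfl)
        · refine ⟨⟨(x - (j - m)).toNat, by omega⟩, ?_⟩
          rw [if_neg (by rw [Fin.ext_iff, Fin.val_last]; simp only; omega)]
          simp only
          omega
        · exact ⟨Fin.last m, if_pos rfl⟩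

end RealCase

theorem residues_congr {i i' : ℤ} (h : i ≡ i' [ZMOD n]) (T : Finset ℤ) :
    residues n (T ∪ {i}) = residues n (T ∪ {i'}) := by
  ext y
  simp only [residues, Finset.mem_filter, Finset.mem_univ, true_and, Finset.mem_union,
    Finset.mem_singleton, or_and_right, exists_or, exists_eq_left]
  exact or_congr Iff.rfl ⟨fun h1 => h.symm.trans h1, fun h1 => h.trans h1⟩

theorem turns_insert {i : ℤ} {T : Finset ℤ} (h : i ∉ T) :
    turns n (insert i T) = i / n + turns n T := Finset.sum_insert h

variable {t : ℝ} {u : ℤ → Fin (m + 1) → ℝ} {x : X n (m + 1)}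

theorem Represents.plucker_residues (h : Represents t u x) :
    ∃ c : ℂ, c ≠ 0 ∧ ∀ (z : ℤ) (T : Finset ℤ), (∀ i ∈ T, z ≤ i ∧ i < z + n) →
      c * x.1.plucker (residues n T) = ((setDet u T * t ^ turns n T : ℝ) : ℂ) := by
  have hu := h.totallyPositive
  have : NeZero n := ⟨hu.nondegenerate.pos.ne'⟩
  obtain ⟨c, hc, hcI⟩ := x.1.plucker_of_span (columns n u) (by
    rw [← h.range_eq, Matrix.range_mulVecLin]; rfl)
  refine ⟨c, hc, fun z T hT => ?_⟩
  rw [← hcI, maxMinor_columns, map_finInt_residues, setDet_eq hu.pos.ne' hu.periodic hT]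
  rfl

/-- Here `e` lifts `i` to the period starting at `j - m`. Numerator and denominator then differ only
in the elements `i + e * n` and `j - m - 1`, whose difference in turns is the exponent of `t`. -/
theorem Represents.plucker_ratio (h : Represents t u x) (i j : Fin n) (e : ℤ)
    (h1 : (j : ℕ) - (m : ℤ) ≤ (i : ℕ) + e * n) (h2 : (i : ℕ) + e * n < (j : ℕ) - (m : ℤ) + n) :
    x.1.plucker (residues n (Finset.Icc (((j : ℕ) : ℤ) - m) ((j : ℕ) - 1) ∪ {((i : ℕ) : ℤ)})) /
      x.1.plucker (residues n (Finset.Icc (((j : ℕ) : ℤ) - m - 1) ((j : ℕ) - 1))) =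
      ((bracket u (j : ℕ) (u ((i : ℕ) + e * n)) / (window u ((j : ℕ) - m - 1)).det *
        t ^ (e - (((j : ℕ) : ℤ) - m - 1) / n) : ℝ) : ℂ) := by
  have hu := h.totallyPositive
  have hlt := hu.lt
  have hn : (n : ℤ) ≠ 0 := by have := hu.nondegenerate.pos; omega
  have ht := hu.pos.ne'
  obtain ⟨c, hc, hcT⟩ := h.plucker_residues
  have hres : residues n (Finset.Icc (((j : ℕ) : ℤ) - m) ((j : ℕ) - 1) ∪ {((i : ℕ) : ℤ)}) =
      residues n (Finset.Icc (((j : ℕ) : ℤ) - m) ((j : ℕ) - 1) ∪ {((i : ℕ) + e * n : ℤ)}) :=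
    residues_congr (by simp [Int.ModEq]) _
  have e1 := hcT ((j : ℕ) - m) (Finset.Icc (((j : ℕ) : ℤ) - m) ((j : ℕ) - 1) ∪
    {((i : ℕ) + e * n : ℤ)}) (fun l hl => by
      rw [Finset.mem_union, Finset.mem_Icc, Finset.mem_singleton] at hl
      rcases hl with hl | rfl
      · omega
      · exact ⟨h1, h2⟩)
  have e2 := hcT ((j : ℕ) - m - 1) (Finset.Icc (((j : ℕ) : ℤ) - m - 1) ((j : ℕ) - 1))
    (fun l hl => by rw [Finset.mem_Icc] at hl; omega)
  have hI : Finset.Icc (((j : ℕ) : ℤ) - m - 1) ((j : ℕ) - 1) =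
      Finset.Ico (((j : ℕ) : ℤ) - m - 1) (((j : ℕ) : ℤ) - m - 1 + (m + 1 : ℕ)) := by
    ext l; rw [Finset.mem_Icc, Finset.mem_Ico]; omega
  have hins : Finset.Icc (((j : ℕ) : ℤ) - m - 1) ((j : ℕ) - 1) =
      insert (((j : ℕ) : ℤ) - m - 1) (Finset.Icc (((j : ℕ) : ℤ) - m) ((j : ℕ) - 1)) := by
    ext l; rw [Finset.mem_insert, Finset.mem_Icc, Finset.mem_Icc]; omega
  have e3 : turns n (Finset.Icc (((j : ℕ) : ℤ) - m - 1) ((j : ℕ) - 1)) =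
      (((j : ℕ) : ℤ) - m - 1) / n + turns n (Finset.Icc (((j : ℕ) : ℤ) - m) ((j : ℕ) - 1)) := by
    rw [hins, turns_insert (by rw [Finset.mem_Icc]; omega)]
  rw [setDet_Icc_union u h1] at e1
  have e4 : setDet u (Finset.Icc (((j : ℕ) : ℤ) - m - 1) ((j : ℕ) - 1)) =
      (window u ((j : ℕ) - m - 1)).det := by rw [hI, setDet_Ico]
  rw [e4, e3] at e2
  have hw := (hu.window_pos ((j : ℕ) - m - 1)).ne'
  rw [hres, ← mul_div_mul_left _ _ hc, e1, e2, ← Complex.ofReal_div]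
  congr 1
  set τ := turns n (Finset.Icc (((j : ℕ) : ℤ) - m) ((j : ℕ) - 1)) with hτ
  rcases lt_or_ge ((i : ℕ) + e * n : ℤ) (j : ℕ) with hlt' | hge
  · rw [bracket_eq_zero u h1 hlt']
    simp
  · have e5 : turns n (Finset.Icc (((j : ℕ) : ℤ) - m) ((j : ℕ) - 1) ∪ {((i : ℕ) + e * n : ℤ)}) =
        e + τ := by
      rw [Finset.union_comm, ← Finset.insert_eq, turns_insert (by rw [Finset.mem_Icc]; omega),
        Int.add_mul_ediv_right _ _ hn, Int.ediv_eq_zero_of_lt (by omega) (by have := i.2; omega),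
        zero_add]
    rw [e5, zpow_add₀ ht, zpow_add₀ ht, zpow_sub₀ ht]
    field_simp

/-- The entries of `g` in terms of the band matrix. -/
theorem Represents.g_apply (h : Represents t u x) (i j : Fin n) :
    g x i j = Polynomial.C ((bandEntry n t u (i : ℕ) (j : ℕ) : ℝ) : ℂ) +
      Polynomial.X * Polynomial.C ((bandEntry n t u ((i : ℕ) + n) (j : ℕ) : ℝ) : ℂ) := by
  have hu := h.totallyPositive
  have hlt := hu.lt
  have hi := i.2
  have hj := j.2
  have hn : (0 : ℤ) < n := by omega
  have ht := hu.pos.ne'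
  have e1 : ((j : ℕ) : ℤ) - ((m + 1 : ℕ) : ℤ) + 1 = (j : ℕ) - m := by push_cast; ring
  have e2 : ((j : ℕ) : ℤ) - ((m + 1 : ℕ) : ℤ) = (j : ℕ) - m - 1 := by push_cast; ring
  rw [g, Matrix.of_apply, e1, e2, ← h.coe_eq]
  -- In this case the lift of `i` is `i + n`, so the entry comes from the part of the band carrying
  -- `λ`.
  by_cases c1 : (i : ℕ) + m + 1 ≤ (j : ℕ)
  · rw [h.plucker_ratio i j 1 (by omega) (by omega), if_neg (by omega),
      if_neg (by rw [Fin.le_def]; omega), bandEntry_of_not (by omega), Complex.ofReal_zero,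
      Polynomial.C_0, zero_add, bandEntry, if_pos (by omega),
      Int.ediv_eq_zero_of_lt (by omega) (by omega), sub_zero, zpow_one, one_mul]
    congr 3
    ring
  · have z2 : bandEntry n t u ((i : ℕ) + n) (j : ℕ) = 0 := bandEntry_of_not (by omega)
    rw [z2, Complex.ofReal_zero, Polynomial.C_0, mul_zero, add_zero]
    by_cases c2 : (j : ℕ) ≤ (i : ℕ) ∧ (i : ℕ) + m + 1 ≤ (j : ℕ) + n
    · have hb : bandEntry n t u (i : ℕ) (j : ℕ) = t * bracket u (j : ℕ) (u (i : ℕ)) /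
          (window u ((j : ℕ) - m - 1)).det := if_pos (by omega)
      rw [h.plucker_ratio i j 0 (by omega) (by omega), hb, zero_mul, add_zero, zero_sub]
      -- For these columns the window starts at a negative index, one turn below; this supplies the
      -- factor `t` that g omits there.
      by_cases c3 : (j : ℕ) < m + 1
      · have : (((j : ℕ) : ℤ) - m - 1) / n = -1 := by
          rw [Int.ediv_eq_iff_of_pos hn]
          omega
        rw [if_pos c3, this, neg_neg, zpow_one, one_mul]
        congr 2
        ring
      · rw [if_neg c3, if_pos (by rw [Fin.le_def]; exact c2.1),
          Int.ediv_eq_zero_of_lt (by omega) (by omega), neg_zero, zpow_zero, mul_one,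
          ← Polynomial.C_mul, ← Complex.ofReal_mul, mul_div_assoc]
    · have z1 : bandEntry n t u (i : ℕ) (j : ℕ) = 0 := bandEntry_of_not (by omega)
      rw [z1, Complex.ofReal_zero, Polynomial.C_0]
      by_cases c4 : (i : ℕ) < (j : ℕ)
      · rw [h.plucker_ratio i j 0 (by omega) (by omega),
          bracket_eq_zero u (by omega) (by omega), zero_div, zero_mul, Complex.ofReal_zero,
          Polynomial.C_0, mul_zero]
      · rw [h.plucker_ratio i j (-1) (by omega) (by omega),
          bracket_eq_zero u (by omega) (by omega), zero_div, zero_mul, Complex.ofReal_zero,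
          Polynomial.C_0, mul_zero]

end Entries

/-! ### Evaluating g at complex numbers. -/

section Evaluation

section Composition

variable {K : Type*} [Field K] {n : ℕ}

/-- The product of evaluated matrices depends only on the columns of the product of the band
matrices, so an exchange of band matrices passes to all evaluations. -/
theorem foldMatrix_mul [NeZero n] {lam : K} (hl : lam ≠ 0) {A B : ℤ → ℤ → K}
    (hAs : ∀ i j : ℤ, ¬ (j ≤ i ∧ i < j + n) → A i j = 0)
    (hBs : ∀ i j : ℤ, ¬ (j ≤ i ∧ i < j + n) → B i j = 0)
    (hB : ∀ i j, B (i + n) (j + n) = B i j) (y : Fin n → K) (i : Fin n) :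
    ((foldMatrix n lam A * foldMatrix n lam B).mulVec y) i =
      ∑ j ∈ Finset.Icc ((i : ℕ) - 2 * (n : ℤ)) (i : ℕ),
        bandOp n A (fun l => B l j) (i : ℕ) * extend n lam y j := by
  set x := extend n lam y with hx
  have hxp : QuasiPeriodic n lam x := extend_quasiPeriodic hl y
  have hyx : y = fun j : Fin n => x (j : ℕ) := by funext j; rw [hx, extend_apply]
  have h1 : ∀ {C : ℤ → ℤ → K} {w : ℤ → K}, (∀ i j : ℤ, ¬ (j ≤ i ∧ i < j + n) → C i j = 0) →
      QuasiPeriodic n lam w → (foldMatrix n lam C).mulVec (fun j : Fin n => w (j : ℕ)) =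
        fun i : Fin n => bandOp n C w (i : ℕ) := by
    intro C w hC hw
    funext i
    rw [bandOp_eq_foldMatrix hC hw]
    rfl
  rw [← Matrix.mulVec_mulVec, hyx, h1 hBs hxp, h1 hAs (bandOp_quasiPeriodic hB hxp)]
  unfold bandOp
  simp only [smul_eq_mul, Finset.sum_mul]
  rw [Finset.sum_comm]
  refine Finset.sum_congr rfl fun l hl => ?_
  rw [Finset.mem_Icc] at hl
  rw [Finset.mul_sum]
  simp only [← mul_assoc]
  refine Finset.sum_subset (fun j hj => ?_) fun j _ hj => ?_
  · rw [Finset.mem_Icc] at hj ⊢; omega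
  · rw [Finset.mem_Icc] at hj
    rw [hBs l j (by omega), mul_zero, zero_mul]

end Composition

variable {m n : ℕ} {t : ℝ} {u : ℤ → Fin (m + 1) → ℝ} {x : X n (m + 1)}

/-- The complexification of a real sequence of vectors. -/
noncomputable def complexify (u : ℤ → Fin (m + 1) → ℝ) : ℤ → Fin (m + 1) → ℂ :=
  fun i l => ((u i l : ℝ) : ℂ)

theorem det_window_complexify (u : ℤ → Fin (m + 1) → ℝ) (a : ℤ) :
    (window (complexify u) a).det = (((window u a).det : ℝ) : ℂ) := by
  change _ = Complex.ofRealHom _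
  rw [RingHom.map_det]
  rfl

theorem bandEntry_complexify (t : ℝ) (u : ℤ → Fin (m + 1) → ℝ) :
    bandEntry n (t : ℂ) (complexify u) = fun i j => ((bandEntry n t u i j : ℝ) : ℂ) := by
  funext i j
  unfold bandEntry
  split_ifs
  · rw [det_window_complexify]
    push_cast
    congr 2
    rw [bracket_apply, bracket_apply]
    change _ = Complex.ofRealHom _
    rw [RingHom.map_det]
    congr 1
    ext r l
    by_cases hr : r = Fin.last m
    · subst hr
      simp [complexify]
    · simp [Matrix.updateRow_ne hr, complexify, window_apply]
  · simp

theorem TotallyPositive.complexify (hu : TotallyPositive n t u) :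
    Nondegenerate n (t : ℂ) (complexify u) := by
  refine ⟨hu.lt, by exact_mod_cast hu.pos.ne', fun i => ?_, fun a => ?_⟩
  · funext l
    have := congrFun (hu.periodic i) l
    simp only [Pi.smul_apply, smul_eq_mul, GeometricR.complexify] at this ⊢
    rw [← this]
    push_cast
    rfl
  · rw [det_window_complexify]
    exact_mod_cast (hu.window_pos a).ne'

theorem Represents.map_eval (h : Represents t u x) (lam : ℂ) :
    (Polynomial.evalRingHom lam).mapMatrix (g x) =
      foldMatrix n lam (bandEntry n (t : ℂ) (complexify u)) := by
  ext i j
  have h1 := h.totallyPositive.nondegenerate.bandEntry_add (i : ℕ) ((j : ℕ) - n)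
  rw [sub_add_cancel] at h1
  simp only [RingHom.mapMatrix_apply, Matrix.map_apply, h.g_apply, foldMatrix, Matrix.of_apply,
    bandEntry_complexify, ← h1]
  simp only [map_add, map_mul, Polynomial.coe_evalRingHom, Polynomial.eval_C, Polynomial.eval_X]

theorem Represents.det_ne_zero (h : Represents t u x) {lam : ℂ} (hl : lam ≠ 0)
    (hne : lam ≠ (-1) ^ m * (x.2 : ℂ)) :
    ((Polynomial.evalRingHom lam).mapMatrix (g x)).det ≠ 0 := by
  have hu := h.totallyPositive.complexify
  rw [h.map_eval]
  rw [← h.coe_eq] at hne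
  exact det_foldMatrix_ne_zero hu.pos hl bandEntry_of_not_lt hu.bandEntry_add
    fun y hy h0 => eq_zero_of_bandOp_eq_zero hu hl hne hy h0

/-- The inclusions are `bandOp_inSpan` and `exists_preimage`, read on one period. -/
theorem Represents.range_eval (h : Represents t u x) :
    LinearMap.range ((Polynomial.evalRingHom ((-1) ^ m * (x.2 : ℂ))).mapMatrix (g x)).mulVecLin =
      x.1.1 := by
  have hu := h.totallyPositive.complexify
  have hl := hu.twist_ne
  have : NeZero n := ⟨hu.pos.ne'⟩
  rw [h.map_eval, ← h.range_eq, ← h.coe_eq]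
  have hmv : ∀ w : ℤ → ℂ, QuasiPeriodic n ((-1) ^ m * (t : ℂ)) w →
      (foldMatrix n ((-1) ^ m * (t : ℂ)) (bandEntry n (t : ℂ) (complexify u))).mulVec
        (fun j : Fin n => w (j : ℕ)) =
        fun i : Fin n => bandOp n (bandEntry n (t : ℂ) (complexify u)) w (i : ℕ) := by
    intro w hw
    funext i
    rw [bandOp_eq_foldMatrix bandEntry_of_not_lt hw]
    rfl
  have hsp : ∀ f : Fin (m + 1) → ℂ, (columns n u).mulVec f =
      fun i : Fin n => ∑ l, complexify u (i : ℕ) l * f l := fun f => rfl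
  apply le_antisymm
  · rintro _ ⟨y, rfl⟩
    have hw := extend_quasiPeriodic (n := n) hl y
    obtain ⟨f, hf⟩ := hu.bandOp_inSpan hw
    have e := hmv _ hw
    simp only [extend_apply] at e
    refine ⟨fun l => f (Pi.single l 1), ?_⟩
    rw [Matrix.mulVecLin_apply, Matrix.mulVecLin_apply, e, hsp]
    funext i
    rw [hf, LinearMap.pi_apply_eq_sum_univ f]
    refine Finset.sum_congr rfl fun l _ => ?_
    rw [smul_eq_mul]
    congr 2
    funext j
    simp [Pi.single_apply, eq_comm]
  · rintro _ ⟨f, rfl⟩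
    obtain ⟨y, hy, hy'⟩ := hu.exists_preimage (x := fun i => ∑ l, complexify u i l * f l)
      ⟨∑ l, f l • LinearMap.proj l, fun i => by
        rw [LinearMap.sum_apply]
        exact Finset.sum_congr rfl fun l _ => mul_comm _ _⟩
    refine ⟨fun j : Fin n => y (j : ℕ), ?_⟩
    rw [Matrix.mulVecLin_apply, Matrix.mulVecLin_apply, hmv y hy, hy', hsp]

end Evaluation

/-! ### Uniqueness and exchange for the matrices g. -/

section Main

variable {m m₁ m₂ n k : ℕ}

theorem range_mulVecLin_mul {A B : Matrix (Fin n) (Fin n) ℂ} (hB : B.det ≠ 0) :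
    LinearMap.range (A * B).mulVecLin = LinearMap.range A.mulVecLin := by
  rw [Matrix.mulVecLin_mul]
  refine LinearMap.range_comp_of_range_eq_top _ ?_
  rw [LinearMap.range_eq_top]
  exact Matrix.mulVec_surjective_iff_isUnit.mpr
    ((Matrix.isUnit_iff_isUnit_det _).mpr (Ne.isUnit hB))

theorem eq_of_mul_eq_of_det_ne_zero {R : Type*} [CommRing R] [IsDomain R]
    {G A B : Matrix (Fin n) (Fin n) R} (hG : G.det ≠ 0) (h : G * A = G * B) : A = B := by
  have h1 := congrArg (G.adjugate * ·) h
  simp only [← Matrix.mul_assoc, Matrix.adjugate_mul, Matrix.smul_mul, Matrix.one_mul] at h1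
  ext i j
  have h2 := congrFun (congrFun h1 i) j
  rw [Matrix.smul_apply, Matrix.smul_apply, smul_eq_mul, smul_eq_mul] at h2
  exact mul_left_cancel₀ hG h2

theorem bandOp_ofReal (A : ℤ → ℤ → ℝ) (w : ℤ → ℝ) (i : ℤ) :
    bandOp n (fun i j => ((A i j : ℝ) : ℂ)) (fun l => ((w l : ℝ) : ℂ)) i =
      ((bandOp n A w i : ℝ) : ℂ) := by
  simp [bandOp]

/-- Equal signs would give `s = t`, opposite signs `s + t = 0`; positivity excludes the latter, so
distinct positive parameters have distinct special values. -/
theorem twist_mul_ne_complex {s t : ℂ} (hs : 0 < s) (ht : 0 < t) (h : s ≠ t) (a b : ℕ) :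
    (-1) ^ a * s ≠ (-1) ^ b * t := by
  have hst : s + t ≠ 0 := (add_pos hs ht).ne'
  rcases neg_one_pow_eq_or ℂ a with h1 | h1 <;> rcases neg_one_pow_eq_or ℂ b with h2 | h2 <;>
    rw [h1, h2] <;> intro h3
  · exact h (by linear_combination h3)
  · exact hst (by linear_combination h3)
  · exact hst (by linear_combination -h3)
  · exact h (by linear_combination -h3)

theorem Represents.exists_exchange {s t : ℝ} {u : ℤ → Fin (m₁ + 1) → ℝ} {v : ℤ → Fin (m₂ + 1) → ℝ}
    {x : X n (m₁ + 1)} {y : X n (m₂ + 1)} (hx : Represents s u x) (hy : Represents t v y)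
    (hst : s ≠ t) : ∃ p : Gr n (m₂ + 1) × Gr n (m₁ + 1), IsPositive (p.1, y.2) ∧
      IsPositive (p.2, x.2) ∧ g x * g y = g (p.1, y.2) * g (p.2, x.2) := by
  have : NeZero n := ⟨hx.totallyPositive.nondegenerate.pos.ne'⟩
  obtain ⟨v', u', hv', hu', hex⟩ :=
    GeometricR.exists_exchange hx.totallyPositive hy.totallyPositive hst
  obtain ⟨N', hN'⟩ := exists_represents t v' hv' y.2 hy.coe_eq
  obtain ⟨M', hM'⟩ := exists_represents s u' hu' x.2 hx.coe_eq
  refine ⟨(N', M'), hN'.isPositive, hM'.isPositive, ?_⟩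
  have heval : ∀ lam : ℂ, lam ≠ 0 → (Polynomial.evalRingHom lam).mapMatrix (g x * g y) =
      (Polynomial.evalRingHom lam).mapMatrix (g (N', y.2) * g (M', x.2)) := by
    intro lam hl
    rw [map_mul, map_mul, hx.map_eval, hy.map_eval, hN'.map_eval, hM'.map_eval]
    apply Matrix.mulVec_injective
    funext w i
    rw [foldMatrix_mul hl bandEntry_of_not_lt bandEntry_of_not_lt
      hy.totallyPositive.complexify.bandEntry_add,
      foldMatrix_mul hl bandEntry_of_not_lt bandEntry_of_not_lt hu'.complexify.bandEntry_add]
    refine Finset.sum_congr rfl fun j _ => ?_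
    simp only [bandEntry_complexify]
    rw [bandOp_ofReal, bandOp_ofReal, hex]
  ext1 i j
  -- Folding needs `λ ≠ 0`; agreement at all nonzero values suffices for polynomials.
  refine Polynomial.eq_of_infinite_eval_eq _ _ ((Set.finite_singleton (0 : ℂ)).infinite_compl.mono
    fun lam hl => ?_)
  exact congrFun (congrFun (heval lam hl) i) j

theorem IsPositive.det_eval_ne_zero (hk : 1 ≤ k) (hkn : k < n) {x : X n k} (hx : IsPositive x)
    {lam : ℂ} (hl : lam ≠ 0) (hne : lam ≠ (-1) ^ (k - 1) * (x.2 : ℂ)) :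
    ((Polynomial.evalRingHom lam).mapMatrix (g x)).det ≠ 0 := by
  obtain ⟨m, rfl⟩ : ∃ m, k = m + 1 := ⟨k - 1, by omega⟩
  obtain ⟨t, u, h⟩ := hx.exists_represents hkn
  exact h.det_ne_zero hl hne

theorem IsPositive.range_eval (hk : 1 ≤ k) (hkn : k < n) {x : X n k} (hx : IsPositive x) :
    LinearMap.range
      ((Polynomial.evalRingHom ((-1) ^ (k - 1) * (x.2 : ℂ))).mapMatrix (g x)).mulVecLin = x.1.1 := by
  obtain ⟨m, rfl⟩ : ∃ m, k = m + 1 := ⟨k - 1, by omega⟩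
  obtain ⟨t, u, h⟩ := hx.exists_represents hkn
  exact h.range_eval

theorem twist_coe_ne_zero (a : ℕ) (t : ℂˣ) : (-1) ^ a * (t : ℂ) ≠ 0 :=
  mul_ne_zero (pow_ne_zero _ (neg_ne_zero.mpr one_ne_zero)) t.ne_zero

theorem IsPositive.det_ne_zero (hk : 1 ≤ k) (hkn : k < n) {x : X n k} (hx : IsPositive x) :
    (g x).det ≠ 0 := by
  intro h
  have h0 := twist_coe_ne_zero (k - 1) x.2
  -- Twice the special value is nonzero and not special.
  refine hx.det_eval_ne_zero hk hkn (lam := 2 * ((-1) ^ (k - 1) * (x.2 : ℂ)))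
    (mul_ne_zero two_ne_zero h0) (fun e => h0 (by linear_combination e)) ?_
  rw [← RingHom.map_det, h, map_zero]

/-- The leftmost factor of a product is determined by the product. -/
theorem IsPositive.eq_of_g_mul_eq (hk : 1 ≤ k) (hkn : k < n) {t : ℂˣ} {M N : Gr n k}
    (hM : IsPositive (M, t)) (hN : IsPositive (N, t)) {A B : Matrix (Fin n) (Fin n) ℂ[X]}
    (hA : ((Polynomial.evalRingHom ((-1) ^ (k - 1) * (t : ℂ))).mapMatrix A).det ≠ 0)
    (hB : ((Polynomial.evalRingHom ((-1) ^ (k - 1) * (t : ℂ))).mapMatrix B).det ≠ 0)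
    (h : g (M, t) * A = g (N, t) * B) : M = N ∧ A = B := by
  have hMN : M = N := by
    have h1 := congrArg (fun C => LinearMap.range
      ((Polynomial.evalRingHom ((-1) ^ (k - 1) * (t : ℂ))).mapMatrix C).mulVecLin) h
    simp only [map_mul] at h1
    rw [range_mulVecLin_mul hA, range_mulVecLin_mul hB] at h1
    exact Subtype.ext ((hM.range_eval hk hkn).symm.trans (h1.trans (hN.range_eval hk hkn)))
  subst hMN
  exact ⟨rfl, eq_of_mul_eq_of_det_ne_zero (hM.det_ne_zero hk hkn) h⟩

theorem gProd_succ {d : ℕ} {k : Fin (d + 1) → ℕ} (x : (i : Fin (d + 1)) → X n (k i)) :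
    gProd x = g (x 0) * gProd (fun i : Fin d => x i.succ) := by
  simp [gProd, List.ofFn_succ]

theorem det_eval_gProd_ne_zero {lam : ℂ} (hl : lam ≠ 0) {d : ℕ} :
    ∀ {k : Fin d → ℕ}, (∀ i, 1 ≤ k i ∧ k i < n) → ∀ {x : (i : Fin d) → X n (k i)},
      (∀ i, IsPositive (x i)) → (∀ i, lam ≠ (-1) ^ (k i - 1) * ((x i).2 : ℂ)) →
      ((Polynomial.evalRingHom lam).mapMatrix (gProd x)).det ≠ 0 := by
  induction d with
  | zero => intro k _ x _ _; simp [gProd]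
  | succ d ih =>
    intro k hk x hx hne
    rw [gProd_succ, map_mul, Matrix.det_mul]
    exact mul_ne_zero ((hx 0).det_eval_ne_zero (hk 0).1 (hk 0).2 hl (hne 0))
      (ih (fun i => hk i.succ) (fun i => hx i.succ) fun i => hne i.succ)

theorem eq_of_gProd_eq {d : ℕ} : ∀ {k : Fin d → ℕ}, (∀ i, 1 ≤ k i ∧ k i < n) →
    ∀ {t : Fin d → ℂˣ} {M N : (i : Fin d) → Gr n (k i)},
      (fun i => (M i, t i)) ∈ positiveLocus n k → (fun i => (N i, t i)) ∈ positiveLocus n k →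
      gProd (fun i => ((M i, t i) : X n (k i))) = gProd (fun i => ((N i, t i) : X n (k i))) →
      ∀ i, M i = N i := by
  induction d with
  | zero => intro k _ t M N _ _ _ i; exact i.elim0
  | succ d ih =>
    intro k hk t M N hM hN h
    -- At the special value of the first factor all remaining factors are invertible, so the range
    -- there reveals the first subspace.
    have hne : ∀ i : Fin d, (-1) ^ (k 0 - 1) * (t 0 : ℂ) ≠ (-1) ^ (k i.succ - 1) * (t i.succ : ℂ) :=
      fun i => twist_mul_ne_complex (hM.1 0).1 (hM.1 i.succ).1
        (fun e => (Fin.succ_ne_zero i) (hM.2 (Units.ext e)).symm) _ _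
    rw [gProd_succ, gProd_succ] at h
    obtain ⟨h0, h1⟩ := (hM.1 0).eq_of_g_mul_eq (hk 0).1 (hk 0).2 (hN.1 0)
      (det_eval_gProd_ne_zero (twist_coe_ne_zero _ _) (fun i => hk i.succ)
        (fun i => hM.1 i.succ) hne)
      (det_eval_gProd_ne_zero (twist_coe_ne_zero _ _) (fun i => hk i.succ)
        (fun i => hN.1 i.succ) hne) h
    have h2 := ih (fun i => hk i.succ) (t := fun i => t i.succ) (M := fun i => M i.succ)
      (N := fun i => N i.succ) ⟨fun i => hM.1 i.succ, hM.2.comp (Fin.succ_injective d)⟩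
      ⟨fun i => hN.1 i.succ, hN.2.comp (Fin.succ_injective d)⟩ h1
    exact Fin.cases h0 h2

theorem IsPositive.exists_exchange {k₁ k₂ : ℕ} (hk₁ : 1 ≤ k₁) (hk₁n : k₁ < n) (hk₂ : 1 ≤ k₂)
    (hk₂n : k₂ < n) {x : X n k₁} {y : X n k₂} (hx : IsPositive x) (hy : IsPositive y)
    (hne : x.2 ≠ y.2) : ∃ p : Gr n k₂ × Gr n k₁, IsPositive (p.1, y.2) ∧
      IsPositive (p.2, x.2) ∧ g x * g y = g (p.1, y.2) * g (p.2, x.2) := by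
  obtain ⟨m₁, rfl⟩ : ∃ m, k₁ = m + 1 := ⟨k₁ - 1, by omega⟩
  obtain ⟨m₂, rfl⟩ : ∃ m, k₂ = m + 1 := ⟨k₂ - 1, by omega⟩
  obtain ⟨s, u, h⟩ := hx.exists_represents hk₁n
  obtain ⟨t, v, h'⟩ := hy.exists_represents hk₂n
  refine h.exists_exchange h' ?_
  rintro rfl
  exact hne (Units.ext (h.coe_eq.symm.trans h'.coe_eq))

end Main

end GeometricR

theorem mainTheorem5 (n : ℕ) (hn : 2 ≤ n) :
    (∀ (d : ℕ) (k : Fin d → ℕ), (∀ i, 1 ≤ k i ∧ k i < n) →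
      ∀ (t : Fin d → ℂˣ) (M N : (i : Fin d) → GeometricR.Gr n (k i)),
        (fun i => (M i, t i)) ∈ GeometricR.positiveLocus n k →
        (fun i => (N i, t i)) ∈ GeometricR.positiveLocus n k →
        GeometricR.gProd (fun i => ((M i, t i) : GeometricR.X n (k i))) =
          GeometricR.gProd (fun i => ((N i, t i) : GeometricR.X n (k i))) →
        ∀ i, M i = N i) ∧
    (∀ k₁ k₂ : ℕ, 1 ≤ k₁ → k₁ < n → 1 ≤ k₂ → k₂ < n →
      ∀ (s t : ℂˣ) (M : GeometricR.Gr n k₁) (N : GeometricR.Gr n k₂), s ≠ t →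
        GeometricR.IsPositive (M, s) → GeometricR.IsPositive (N, t) →
        ∃! p : GeometricR.Gr n k₂ × GeometricR.Gr n k₁,
          GeometricR.IsPositive (p.1, t) ∧ GeometricR.IsPositive (p.2, s) ∧
          GeometricR.g (M, s) * GeometricR.g (N, t) =
            GeometricR.g (p.1, t) * GeometricR.g (p.2, s)) := by
  refine ⟨fun d k hk t M N hM hN h => GeometricR.eq_of_gProd_eq hk hM hN h,
    fun k₁ k₂ hk₁ hk₁n hk₂ hk₂n s t M N hst hM hN => ?_⟩
  obtain ⟨p, hp₁, hp₂, hp⟩ := hM.exists_exchange hk₁ hk₁n hk₂ hk₂n hN hst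
  refine ⟨p, ⟨hp₁, hp₂, hp⟩, ?_⟩
  rintro q ⟨hq₁, hq₂, hq⟩
  have hne := GeometricR.twist_mul_ne_complex hN.1 hM.1 (fun e => hst (Units.ext e).symm)
    (k₂ - 1) (k₁ - 1)
  have hdet : ∀ P : GeometricR.Gr n k₁, GeometricR.IsPositive (P, s) →
      ((Polynomial.evalRingHom ((-1) ^ (k₂ - 1) * (t : ℂ))).mapMatrix
        (GeometricR.g (P, s))).det ≠ 0 := fun P hP =>
    hP.det_eval_ne_zero hk₁ hk₁n (GeometricR.twist_coe_ne_zero _ _) hne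
  obtain ⟨h₁, h₂⟩ := hq₁.eq_of_g_mul_eq hk₂ hk₂n hp₁ (hdet _ hq₂) (hdet _ hp₂) (hq.symm.trans hp)
  -- After cancelling the left factor a single g remains on each side, which determines its
  -- subspace.
  have h₃ := (hq₂.eq_of_g_mul_eq hk₁ hk₁n hp₂ (A := 1) (B := 1) (by simp) (by simp)
    (by rw [h₂])).1
  exact Prod.ext h₁ h₃
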